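/- Let $n\ge 2$. For $m\ge 0$ let $\mathfrak L_m(x_1,\dots,x_m)=\sum_{0<k_1<\cdots<k_m}\frac{x_1^{k_1}\cdots x_m^{k_m}}{k_1\cdots k_m}$ $(|x_i|<1)$ be the multiple logarithm (so $\mathfrak L_0=1$), together with its analytic continuation. For $1\le a\le b\le n$ put $$F_{ab}(\mathbf x)=\mathfrak L_{b-a}\Bigl(\frac{1-x_ax_{a+1}}{1-x_a},\dots,\frac{1-x_a\cdots x_b}{1-x_a\cdots x_{b-1}}\Bigr),\qquad F_{aa}=1 .$$ Let $S'_n\subset\mathbb C^n$ be the complement of the union of all components $\mathcal D_{j0}=\{x_j=0\}$ $(1\le j\le n)$ and $\mathcal D_{ab}=\{x_a\cdots x_b=1\}$ $(1\le a\le b\le n)$. Write $v_0=1$, $v_k=x_1\cdots x_k$. The principal germ of $F_{ab}$ at $\mathbf x$ is obtained by continuing the power series of $\mathfrak L_{b-a}$ along the straight segment from $0$ to the argument displayed above. For a set $A\subset \mathbb C^n$, a loop $q$ in $S'_n$ based at $\mathbf x$ is said to turn once around a component $\mathcal D$ (with defining function $f=x_j$, resp. $f=1-x_a\cdots x_b$)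 and no other component, through $A$, if it is the boundary $q(t)=\varphi(e^{2\pi i t})$ of a continuous map $\varphi$ of the closed unit disc into $\mathbb C^n$ with $\varphi(z)\in S'_n$ for $z\ne0$, with $\varphi(0)\in\mathcal D$ on no other component, with $\varphi((0,1])\subset A$, and if $\int_q d\log f=2\pi i$. The regions used are: * $T_m$ $(1\le m<n)$: $v_m\notin[v_0,v_n]$, and the triangle with vertices $v_0,v_m,v_n$ contains no $v_i$, $1\le i<n$, $i\ne m$. * $P_j$ $(1\le j<n)$: $v_{n-1}\notin[v_0,v_n]$; if $j<n-1$, then $v_0,v_j,v_{j+1},\dots,v_n$ are in this order the vertices of a convex polygon traversed clockwise, i.e. every triple of them, in this order, is clockwise; and the convex hull of $v_0,v_j,\dots,v_n$ contains none of $v_1,\dots,v_{j-1}$. Let $p$ be any path in $S'_n$ from $\mathbf x$ to any point $\mathbf x'$. Let $F_{ab}$ also denote the germ at $\mathbf x'$ obtained by continuing the principal germ at $\mathbf x$ along $p$, and let $\Theta(q)F_{ab}$ be the germ obtained by continuing it along $q$ followed by $p$. Then all the continuations occurring below exist, and, near $\mathbf x'$: 1. if $1\le j<n$ and $q$ turns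 once around $\mathcal D_{j0}$ and no other component, through $P_j$ (so $\int_q dx_j/x_j=2\pi i$), then $$(\Theta(q)-\mathrm{id})F_{1n}=-2\pi i\sum_{s=j}^{n-1}F_{1s}F_{s+1,n};$$ 2. if $1\le j<n$ and $q$ turns once around $\mathcal D_{1j}$ and no other component, through $T_j$ (so $\int_q d\log(1-x_1\cdots x_j)=2\pi i$), then $$(\Theta(q)-\mathrm{id})F_{1n}=2\pi i\,F_{1j}F_{j+1,n};$$ 3. if $2\le j\le n$ and $q$ turns once around $\mathcal D_{jn}$ and no other component, through $T_{j-1}$ (so $\int_q d\log(1-x_j\cdots x_n)=2\pi i$), then $$(\Theta(q)-\mathrm{id})F_{1n}=-2\pi i\,F_{1,j-1}F_{jn}.$$ -/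

import Mathlib

open Filter Topology

noncomputable section

namespace MultipleLog

/-- The power series of the multiple logarithm of depth `m`,
`∑_{0 < k₁ < ⋯ < k_m} x₁^{k₁} ⋯ x_m^{k_m} / (k₁ ⋯ k_m)`, which converges absolutely for `|x_i| < 1`
(for `m = 0` it is the constant `1`). -/
def multilogSeries (m : ℕ) (x : Fin m → ℂ) : ℂ :=
  ∑' k : {k : Fin m → ℕ // StrictMono k ∧ ∀ i, 0 < k i},
    ∏ i : Fin m, x i ^ (k.1 i) / ((k.1 i : ℕ) : ℂ)

/-- The germ of `g` at `γ 1` is the analytic continuation along `γ` of the germ of `f` at `γ 0`: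
there are germs of holomorphic functions `G t` at the points `γ t` which are locally constant
in `t` and start with `f` and end with `g`. -/
def ContinuesAlong {m : ℕ} (γ : unitInterval → Fin m → ℂ) (f g : (Fin m → ℂ) → ℂ) : Prop :=
  ∃ G : unitInterval → (Fin m → ℂ) → ℂ,
    (∀ t, AnalyticAt ℂ (G t) (γ t)) ∧
    (∀ t, ∀ᶠ s in 𝓝 t, G s =ᶠ[𝓝 (γ s)] G t) ∧
    G 0 =ᶠ[𝓝 (γ 0)] f ∧ G 1 =ᶠ[𝓝 (γ 1)] g

/-- The principal germ of the multiple logarithm `𝔏_m` at `y`: the continuation of the power series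
along the straight segment from `0` to `y`. -/
def IsPrincipalMultilog (m : ℕ) (y : Fin m → ℂ) (g : (Fin m → ℂ) → ℂ) : Prop :=
  ContinuesAlong (fun t => ((t : ℝ) : ℂ) • y) (multilogSeries m) g

variable {n : ℕ}

/-- `x_a x_{a+1} ⋯ x_b` with coordinates numbered `1, …, n` (the empty product `1` if `b < a`). -/
def block (x : Fin n → ℂ) (a b : ℕ) : ℂ :=
  ∏ i : Fin n with a ≤ i.val + 1 ∧ i.val + 1 ≤ b, x i

/-- The partial product `v_k = x₁ ⋯ x_k`, with `v₀ = 1`. -/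
def partialProd (x : Fin n → ℂ) (k : ℕ) : ℂ := block x 1 k

/-- The point `((1 - x_a x_{a+1})/(1 - x_a), …, (1 - x_a⋯x_b)/(1 - x_a⋯x_{b-1}))`. -/
def ratioPoint (a b : ℕ) (x : Fin n → ℂ) : Fin (b - a) → ℂ :=
  fun i => (1 - block x a (a + i.val + 1)) / (1 - block x a (a + i.val))

/-- The principal germ at `x` of `F_{ab}(x) = 𝔏_{b-a}(ratioPoint a b x)`. -/
def IsPrincipalF (a b : ℕ) (x : Fin n → ℂ) (f : (Fin n → ℂ) → ℂ) : Prop :=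
  ∃ g, IsPrincipalMultilog (b - a) (ratioPoint a b x) g ∧
    f =ᶠ[𝓝 x] fun z => g (ratioPoint a b z)

/-- `g` is the germ at the end `x'` of the path `γ` obtained by continuing along `γ` the principal
germ of `F_{ab}` at the starting point `x`. -/
def IsBranchF (a b : ℕ) {x x' : Fin n → ℂ} (γ : Path x x') (g : (Fin n → ℂ) → ℂ) : Prop :=
  ∃ f, IsPrincipalF a b x f ∧ ContinuesAlong (fun t => γ t) f g

/-- Names for the irreducible components of the divisor `X'_n`:
`zero j` for `{x_j = 0}` and `one a b` for `{x_a ⋯ x_b = 1}`. -/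
inductive Component where
  | zero (j : ℕ)
  | one (a b : ℕ)

namespace Component

/-- The range of the indices. -/
def Valid (n : ℕ) : Component → Prop
  | zero j => 1 ≤ j ∧ j ≤ n
  | one a b => 1 ≤ a ∧ a ≤ b ∧ b ≤ n

/-- The defining function: `x_j` for `zero j`, and `1 - x_a ⋯ x_b` for `one a b`. -/
def eqn (D : Component) (x : Fin n → ℂ) : ℂ :=
  match D with
  | zero j => block x j j
  | one a b => 1 - block x a b

end Component

/-- `S'_n`, the complement of `X'_n` in `ℂⁿ`. -/
def regularSet (n : ℕ) : Set (Fin n → ℂ) :=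
  {x | ∀ D : Component, D.Valid n → D.eqn x ≠ 0}

/-- `q` is a loop at `x` that turns around `D` once in the positive direction and around no other
component, and reaches `D` through the region `A`: it is the boundary of a disc which meets `X'_n`
only at its centre, in a point of `D` that lies on no other component, the radius from `x` to the
centre stays in `A` until it arrives at the centre, and `∫_q dlog (D.eqn) = 2πi` (written as the
increment of a logarithm of `D.eqn` along `q`). -/
def TurnsOnceAround (D : Component) (A : Set (Fin n → ℂ)) {x : Fin n → ℂ} (q : Path x x) : Prop :=
  (∃ φ : ℂ → Fin n → ℂ,
    ContinuousOn φ (Metric.closedBall 0 1) ∧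
    (∀ z ∈ Metric.closedBall (0 : ℂ) 1, z ≠ 0 → φ z ∈ regularSet n) ∧
    D.eqn (φ 0) = 0 ∧
    (∀ D' : Component, D'.Valid n → D' ≠ D → D'.eqn (φ 0) ≠ 0) ∧
    (∀ r : ℝ, 0 < r → r ≤ 1 → φ (r : ℂ) ∈ A) ∧
    (∀ t : unitInterval, q t = φ (Complex.exp (2 * Real.pi * Complex.I * ((t : ℝ) : ℂ))))) ∧
  ∃ l : unitInterval → ℂ, Continuous l ∧ (∀ t, Complex.exp (l t) = D.eqn (q t)) ∧
    l 1 - l 0 = 2 * Real.pi * Complex.I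

/-- The points `x` for which `v_m` is not on the segment `[v₀, v_n]` and the triangle with vertices
`v₀, v_m, v_n` contains no other `v_i`. -/
def triangleRegion (n m : ℕ) : Set (Fin n → ℂ) :=
  {x | partialProd x m ∉ segment ℝ (partialProd x 0) (partialProd x n) ∧
    ∀ i, 1 ≤ i → i < n → i ≠ m →
      partialProd x i ∉ convexHull ℝ {partialProd x 0, partialProd x m, partialProd x n}}

/-- The triangle `u, v, w` in the plane is traversed clockwise. -/
def Clockwise (u v w : ℂ) : Prop := ((w - u) / (v - u)).im < 0

/-- The points `x` for which `v₀, v_j, v_{j+1}, …, v_n` are, in this order, the vertices of a convex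
polygon traversed clockwise (every triple is clockwise) that contains none of `v₁, …, v_{j-1}`.
If `j = n - 1` the polygon is a triangle, and instead of its orientation only
`v_{n-1} ∉ [v₀, v_n]` is required. -/
def polygonRegion (n j : ℕ) : Set (Fin n → ℂ) :=
  {x | partialProd x (n - 1) ∉ segment ℝ (partialProd x 0) (partialProd x n) ∧
    (j + 1 < n → ∀ a b c : ℕ, (a = 0 ∨ j ≤ a) → j ≤ b → a < b → b < c → c ≤ n →
      Clockwise (partialProd x a) (partialProd x b) (partialProd x c)) ∧
    ∀ i, 1 ≤ i → i < j →
      partialProd x i ∉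
        convexHull ℝ (insert (partialProd x 0) (partialProd x '' Set.Icc j n))}

end MultipleLog

end

/-! Write v_k for the partial products. The products of consecutive arguments of the logarithm in
F_ab telescope to (v_b - v_{a-1}) / (v_{a+i} - v_{a-1}), so F_ab is the iterated integral I(v_{a-1};
v_a, …, v_{b-1}; v_b) of the forms ds/(v_i - s) along the segment from v_{a-1} to v_b
(`multilogSeries_eq_iter`, `isPrincipalF_intF`). Everything then takes place in the space of
configurations (p_0, …, p_n) of points of the plane, where I is invariant under affine maps.

The differential of I is a sum of integrals with one singular point dropped, times differences of
the forms dlog(p_{k+1} - p_k) (`hasFDerivAt_polyInt`). By induction on the depth, I continues along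
every path on which the points stay distinct (`exists_cont_polyInt`). Homotopies through such paths
may therefore be used freely, also with moving end points, as long as the germs at both ends remain
the given analytic functions (`Cont.homotopy`, `cont_confInt_homotopy`).

On the divisor x_{m+1}⋯x_n = 1 the end point p_n meets the singular point p_m. As a function of its
end point z, the integral is A(z) - c·log(z - p_m)·g(z) near p_m, with A holomorphic, c = I(p_0; …;
p_m) and g(z) = I(p_m; …; z) (`exists_log_decomposition`). One turn of the logarithm gives -2πi·c·g.
A given loop is shrunk to a small radius and deformed to a round circle through logarithms of p_m -
p_n (`cont_confInt_collision`). The triangle condition keeps all segments of integration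
unobstructed on the radius of the disc. The divisor x_1⋯x_m = 1 is the same situation for the path
run backwards; the signs of `polyInt_reverse` turn minus into plus.

On x_j = 0 the points p_j, …, p_n shrink together to 0, and the loop is a full rotation of this
cluster (`cont_confInt_cluster`). Normalize p_0 = 1, p_n = 0. If p_j is first pulled away from the
rest of the cluster, the rotation of the cluster is the rotation of p_j around the later points
followed by the rotation of the cluster without p_j (`cont_clusterGerm_of_succ`). During its
rotation p_j crosses the segment from p_0 to p_n once. The effect of that crossing is read off from
a small circle of p_j around p_n, where the collision formula applies, and it is -2πi·I(p_0; …;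
p_j)·I(p_j; …; p_n) (`cont_confInt_put_rotate`). Induction on the number of points in the cluster
produces the sum over s. Convexity and clockwise orientation of the polygon keep p_j on one side of
the other points and make the integrals in this sum unobstructed.

Finally, a formula for the loop q at x is transported along p: sums and products of germs continue
termwise (`exists_branches`). -/

open Filter Topology ComplexConjugate

noncomputable section

namespace MultipleLog

/-! ### Germs of analytic functions along paths: continuation, uniqueness, homotopy -/

section Germs

variable {E : Type*} [NormedAddCommGroup E] [NormedSpace ℂ E]
  {F : Type*} [NormedAddCommGroup F] [NormedSpace ℂ F]

/-- A function with analytic derivative is analytic. -/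
theorem analyticAt_of_hasFDerivAt {f : E → ℂ} {ω : E → E →L[ℂ] ℂ} {x : E}
    (hω : AnalyticAt ℂ ω x) (hf : ∀ᶠ y in 𝓝 x, HasFDerivAt f (ω y) y) : AnalyticAt ℂ f x := by
  obtain ⟨p, r₀, hp₀⟩ := hω
  obtain ⟨δ, hδ, hfδ⟩ := Metric.eventually_nhds_iff_ball.1 hf
  set r : ENNReal := min r₀ (ENNReal.ofReal δ) with hr
  have hrpos : 0 < r := lt_min hp₀.r_pos (by simpa using hδ)
  have hp : HasFPowerSeriesOnBall ω p x r := hp₀.mono hrpos (min_le_left _ _)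
  have hfr : ∀ y ∈ Metric.eball x r, HasFDerivAt f (ω y) y := by
    intro y hy
    apply hfδ
    have : edist y x < ENNReal.ofReal δ := lt_of_lt_of_le hy (min_le_right _ _)
    rwa [edist_dist, ENNReal.ofReal_lt_ofReal_iff hδ] at this
  -- Termwise integration of the series of `ω` along rays: degree n + 1 carries the coefficient of
  -- degree n divided by n + 1. The `if` corrects the convention 0⁻¹ = 0, so that the constant term
  -- f x has factor 1.
  let q : FormalMultilinearSeries ℂ E ℂ := fun n =>
    ((n : ℂ) ^ (-1 : ℤ) + if n = 0 then 1 else 0) • (p.unshift (f x)) n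
  have hq0 : ∀ h : E, (q 0) (fun _ => h) = f x := by
    intro h
    simp only [q, Nat.cast_zero, if_true]
    simp
    rfl
  have hqs : ∀ n (h : E), (q (n + 1)) (fun _ => h) = (p n (fun _ => h)) h / (n + 1) := by
    intro n h
    simp [q, FormalMultilinearSeries.unshift, div_eq_inv_mul]
    left; rfl
  have hqn : ∀ n, ‖q (n + 1)‖ ≤ ‖p n‖ := by
    intro n
    have h1 : ‖(p.unshift (f x)) (n + 1)‖ = ‖p n‖ := by
      exact (continuousMultilinearCurryRightEquiv' ℂ n E ℂ).symm.norm_map _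
    simp only [q, norm_smul, h1]
    have : ‖(((n + 1 : ℕ) : ℂ) ^ (-1 : ℤ) + if n + 1 = 0 then 1 else 0)‖ ≤ 1 := by
      simp only [Nat.add_eq_zero_iff, one_ne_zero, and_false, if_false, add_zero, zpow_neg_one,
        norm_inv, Complex.norm_natCast]
      apply inv_le_one_of_one_le₀
      push_cast; linarith [n.cast_nonneg (α := ℝ)]
    calc _ ≤ 1 * ‖p n‖ := by gcongr
      _ = _ := one_mul _
  refine ⟨q, r, ?_, hrpos, ?_⟩
  · refine le_trans hp.r_le ?_
    apply ENNReal.le_of_forall_nnreal_lt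
    intro s hs
    obtain ⟨C, hC, hCb⟩ := p.norm_mul_pow_le_of_lt_radius hs
    apply q.le_radius_of_bound (max (‖q 0‖) (C * s))
    intro n
    cases n with
    | zero => simp
    | succ n =>
      refine le_trans ?_ (le_max_right _ _)
      calc ‖q (n + 1)‖ * (s : ℝ) ^ (n + 1) ≤ ‖p n‖ * (s : ℝ) ^ (n + 1) := by gcongr; exact hqn n
        _ = ‖p n‖ * (s : ℝ) ^ n * s := by ring
        _ ≤ C * s := by gcongr; exact hCb n
  · intro h hh
    have hmem : ∀ t ∈ Set.Icc (0 : ℝ) 1, (t : ℂ) • h ∈ Metric.eball (0 : E) r := by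
      intro t ht
      have h1 : ‖(t : ℂ) • h‖ ≤ ‖h‖ := by
        rw [norm_smul, Complex.norm_real, Real.norm_of_nonneg ht.1]
        exact mul_le_of_le_one_left (norm_nonneg _) ht.2
      have h2 : ‖(t : ℂ) • h‖₊ ≤ ‖h‖₊ := h1
      simp only [Metric.mem_eball, edist_zero_right] at hh ⊢
      exact lt_of_le_of_lt (ENNReal.coe_le_coe.2 h2) hh
    set a : ℕ → ℂ := fun n => (p n (fun _ => h)) h with ha
    have hsum : Summable fun n => ‖a n‖ := by
      have h1 : Summable fun n => ‖p n fun _ => h‖ :=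
        p.summable_norm_apply (Metric.eball_subset_eball hp.r_le hh)
      refine Summable.of_nonneg_of_le (fun _ => norm_nonneg _) (fun n => ?_) (h1.mul_right ‖h‖)
      exact (p n fun _ => h).le_opNorm h
    have hser : ∀ t ∈ Set.Icc (0 : ℝ) 1,
        HasSum (fun n => (t : ℂ) ^ n * a n) (ω (x + (t : ℂ) • h) h) := by
      intro t ht
      have h1 := hp.hasSum (hmem t ht)
      have h2 := (ContinuousLinearMap.apply ℂ ℂ h).hasSum h1
      refine h2.congr_fun ?_ |> fun z => z
      intro n
      simp only [ContinuousLinearMap.apply_apply, ha]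
      have : (fun _ : Fin n => (t : ℂ) • h) = fun i => (fun _ : Fin n => (t : ℂ)) i • (fun _ => h) i := rfl
      rw [this, ContinuousMultilinearMap.map_smul_univ]
      simp
    -- The fundamental theorem of calculus on the ray from x to x + h; the integrand is the
    -- derivative of f along the ray.
    have hint : ∫ t in (0 : ℝ)..1, (∑' n, (t : ℂ) ^ n * a n) = f (x + h) - f x := by
      have hder : ∀ t ∈ Set.uIcc (0 : ℝ) 1,
          HasDerivAt (fun t : ℝ => f (x + (t : ℂ) • h)) (ω (x + (t : ℂ) • h) h) t := by
        intro t ht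
        rw [Set.uIcc_of_le zero_le_one] at ht
        have h1 : HasFDerivAt f (ω (x + (t : ℂ) • h)) (x + (t : ℂ) • h) := by
          apply hfr
          have := hmem t ht
          simp only [Metric.mem_eball, edist_zero_right] at this ⊢
          simpa [edist_eq_enorm_sub] using this
        have h2 : HasDerivAt (fun z : ℂ => x + z • h) h (t : ℂ) := by
          simpa using ((hasDerivAt_id (t : ℂ)).smul_const h).const_add x
        exact (h1.comp_hasDerivAt (t : ℂ) h2).comp_ofReal
      have hcont : ContinuousOn (fun t : ℝ => ω (x + (t : ℂ) • h) h) (Set.uIcc 0 1) := by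
        intro t ht
        rw [Set.uIcc_of_le zero_le_one] at ht
        have h1 : ContinuousAt ω (x + (t : ℂ) • h) := by
          apply (hp.analyticAt_of_mem _).continuousAt
          have := hmem t ht
          simp only [Metric.mem_eball, edist_zero_right] at this ⊢
          simpa [edist_eq_enorm_sub] using this
        have h2 : ContinuousAt (fun t : ℝ => x + (t : ℂ) • h) t := by fun_prop
        exact ((ContinuousAt.comp (f := fun t : ℝ => x + (t : ℂ) • h) h1 h2).clm_apply
          continuousAt_const).continuousWithinAt
      have key := intervalIntegral.integral_eq_sub_of_hasDerivAt hder hcont.intervalIntegrable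
      simp only [Complex.ofReal_one, one_smul, Complex.ofReal_zero, zero_smul, add_zero] at key
      rw [← key]
      apply intervalIntegral.integral_congr
      intro t ht
      rw [Set.uIcc_of_le zero_le_one] at ht
      exact (hser t ht).tsum_eq
    have hts : HasSum (fun n => a n / (n + 1)) (f (x + h) - f x) := by
      rw [← hint]
      have := intervalIntegral.hasSum_integral_of_dominated_convergence
        (μ := MeasureTheory.volume) (a := (0:ℝ)) (b := 1)
        (F := fun n (t : ℝ) => (t : ℂ) ^ n * a n) (f := fun t : ℝ => ∑' n, (t : ℂ) ^ n * a n)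
        (fun n _ => ‖a n‖) (fun n => by
          apply Continuous.aestronglyMeasurable; fun_prop) (fun n => by
          filter_upwards with t ht
          rw [Set.uIoc_of_le zero_le_one] at ht
          rw [norm_mul, norm_pow, Complex.norm_real, Real.norm_of_nonneg ht.1.le]
          exact mul_le_of_le_one_left (norm_nonneg _) (pow_le_one₀ ht.1.le ht.2))
        (by filter_upwards with t ht using hsum) (by simp) (by
          filter_upwards with t ht
          rw [Set.uIoc_of_le zero_le_one] at ht
          have := hser t ⟨ht.1.le, ht.2⟩
          rwa [← this.tsum_eq] at this)
      refine this.congr_fun ?_ |> fun z => z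
      intro n
      rw [intervalIntegral.integral_mul_const]
      have : ∫ t in (0:ℝ)..1, (t : ℂ) ^ n = ((∫ t in (0:ℝ)..1, t ^ n : ℝ) : ℂ) := by
        rw [← intervalIntegral.integral_ofReal]; simp
      rw [this, integral_pow]
      push_cast
      simp; ring
    rw [← hasSum_nat_add_iff' 1]
    simpa [hqs, hq0] using hts

/-- `G t`, for `t ∈ S`, are germs of analytic functions at the points `γ t` that are locally
constant in `t`. -/
def IsGermFamily {T : Type*} [TopologicalSpace T] (S : Set T) (γ : T → E) (G : T → E → F) : Prop :=
  (∀ t ∈ S, AnalyticAt ℂ (G t) (γ t)) ∧ ∀ t ∈ S, ∀ᶠ s in 𝓝[S] t, G s =ᶠ[𝓝 (γ s)] G t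

/-- `g` is the analytic continuation of `f` along `γ` restricted to `[a, b]`. -/
def Cont (γ : ℝ → E) (a b : ℝ) (f g : E → F) : Prop :=
  ∃ G, IsGermFamily (Set.Icc a b) γ G ∧ G a =ᶠ[𝓝 (γ a)] f ∧ G b =ᶠ[𝓝 (γ b)] g

section Family

variable {T : Type*} [TopologicalSpace T] {S : Set T} {γ : T → E} {G : T → E → F}

theorem IsGermFamily.comp {T' : Type*} [TopologicalSpace T'] {S' : Set T'} (h : IsGermFamily S γ G)
    {τ : T' → T} (hτ : ContinuousOn τ S') (hm : Set.MapsTo τ S' S) :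
    IsGermFamily S' (γ ∘ τ) (G ∘ τ) := by
  refine ⟨fun t ht => h.1 _ (hm ht), fun t ht => ?_⟩
  have h1 : Tendsto τ (𝓝[S'] t) (𝓝[S] (τ t)) := (hτ t ht).tendsto_nhdsWithin hm
  exact h1.eventually (h.2 _ (hm ht))

theorem IsGermFamily.mono {S' : Set T} (h : IsGermFamily S γ G) (hS : S' ⊆ S) :
    IsGermFamily S' γ G :=
  h.comp continuousOn_id hS

theorem IsGermFamily.const {f : E → F} (hf : ∀ t ∈ S, AnalyticAt ℂ f (γ t)) :
    IsGermFamily S γ (fun _ => f) :=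
  ⟨hf, fun _ _ => Eventually.of_forall fun _ => EventuallyEq.rfl⟩

theorem IsGermFamily.congr_path {γ' : T → E} (h : IsGermFamily S γ G) (hγ : Set.EqOn γ γ' S) :
    IsGermFamily S γ' G := by
  refine ⟨fun t ht => hγ ht ▸ h.1 t ht, fun t ht => ?_⟩
  filter_upwards [h.2 t ht, self_mem_nhdsWithin] with s hs hs'
  rwa [← hγ hs']

theorem IsGermFamily.pullback {E' : Type*} [NormedAddCommGroup E'] [NormedSpace ℂ E']
    {γ' : T → E'} {h : E' → E} (hG : IsGermFamily S γ G) (hh : ∀ t ∈ S, AnalyticAt ℂ h (γ' t))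
    (hγ : ∀ t ∈ S, h (γ' t) = γ t) : IsGermFamily S γ' (fun t => G t ∘ h) := by
  refine ⟨fun t ht => AnalyticAt.comp (by rw [hγ t ht]; exact hG.1 t ht) (hh t ht), fun t ht => ?_⟩
  filter_upwards [hG.2 t ht, self_mem_nhdsWithin] with s hs hs'
  have h1 : Tendsto h (𝓝 (γ' s)) (𝓝 (γ s)) := hγ s hs' ▸ (hh s hs').continuousAt
  exact h1.eventually hs

theorem IsGermFamily.map₂ {F₁ F₂ : Type*} [NormedAddCommGroup F₁] [NormedSpace ℂ F₁]
    [NormedAddCommGroup F₂] [NormedSpace ℂ F₂] {G₁ : T → E → F₁} {G₂ : T → E → F₂}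
    (h₁ : IsGermFamily S γ G₁) (h₂ : IsGermFamily S γ G₂) (op : F₁ → F₂ → F)
    (hop : ∀ t ∈ S, AnalyticAt ℂ (fun z => op (G₁ t z) (G₂ t z)) (γ t)) :
    IsGermFamily S γ (fun t z => op (G₁ t z) (G₂ t z)) := by
  refine ⟨hop, fun t ht => ?_⟩
  filter_upwards [h₁.2 t ht, h₂.2 t ht] with s h1 h2
  filter_upwards [h1, h2] with z hz1 hz2
  rw [hz1, hz2]

/-- Compactness gives one radius on which all the germs have representatives. Representatives at
neighbouring parameters agree on the whole overlap of their balls, because the overlap is convex and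
the identity theorem applies. In this form the family can be carried over to nearby paths. -/
theorem IsGermFamily.normal_form [CompleteSpace F] (h : IsGermFamily S γ G) (hS : IsCompact S)
    (hγ : ContinuousOn γ S) :
    ∃ δ > 0, ∃ K : T → E → F, (∀ t ∈ S, AnalyticOnNhd ℂ (K t) (Metric.ball (γ t) δ)) ∧
      (∀ t ∈ S, K t =ᶠ[𝓝 (γ t)] G t) ∧
      ∀ t ∈ S, ∀ᶠ s in 𝓝[S] t,
        Set.EqOn (K s) (K t) (Metric.ball (γ s) δ ∩ Metric.ball (γ t) δ) := by
  have h1 : ∃ δ > 0, ∀ t ∈ S, ∃ K : E → F, AnalyticOnNhd ℂ K (Metric.ball (γ t) δ) ∧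
      K =ᶠ[𝓝 (γ t)] G t := by
    have := hS.induction_on (p := fun A => ∃ δ > 0, ∀ t ∈ A ∩ S, ∃ K : E → F,
      AnalyticOnNhd ℂ K (Metric.ball (γ t) δ) ∧ K =ᶠ[𝓝 (γ t)] G t) ⟨1, one_pos, by simp⟩
      (fun s t hst ⟨δ, hδ, H⟩ => ⟨δ, hδ, fun x hx => H x ⟨hst hx.1, hx.2⟩⟩)
      (by
        rintro s t ⟨δ, hδ, H⟩ ⟨δ', hδ', H'⟩
        refine ⟨min δ δ', lt_min hδ hδ', ?_⟩
        rintro x ⟨hx | hx, hxS⟩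
        · obtain ⟨K, hK, hK'⟩ := H x ⟨hx, hxS⟩
          exact ⟨K, hK.mono (Metric.ball_subset_ball (min_le_left _ _)), hK'⟩
        · obtain ⟨K, hK, hK'⟩ := H' x ⟨hx, hxS⟩
          exact ⟨K, hK.mono (Metric.ball_subset_ball (min_le_right _ _)), hK'⟩)
      (by
        intro t ht
        obtain ⟨r, hr, hrb⟩ := Metric.eventually_nhds_iff_ball.1 (h.1 t ht).eventually_analyticAt
        have h2 : ∀ᶠ s in 𝓝[S] t, dist (γ s) (γ t) < r / 2 :=
          (hγ t ht).eventually (Metric.ball_mem_nhds _ (half_pos hr))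
        refine ⟨_, h2.and (h.2 t ht), r / 2, half_pos hr, ?_⟩
        rintro s ⟨⟨hs1, hs2⟩, -⟩
        refine ⟨G t, fun y hy => hrb y ?_, hs2.symm⟩
        rw [Metric.mem_ball] at hy ⊢
        linarith [dist_triangle y (γ s) (γ t)])
    simpa using this
  obtain ⟨δ, hδ, H⟩ := h1
  choose! K hK hK' using H
  refine ⟨δ, hδ, K, hK, hK', fun t ht => ?_⟩
  have h2 : ∀ᶠ s in 𝓝[S] t, K t =ᶠ[𝓝 (γ s)] G t := (hγ t ht).eventually (hK' t ht).eventuallyEq_nhds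
  have h3 : ∀ᶠ s in 𝓝[S] t, γ s ∈ Metric.ball (γ t) δ :=
    (hγ t ht).eventually (Metric.ball_mem_nhds _ hδ)
  filter_upwards [h2, h3, h.2 t ht, self_mem_nhdsWithin] with s hs2 hs3 hs4 hs
  refine AnalyticOnNhd.eqOn_of_preconnected_of_eventuallyEq
    ((hK s hs).mono Set.inter_subset_left) ((hK t ht).mono Set.inter_subset_right) ?_
    (z₀ := γ s) ⟨Metric.mem_ball_self hδ, hs3⟩ (((hK' s hs).trans hs4).trans hs2.symm)
  let : NormedSpace ℝ E := NormedSpace.restrictScalars ℝ ℂ E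
  exact ((convex_ball _ _).inter (convex_ball _ _)).isPreconnected

/-- The representatives of `IsGermFamily.normal_form` serve every path in the tube of radius δ
around the original one. This is the source of homotopy invariance. -/
theorem isGermFamily_of_dist_lt {δ : ℝ} {K : T → E → F} {γ' : T → E}
    (h1 : ∀ t ∈ S, AnalyticOnNhd ℂ (K t) (Metric.ball (γ t) δ))
    (h2 : ∀ t ∈ S, ∀ᶠ s in 𝓝[S] t,
        Set.EqOn (K s) (K t) (Metric.ball (γ s) δ ∩ Metric.ball (γ t) δ))
    (hγ' : ContinuousOn γ' S) (hd : ∀ t ∈ S, dist (γ' t) (γ t) < δ) : IsGermFamily S γ' K := by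
  refine ⟨fun t ht => h1 t ht _ (hd t ht), fun t ht => ?_⟩
  have h3 : ∀ᶠ s in 𝓝[S] t, γ' s ∈ Metric.ball (γ t) δ :=
    (hγ' t ht).eventually (Metric.isOpen_ball.mem_nhds (hd t ht))
  filter_upwards [h2 t ht, h3, self_mem_nhdsWithin] with s hs hs3 hs4
  exact hs.eventuallyEq_of_mem ((Metric.isOpen_ball.inter Metric.isOpen_ball).mem_nhds
    ⟨hd s hs4, hs3⟩)

/-- By the identity theorem on a ball, the coincidence of two analytic germs is both an open and a
closed condition. All connectedness arguments about germs use this. -/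
theorem eventually_eventuallyEq_iff [CompleteSpace F] {f g : E → F} {x : E} (hf : AnalyticAt ℂ f x)
    (hg : AnalyticAt ℂ g x) : ∀ᶠ y in 𝓝 x, (f =ᶠ[𝓝 y] g ↔ f =ᶠ[𝓝 x] g) := by
  obtain ⟨r, hr, hrb⟩ := Metric.eventually_nhds_iff_ball.1
    (hf.eventually_analyticAt.and hg.eventually_analyticAt)
  let : NormedSpace ℝ E := NormedSpace.restrictScalars ℝ ℂ E
  have key : ∀ y ∈ Metric.ball x r, ∀ z ∈ Metric.ball x r, f =ᶠ[𝓝 y] g → f =ᶠ[𝓝 z] g := by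
    intro y hy z hz h
    exact (AnalyticOnNhd.eqOn_of_preconnected_of_eventuallyEq (fun w hw => (hrb w hw).1)
      (fun w hw => (hrb w hw).2) (convex_ball x r).isPreconnected hy h).eventuallyEq_of_mem
      (Metric.isOpen_ball.mem_nhds hz)
  filter_upwards [Metric.ball_mem_nhds x hr] with y hy
  exact ⟨key y hy x (Metric.mem_ball_self hr), key x (Metric.mem_ball_self hr) y hy⟩

theorem IsGermFamily.unique [CompleteSpace F] {G' : T → E → F} (h : IsGermFamily S γ G)
    (h' : IsGermFamily S γ G') (hγ : ContinuousOn γ S) (hS : IsPreconnected S) {t₀ t : T}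
    (ht₀ : t₀ ∈ S) (ht : t ∈ S) (heq : G t₀ =ᶠ[𝓝 (γ t₀)] G' t₀) : G t =ᶠ[𝓝 (γ t)] G' t := by
  have := hS.induction₂ (fun x y => (G x =ᶠ[𝓝 (γ x)] G' x ↔ G y =ᶠ[𝓝 (γ y)] G' y))
    (by
      intro x hx
      filter_upwards [h.2 x hx, h'.2 x hx,
        (hγ x hx).eventually (eventually_eventuallyEq_iff (h.1 x hx) (h'.1 x hx))] with y h1 h2 h3
      rw [← h3]
      exact ⟨fun H => (h1.trans H).trans h2.symm, fun H => (h1.symm.trans H).trans h2⟩)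
    (fun _ _ _ _ _ _ => Iff.trans) (fun _ _ _ _ => Iff.symm) ht₀ ht
  exact this.1 heq

end Family

section Cont

variable {γ : ℝ → E} {a b c : ℝ} {f g h : E → F}

theorem Cont.congr_path {γ' : ℝ → E} (hC : Cont γ a b f g) (hab : a ≤ b)
    (hγ : Set.EqOn γ γ' (Set.Icc a b)) : Cont γ' a b f g := by
  obtain ⟨G, h1, h2, h3⟩ := hC
  refine ⟨G, h1.congr_path hγ, ?_, ?_⟩
  · rwa [← hγ (Set.left_mem_Icc.2 hab)]
  · rwa [← hγ (Set.right_mem_Icc.2 hab)]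

theorem Cont.congr {f' g' : E → F} (hC : Cont γ a b f g) (hf : f =ᶠ[𝓝 (γ a)] f')
    (hg : g =ᶠ[𝓝 (γ b)] g') : Cont γ a b f' g' := by
  obtain ⟨G, h1, h2, h3⟩ := hC
  exact ⟨G, h1, h2.trans hf, h3.trans hg⟩

theorem Cont.const (hf : ∀ t ∈ Set.Icc a b, AnalyticAt ℂ f (γ t)) : Cont γ a b f f :=
  ⟨_, IsGermFamily.const hf, EventuallyEq.rfl, EventuallyEq.rfl⟩

theorem Cont.unique [CompleteSpace F] {g' : E → F} (hγ : ContinuousOn γ (Set.Icc a b)) (hab : a ≤ b)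
    (h1 : Cont γ a b f g) (h2 : Cont γ a b f g') : g =ᶠ[𝓝 (γ b)] g' := by
  obtain ⟨G, hG, hGa, hGb⟩ := h1
  obtain ⟨G', hG', hGa', hGb'⟩ := h2
  have := hG.unique hG' hγ isPreconnected_Icc (Set.left_mem_Icc.2 hab) (Set.right_mem_Icc.2 hab)
    (hGa.trans hGa'.symm)
  exact (hGb.symm.trans this).trans hGb'

/-- Reparametrization; also covers restriction to subintervals and reversal. -/
theorem IsGermFamily.cont_comp {G : ℝ → E → F} {a b c d : ℝ} (hG : IsGermFamily (Set.Icc a b) γ G)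
    {τ : ℝ → ℝ} (hτ : ContinuousOn τ (Set.Icc c d))
    (hm : Set.MapsTo τ (Set.Icc c d) (Set.Icc a b)) : Cont (γ ∘ τ) c d (G (τ c)) (G (τ d)) :=
  ⟨G ∘ τ, hG.comp hτ hm, EventuallyEq.rfl, EventuallyEq.rfl⟩

theorem Cont.comp {a b c d : ℝ} (hC : Cont γ a b f g)
    {τ : ℝ → ℝ} (hτ : ContinuousOn τ (Set.Icc c d))
    (hm : Set.MapsTo τ (Set.Icc c d) (Set.Icc a b)) (hc : τ c = a) (hd : τ d = b) :
    Cont (γ ∘ τ) c d f g := by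
  obtain ⟨G, hG, h1, h2⟩ := hC
  refine (hG.cont_comp hτ hm).congr ?_ ?_
  · simpa [hc] using h1
  · simpa [hd] using h2

theorem Cont.comp_reverse {a b c d : ℝ} (hC : Cont γ a b f g)
    {τ : ℝ → ℝ} (hτ : ContinuousOn τ (Set.Icc c d))
    (hm : Set.MapsTo τ (Set.Icc c d) (Set.Icc a b)) (hc : τ c = b) (hd : τ d = a) :
    Cont (γ ∘ τ) c d g f := by
  obtain ⟨G, hG, h1, h2⟩ := hC
  refine (hG.cont_comp hτ hm).congr ?_ ?_
  · simpa [hc] using h2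
  · simpa [hd] using h1

theorem Cont.trans (hab : a ≤ b) (hbc : b ≤ c) (h₁ : Cont γ a b f g) (h₂ : Cont γ b c g h)
    (hγ : ContinuousAt γ b) : Cont γ a c f h := by
  obtain ⟨G, hG, hGa, hGb⟩ := h₁
  obtain ⟨G', hG', hGa', hGb'⟩ := h₂
  have hb : G b =ᶠ[𝓝 (γ b)] G' b := hGb.trans hGa'.symm
  have hsplit : ∀ t : ℝ, 𝓝[Set.Icc a c] t = 𝓝[Set.Icc a b] t ⊔ 𝓝[Set.Icc b c] t := by
    intro t; rw [← nhdsWithin_union, Set.Icc_union_Icc_eq_Icc hab hbc]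
  refine ⟨fun t => if t ≤ b then G t else G' t, ⟨fun t ht => ?_, fun t ht => ?_⟩, ?_, ?_⟩
  · by_cases htb : t ≤ b
    · simpa [htb] using hG.1 t ⟨ht.1, htb⟩
    · simpa [htb] using hG'.1 t ⟨(not_le.1 htb).le, ht.2⟩
  · rcases lt_trichotomy t b with htb | rfl | htb
    · have h1 := hG.2 t ⟨ht.1, htb.le⟩
      have h2 : 𝓝[Set.Icc a c] t ≤ 𝓝[Set.Icc a b] t := by
        rw [nhdsWithin_le_iff]
        filter_upwards [mem_nhdsWithin_of_mem_nhds (Iio_mem_nhds htb), self_mem_nhdsWithin] with s h1 h2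
        exact ⟨h2.1, le_of_lt h1⟩
      filter_upwards [h2 h1, mem_nhdsWithin_of_mem_nhds (Iio_mem_nhds htb)] with s hs hs'
      have : s ≤ b := le_of_lt hs'
      simpa [htb.le, this] using hs
    · rw [hsplit, eventually_sup]
      constructor
      · filter_upwards [hG.2 t ⟨hab, le_rfl⟩, self_mem_nhdsWithin] with s hs hs'
        simpa [hs'.2] using hs
      · have h3 : ∀ᶠ s in 𝓝[Set.Icc t c] t, G t =ᶠ[𝓝 (γ s)] G' t :=
          (hγ.mono_left nhdsWithin_le_nhds).eventually hb.eventuallyEq_nhds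
        filter_upwards [hG'.2 t ⟨le_rfl, hbc⟩, self_mem_nhdsWithin, h3] with s hs hs' h3
        by_cases hst : s ≤ t
        · have : s = t := le_antisymm hst hs'.1
          subst this; rfl
        · simpa [hst] using hs.trans h3.symm
    · have h1 := hG'.2 t ⟨htb.le, ht.2⟩
      have h2 : 𝓝[Set.Icc a c] t ≤ 𝓝[Set.Icc b c] t := by
        rw [nhdsWithin_le_iff]
        filter_upwards [mem_nhdsWithin_of_mem_nhds (Ioi_mem_nhds htb), self_mem_nhdsWithin] with s h1 h2
        exact ⟨le_of_lt h1, h2.2⟩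
      filter_upwards [h2 h1, mem_nhdsWithin_of_mem_nhds (Ioi_mem_nhds htb)] with s hs hs'
      have : ¬ s ≤ b := not_le.2 hs'
      simpa [not_le.2 htb, this] using hs
  · simpa [hab] using hGa
  · by_cases hcb : c ≤ b
    · have : c = b := le_antisymm hcb hbc
      subst this
      simpa using hb.trans hGb'
    · simpa [hcb] using hGb'

theorem Cont.pullback {E' : Type*} [NormedAddCommGroup E'] [NormedSpace ℂ E']
    {γ' : ℝ → E'} {φ : E' → E} (hC : Cont γ a b f g) (hab : a ≤ b)
    (hφ : ∀ t ∈ Set.Icc a b, AnalyticAt ℂ φ (γ' t))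
    (hγ : ∀ t ∈ Set.Icc a b, φ (γ' t) = γ t) : Cont γ' a b (f ∘ φ) (g ∘ φ) := by
  obtain ⟨G, hG, hGa, hGb⟩ := hC
  refine ⟨_, hG.pullback hφ hγ, ?_, ?_⟩
  · have ha := Set.left_mem_Icc.2 hab
    have h1 : Tendsto φ (𝓝 (γ' a)) (𝓝 (γ a)) := hγ a ha ▸ (hφ a ha).continuousAt
    exact h1.eventually hGa
  · have ha := Set.right_mem_Icc.2 hab
    have h1 : Tendsto φ (𝓝 (γ' b)) (𝓝 (γ b)) := hγ b ha ▸ (hφ b ha).continuousAt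
    exact h1.eventually hGb

theorem Cont.add {f₁ g₁ f₂ g₂ : E → F} (h₁ : Cont γ a b f₁ g₁) (h₂ : Cont γ a b f₂ g₂) :
    Cont γ a b (fun z => f₁ z + f₂ z) (fun z => g₁ z + g₂ z) := by
  obtain ⟨G, hG, hGa, hGb⟩ := h₁
  obtain ⟨G', hG', hGa', hGb'⟩ := h₂
  refine ⟨_, hG.map₂ hG' (fun x y => x + y) fun t ht => (hG.1 t ht).add (hG'.1 t ht), ?_, ?_⟩
  · filter_upwards [hGa, hGa'] with z h1 h2; rw [h1, h2]
  · filter_upwards [hGb, hGb'] with z h1 h2; rw [h1, h2]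

theorem Cont.smul {f₁ g₁ : E → ℂ} {f₂ g₂ : E → F} (h₁ : Cont γ a b f₁ g₁) (h₂ : Cont γ a b f₂ g₂) :
    Cont γ a b (fun z => f₁ z • f₂ z) (fun z => g₁ z • g₂ z) := by
  obtain ⟨G, hG, hGa, hGb⟩ := h₁
  obtain ⟨G', hG', hGa', hGb'⟩ := h₂
  refine ⟨_, hG.map₂ hG' (fun x y => x • y) fun t ht => (hG.1 t ht).smul (hG'.1 t ht), ?_, ?_⟩
  · filter_upwards [hGa, hGa'] with z h1 h2; rw [h1, h2]
  · filter_upwards [hGb, hGb'] with z h1 h2; rw [h1, h2]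

theorem Cont.mul {f₁ g₁ f₂ g₂ : E → ℂ} (h₁ : Cont γ a b f₁ g₁) (h₂ : Cont γ a b f₂ g₂) :
    Cont γ a b (fun z => f₁ z * f₂ z) (fun z => g₁ z * g₂ z) := h₁.smul h₂

theorem Cont.const_mul {f g : E → ℂ} (h : Cont γ a b f g) (k : ℂ) :
    Cont γ a b (fun z => k * f z) (fun z => k * g z) :=
  (Cont.const (f := fun _ => k) fun _ _ => analyticAt_const).mul h

theorem Cont.sum {ι : Type*} (s : Finset ι) {f g : ι → E → F}
    (h : ∀ i ∈ s, Cont γ a b (f i) (g i)) :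
    Cont γ a b (fun z => ∑ i ∈ s, f i z) (fun z => ∑ i ∈ s, g i z) := by
  classical
  induction s using Finset.induction_on with
  | empty => simpa using Cont.const (f := fun _ => (0 : F)) fun _ _ => analyticAt_const
  | insert i s his ih =>
    simp only [Finset.sum_insert his]
    exact (h i (Finset.mem_insert_self i s)).add (ih fun j hj => h j (Finset.mem_insert_of_mem hj))

/-- Continuation from local extension of admissible germs. -/
theorem exists_family_of_local {γ : ℝ → E} (hγ : Continuous γ) {Adm : ℝ → (E → F) → Prop}
    (hab : a ≤ b)
    (hloc : ∀ t₀ ∈ Set.Icc a b, ∃ N ∈ 𝓝 t₀, ∀ t ∈ N ∩ Set.Icc a b, ∀ h, Adm t h →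
      ∃ k, k =ᶠ[𝓝 (γ t)] h ∧ ∀ s ∈ N ∩ Set.Icc a b, AnalyticAt ℂ k (γ s) ∧ Adm s k)
    (hf : Adm a f) : ∃ g, Adm b g ∧ Cont γ a b f g := by
  choose! N hN hN' using hloc
  let c : Set.Icc a b → Set (Set.Icc a b) := fun t => Subtype.val ⁻¹' interior (N t)
  -- A subdivision of the interval subordinate to the cover by the neighbourhoods N; the germ is
  -- extended over one piece after another.
  obtain ⟨u, hu0, humono, ⟨m, hm⟩, hu⟩ := exists_monotone_Icc_subset_open_cover_Icc hab (c := c)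
    (fun t => isOpen_interior.preimage continuous_subtype_val)
    (fun t _ => Set.mem_iUnion.2 ⟨t, mem_interior_iff_mem_nhds.2 (hN t t.2)⟩)
  have key : ∀ k : ℕ, ∃ g, Adm (u k) g ∧ Cont γ a (u k) f g := by
    intro k
    induction k with
    | zero =>
      rw [hu0]
      obtain ⟨k, hk, hk'⟩ := hN' a (Set.left_mem_Icc.2 hab) a
        ⟨mem_of_mem_nhds (hN a (Set.left_mem_Icc.2 hab)), Set.left_mem_Icc.2 hab⟩ f hf
      have h1 := hk' a ⟨mem_of_mem_nhds (hN a (Set.left_mem_Icc.2 hab)), Set.left_mem_Icc.2 hab⟩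
      refine ⟨f, hf, Cont.const fun t ht => ?_⟩
      have : t = a := by simpa using ht
      rw [this]
      exact h1.1.congr hk
    | succ k ih =>
      obtain ⟨g, hg, hC⟩ := ih
      obtain ⟨t₀, ht₀⟩ := hu k
      have hle : (u k : ℝ) ≤ u (k + 1) := humono (Nat.le_succ k)
      have hmem : ∀ s ∈ Set.Icc (u k : ℝ) (u (k + 1)), s ∈ N t₀ ∩ Set.Icc a b := by
        intro s hs
        have hsab : s ∈ Set.Icc a b := ⟨(u k).2.1.trans hs.1, hs.2.trans (u (k + 1)).2.2⟩
        exact ⟨interior_subset (ht₀ (show (⟨s, hsab⟩ : Set.Icc a b) ∈ Set.Icc (u k) (u (k + 1)) from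
          ⟨hs.1, hs.2⟩)), hsab⟩
      obtain ⟨g', hg', H⟩ := hN' t₀ t₀.2 (u k) (hmem _ ⟨le_rfl, hle⟩) g hg
      refine ⟨g', (H _ (hmem _ ⟨hle, le_rfl⟩)).2, hC.trans (u k).2.1 hle ?_ hγ.continuousAt⟩
      exact (Cont.const fun t ht => (H t (hmem t ht)).1).congr hg' EventuallyEq.rfl
  obtain ⟨g, hg, hC⟩ := key m
  rw [hm m le_rfl] at hg hC
  exact ⟨g, hg, hC⟩

end Cont

/-- Near y the form is exact, so its derivative is symmetric there. Symmetry spreads to the ball by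
the identity theorem, and the Poincaré lemma on the convex ball gives a primitive, which is then
shifted by a constant to match h near y. -/
theorem exists_primitive_on_ball {ω : E → E →L[ℂ] ℂ} {x y : E} {δ : ℝ}
    (hω : AnalyticOnNhd ℂ ω (Metric.ball x δ)) (hy : y ∈ Metric.ball x δ) {h : E → ℂ}
    (hh : ∀ᶠ z in 𝓝 y, HasFDerivAt h (ω z) z) :
    ∃ k, k =ᶠ[𝓝 y] h ∧ ∀ z ∈ Metric.ball x δ, HasFDerivAt k (ω z) z := by
  let : NormedSpace ℝ E := NormedSpace.restrictScalars ℝ ℂ E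
  have : IsScalarTower ℝ ℂ E := RestrictScalars.isScalarTower ℝ ℂ E
  have hconv : Convex ℝ (Metric.ball x δ) := convex_ball x δ
  have hsymm : ∀ z ∈ Metric.ball x δ, ∀ u v, fderiv ℂ ω z u v = fderiv ℂ ω z v u := by
    intro z hz u v
    have hA : ∀ u v : E, AnalyticOnNhd ℂ (fun z => fderiv ℂ ω z u v) (Metric.ball x δ) := by
      intro u v z hz
      have h1 : AnalyticAt ℂ (fderiv ℂ ω) z := (hω z hz).fderiv
      have h2 := ((ContinuousLinearMap.apply ℂ (E →L[ℂ] ℂ) u).analyticAt _).comp h1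
      exact ((ContinuousLinearMap.apply ℂ ℂ v).analyticAt _).comp h2
    refine AnalyticOnNhd.eqOn_of_preconnected_of_eventuallyEq (hA u v) (hA v u)
      hconv.isPreconnected hy ?_ hz
    filter_upwards [hh.eventually_nhds, Metric.isOpen_ball.mem_nhds hy] with w hw hwb
    exact second_derivative_symmetric_of_eventually hw
      (hω w hwb).differentiableAt.hasFDerivAt u v
  obtain ⟨k, hk⟩ := hconv.exists_forall_hasFDerivAt_of_fderiv_symmetric (𝕜 := ℂ) (ω := ω)
    Metric.isOpen_ball (fun z hz => ((hω z hz).differentiableAt.restrictScalars ℝ).differentiableWithinAt)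
    (by
      intro z hz u v
      rw [((hω z hz).differentiableAt.hasFDerivAt.restrictScalars ℝ).fderiv]
      exact hsymm z hz u v)
  refine ⟨fun z => k z + (h y - k y), ?_, fun z hz => (hk z hz).add_const _⟩
  obtain ⟨r, hr, hrb⟩ := Metric.eventually_nhds_iff_ball.1
    (hh.and (Metric.isOpen_ball.eventually_mem hy))
  refine (Metric.isOpen_ball.eqOn_of_fderiv_eq (𝕜 := ℂ) (convex_ball y r).isPreconnected (x := y)
    (fun z hz => ((hk z (hrb z hz).2).add_const _).differentiableAt.differentiableWithinAt)
    (fun z hz => (hrb z hz).1.differentiableAt.differentiableWithinAt) (fun z hz => ?_)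
    (Metric.mem_ball_self hr) (by simp)).eventuallyEq_of_mem (Metric.ball_mem_nhds y hr)
  rw [((hk z (hrb z hz).2).add_const _).fderiv, (hrb z hz).1.fderiv]

/-- If the differential of a germ continues along a path, then so does the germ. -/
theorem exists_cont_of_fderiv {γ : ℝ → E} (hγ : Continuous γ) {a b : ℝ} (hab : a ≤ b)
    -- The admissible germs in the proof are the local primitives of W; they extend over balls of a
    -- common radius.
    {W : ℝ → E → E →L[ℂ] ℂ} (hW : IsGermFamily (Set.Icc a b) γ W) {f : E → ℂ}
    (hf : ∀ᶠ z in 𝓝 (γ a), HasFDerivAt f (W a z) z) : ∃ g, Cont γ a b f g := by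
  obtain ⟨δ, hδ, K, hK, hKW, hKK⟩ := hW.normal_form isCompact_Icc hγ.continuousOn
  suffices H : ∃ g, (∀ᶠ z in 𝓝 (γ b), HasFDerivAt g (K b z) z) ∧ Cont γ a b f g from
    H.imp fun g hg => hg.2
  refine exists_family_of_local (F := ℂ) hγ hab
    (Adm := fun t h => ∀ᶠ z in 𝓝 (γ t), HasFDerivAt h (K t z) z) (f := f) ?_ ?_
  · intro t₀ ht₀
    have h1 := hKK t₀ ht₀
    rw [eventually_nhdsWithin_iff] at h1
    have h2 : ∀ᶠ s in 𝓝 t₀, γ s ∈ Metric.ball (γ t₀) δ :=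
      hγ.continuousAt.eventually (Metric.ball_mem_nhds _ hδ)
    refine ⟨_, h1.and h2, ?_⟩
    rintro t ⟨⟨ht1, ht2⟩, htm⟩ h hh
    have heq : ∀ s ∈ Set.Icc a b, Set.EqOn (K s) (K t₀) (Metric.ball (γ s) δ ∩ Metric.ball (γ t₀) δ) →
        γ s ∈ Metric.ball (γ t₀) δ → ∀ᶠ z in 𝓝 (γ s), K s z = K t₀ z := by
      intro s hs h1 h2
      exact h1.eventuallyEq_of_mem ((Metric.isOpen_ball.inter Metric.isOpen_ball).mem_nhds
        ⟨Metric.mem_ball_self hδ, h2⟩)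
    obtain ⟨k, hk1, hk2⟩ := exists_primitive_on_ball (hK t₀ ht₀) ht2 (h := h) (by
      filter_upwards [hh, heq t htm (ht1 htm) ht2] with z hz1 hz2
      rwa [← hz2])
    refine ⟨k, hk1, ?_⟩
    rintro s ⟨⟨hs1, hs2⟩, hsm⟩
    have h3 : ∀ᶠ z in 𝓝 (γ s), HasFDerivAt k (K t₀ z) z := by
      filter_upwards [Metric.isOpen_ball.mem_nhds hs2] with z hz using hk2 z hz
    refine ⟨analyticAt_of_hasFDerivAt (hK t₀ ht₀ _ hs2) h3, ?_⟩
    filter_upwards [h3, heq s hsm (hs1 hsm) hs2] with z hz1 hz2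
    rwa [hz2]
  · filter_upwards [hf, hKW a (Set.left_mem_Icc.2 hab)] with z h1 h2
    rwa [h2]

/-- Homotopy invariance of analytic continuation, with moving end points at which the germs
are those of given analytic functions. -/
theorem Cont.homotopy [CompleteSpace F] {Φ : ℝ → ℝ → E} {f g : E → F}
    (hΦ : Continuous (Function.uncurry Φ))
    (hg : ∀ s ∈ Set.Icc (0 : ℝ) 1, AnalyticAt ℂ g (Φ s 1))
    (hex : ∀ s ∈ Set.Icc (0 : ℝ) 1, ∃ h, Cont (Φ s) 0 1 f h)
    (h0 : Cont (Φ 0) 0 1 f g) : Cont (Φ 1) 0 1 f g := by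
  have h01 : (0 : ℝ) ∈ Set.Icc (0 : ℝ) 1 := by simp
  have h11 : (1 : ℝ) ∈ Set.Icc (0 : ℝ) 1 := by simp
  have hΦs : ∀ s, Continuous (Φ s) := fun s => hΦ.comp (by fun_prop : Continuous fun t => (s, t))
  have hΦt : ∀ t, Continuous (fun s => Φ s t) :=
    fun t => hΦ.comp (by fun_prop : Continuous fun s => (s, t))
  -- The assertion that f continues to g along the path with parameter s is locally constant in s:
  -- representatives in a tube around the path for s₀ continue f along all nearby paths, and whether
  -- they end in g does not depend on the nearby end point.
  have key : ∀ s₀ ∈ Set.Icc (0 : ℝ) 1, ∀ᶠ s in 𝓝[Set.Icc 0 1] s₀,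
      (Cont (Φ s₀) 0 1 f g ↔ Cont (Φ s) 0 1 f g) := by
    intro s₀ hs₀
    obtain ⟨h, G, hG, hG0, hG1⟩ := hex s₀ hs₀
    obtain ⟨δ, hδ, K, hK, hKG, hKK⟩ := hG.normal_form isCompact_Icc (hΦs s₀).continuousOn
    have hclose : ∀ᶠ s in 𝓝 s₀, ∀ t ∈ Set.Icc (0 : ℝ) 1, dist (Φ s t) (Φ s₀ t) < δ := by
      have := isCompact_Icc.eventually_forall_of_forall_eventually (x₀ := s₀) (K := Set.Icc (0:ℝ) 1)
        (P := fun s t => dist (Φ s t) (Φ s₀ t) < δ) (fun t ht => by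
          have hc : ContinuousAt (fun z : ℝ × ℝ => dist (Φ z.1 z.2) (Φ s₀ z.2)) (s₀, t) := by
            apply Continuous.continuousAt
            exact hΦ.dist ((hΦs s₀).comp continuous_snd)
          exact hc.eventually_lt continuousAt_const (by simpa using hδ))
      exact this
    have hK0 : K 0 =ᶠ[𝓝 (Φ s₀ 0)] f := (hKG 0 h01).trans hG0
    have e0 : ∀ᶠ s in 𝓝 s₀, K 0 =ᶠ[𝓝 (Φ s 0)] f :=
      (hΦt 0).continuousAt.eventually hK0.eventuallyEq_nhds
    have e1 : ∀ᶠ s in 𝓝 s₀, (K 1 =ᶠ[𝓝 (Φ s 1)] g ↔ K 1 =ᶠ[𝓝 (Φ s₀ 1)] g) :=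
      (hΦt 1).continuousAt.eventually (eventually_eventuallyEq_iff
        (hK 1 h11 _ (Metric.mem_ball_self hδ)) (hg s₀ hs₀))
    have hiff : ∀ s, (∀ t ∈ Set.Icc (0 : ℝ) 1, dist (Φ s t) (Φ s₀ t) < δ) →
        K 0 =ᶠ[𝓝 (Φ s 0)] f → (Cont (Φ s) 0 1 f g ↔ K 1 =ᶠ[𝓝 (Φ s 1)] g) := by
      intro s hs1 hs2
      have hfam := isGermFamily_of_dist_lt hK hKK (hΦs s).continuousOn hs1
      have hC : Cont (Φ s) 0 1 f (K 1) := ⟨K, hfam, hs2, EventuallyEq.rfl⟩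
      exact ⟨fun H => hC.unique (hΦs s).continuousOn zero_le_one H,
        fun H => hC.congr EventuallyEq.rfl H⟩
    filter_upwards [mem_nhdsWithin_of_mem_nhds hclose, mem_nhdsWithin_of_mem_nhds e0,
      mem_nhdsWithin_of_mem_nhds e1] with s h1 h2 h3
    rw [hiff s h1 h2, h3, hiff s₀ (by simpa using fun _ _ _ => hδ) hK0]
  exact (isPreconnected_Icc.induction₂ (fun s s' => (Cont (Φ s) 0 1 f g ↔ Cont (Φ s') 0 1 f g)) key
    (fun _ _ _ _ _ _ => Iff.trans) (fun _ _ _ _ => Iff.symm) h01 h11).1 h0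

theorem Cont.exists_split {γ : ℝ → E} {a b c : ℝ} {f h : E → F} (hab : a ≤ b) (hbc : b ≤ c)
    (hC : Cont γ a c f h) : ∃ g, Cont γ a b f g ∧ Cont γ b c g h := by
  obtain ⟨G, hG, h1, h2⟩ := hC
  exact ⟨G b, ⟨G, hG.mono (Set.Icc_subset_Icc_right hbc), h1, EventuallyEq.rfl⟩,
    ⟨G, hG.mono (Set.Icc_subset_Icc_left hab), EventuallyEq.rfl, h2⟩⟩

/-- Passage from intervals of real parameters, which are convenient for splitting and
reparametrizing, to the form of continuation used in the theorem. -/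
theorem Cont.continuesAlong {m : ℕ} {γ : ℝ → Fin m → ℂ} {f g : (Fin m → ℂ) → ℂ}
    (h : Cont γ 0 1 f g) : ContinuesAlong (fun t : unitInterval => γ t) f g := by
  obtain ⟨G, hG, h0, h1⟩ := h
  have := hG.comp (S' := Set.univ) (τ := fun t : unitInterval => (t : ℝ))
    continuous_subtype_val.continuousOn (fun t _ => t.2)
  refine ⟨fun t => G t, fun t => this.1 t trivial, fun t => ?_, ?_, ?_⟩
  · simpa using this.2 t trivial
  · simpa using h0
  · simpa using h1

end Germs

/-! ### Iterated integrals in the Banach algebra of continuous functions on the unit interval -/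

section IteratedIntegrals

/-- The inclusion of the unit interval into `ℂ`. -/
def coordI : C(unitInterval, ℂ) := ⟨fun t => ((t : ℝ) : ℂ), by fun_prop⟩

@[simp] theorem coordI_apply (t : unitInterval) : coordI t = ((t : ℝ) : ℂ) := rfl

/-- The operator of integration from `0`. -/
def volterra : C(unitInterval, ℂ) →L[ℂ] C(unitInterval, ℂ) :=
  LinearMap.mkContinuous
    { toFun := fun f => ⟨fun t => ∫ u in (0 : ℝ)..t, Set.IccExtend zero_le_one f u, by
        have h : Continuous (Set.IccExtend (zero_le_one (α := ℝ)) f) := f.continuous.Icc_extend'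
        exact (intervalIntegral.continuous_primitive (fun a b => h.intervalIntegrable a b) 0).comp
          continuous_subtype_val⟩
      map_add' := fun f g => by
        ext t
        have hf : Continuous (Set.IccExtend (zero_le_one (α := ℝ)) f) := f.continuous.Icc_extend'
        have hg : Continuous (Set.IccExtend (zero_le_one (α := ℝ)) g) := g.continuous.Icc_extend'
        exact intervalIntegral.integral_add (hf.intervalIntegrable _ _) (hg.intervalIntegrable _ _)
      map_smul' := fun c f => by
        ext t
        exact intervalIntegral.integral_const_mul c _ } 1 (by
    intro f
    rw [one_mul, ContinuousMap.norm_le _ (norm_nonneg _)]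
    intro t
    refine (intervalIntegral.norm_integral_le_of_norm_le_const (C := ‖f‖) fun x _ =>
      f.norm_coe_le_norm _).trans ?_
    rw [sub_zero, abs_of_nonneg t.2.1]
    exact mul_le_of_le_one_right (norm_nonneg _) t.2.2)

theorem volterra_apply (f : C(unitInterval, ℂ)) (t : unitInterval) :
    volterra f t = ∫ u in (0 : ℝ)..t, Set.IccExtend zero_le_one f u := rfl

theorem volterra_eq_of_hasDerivAt {f g : C(unitInterval, ℂ)} {G : ℝ → ℂ}
    (hG : ∀ t : unitInterval, HasDerivAt G (f t) t) (h0 : G 0 = 0)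
    (hg : ∀ t : unitInterval, g t = G t) : volterra f = g := by
  ext t
  rw [volterra_apply, hg]
  have hf : Continuous (Set.IccExtend (zero_le_one (α := ℝ)) f) := f.continuous.Icc_extend'
  rw [intervalIntegral.integral_eq_sub_of_hasDerivAt (f := G) _ (hf.intervalIntegrable _ _), h0,
    sub_zero]
  intro u hu
  rw [Set.uIcc_of_le t.2.1] at hu
  have hu' : u ∈ Set.Icc (0 : ℝ) 1 := ⟨hu.1, hu.2.trans t.2.2⟩
  rw [Set.IccExtend_of_mem _ _ hu']
  exact hG ⟨u, hu'⟩

/-- Iterated integrals, the last kernel being the outermost one. -/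
def iter (κ : ℕ → C(unitInterval, ℂ)) : ℕ → C(unitInterval, ℂ)
  | 0 => 1
  | m + 1 => volterra (κ m * iter κ m)

theorem iter_congr {κ κ' : ℕ → C(unitInterval, ℂ)} {m : ℕ} (h : ∀ i < m, κ i = κ' i) :
    iter κ m = iter κ' m := by
  induction m with
  | zero => rfl
  | succ m ih => rw [iter, iter, ih fun i hi => h i (by omega), h m (by omega)]

/-- The kernel `w / (1 - w u)`. -/
def ker (w : ℂ) : C(unitInterval, ℂ) := w • Ring.inverse (1 - w • coordI)

/-- The kernel `1 / (b - u)`. -/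
def kerInv (b : ℂ) : C(unitInterval, ℂ) := Ring.inverse (b • 1 - coordI)

/-- `w` does not lie on `[1, ∞)`. -/
def Slit (w : ℂ) : Prop := ∀ t : unitInterval, 1 - w * ((t : ℝ) : ℂ) ≠ 0

theorem Slit.isUnit {w : ℂ} (h : Slit w) : IsUnit (1 - w • coordI) := by
  rw [ContinuousMap.isUnit_iff_forall_ne_zero]
  intro t
  simpa using h t

theorem inverse_apply {f : C(unitInterval, ℂ)} (h : IsUnit f) (t : unitInterval) :
    Ring.inverse f t = (f t)⁻¹ := by
  have h1 : (Ring.inverse f * f) t = 1 := by rw [Ring.inverse_mul_cancel _ h]; rfl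
  exact eq_inv_of_mul_eq_one_left h1

theorem Slit.ker_apply {w : ℂ} (h : Slit w) (t : unitInterval) :
    ker w t = w / (1 - w * ((t : ℝ) : ℂ)) := by
  simp [ker, inverse_apply h.isUnit, div_eq_mul_inv]

/-- Inversion is analytic on the units of a Banach algebra. With kernels as elements of C([0,1], ℂ)
and integration as a bounded operator, analytic dependence on parameters needs no differentiation
under the integral sign. -/
theorem Slit.analyticAt_ker {w : ℂ} (h : Slit w) : AnalyticAt ℂ ker w := by
  have h1 : AnalyticAt ℂ (fun w : ℂ => 1 - w • coordI) w := by fun_prop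
  have h2 : AnalyticAt ℂ (Ring.inverse (M₀ := C(unitInterval, ℂ))) (1 - w • coordI) := by
    obtain ⟨u, hu⟩ := h.isUnit
    rw [← hu]; exact analyticAt_inverse u
  exact analyticAt_id.smul (AnalyticAt.comp (f := fun w : ℂ => 1 - w • coordI) h2 h1)

theorem Slit.inv_ne {w : ℂ} (h : Slit w) (hw : w ≠ 0) (t : unitInterval) :
    w⁻¹ - ((t : ℝ) : ℂ) ≠ 0 := by
  intro h0
  apply h t
  rw [← sub_eq_zero.1 h0, mul_inv_cancel₀ hw, sub_self]

theorem isUnit_kerInv {b : ℂ} (h : ∀ t : unitInterval, b - ((t : ℝ) : ℂ) ≠ 0) :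
    IsUnit (b • (1 : C(unitInterval, ℂ)) - coordI) := by
  rw [ContinuousMap.isUnit_iff_forall_ne_zero]
  intro t
  simpa using h t

theorem kerInv_apply {b : ℂ} (h : ∀ t : unitInterval, b - ((t : ℝ) : ℂ) ≠ 0) (t : unitInterval) :
    kerInv b t = (b - ((t : ℝ) : ℂ))⁻¹ := by
  simp [kerInv, inverse_apply (isUnit_kerInv h)]

/-- `ker` also makes sense at w = 0, the case of an interval of length zero; `kerInv` has the
simpler derivative. This translates between them away from w = 0. -/
theorem Slit.ker_eq_kerInv {w : ℂ} (h : Slit w) (hw : w ≠ 0) : ker w = kerInv w⁻¹ := by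
  ext t
  rw [h.ker_apply, kerInv_apply (h.inv_ne hw)]
  have h1 := h t
  have h2 := h.inv_ne hw t
  rw [div_eq_iff h1, inv_mul_eq_div, eq_div_iff h2]
  field_simp

section Deriv

variable {E : Type*} [NormedAddCommGroup E] [NormedSpace ℂ E]

theorem analyticAt_iter {κ : ℕ → E → C(unitInterval, ℂ)} {e : E} {m : ℕ}
    (h : ∀ i < m, AnalyticAt ℂ (κ i) e) : AnalyticAt ℂ (fun z => iter (fun i => κ i z) m) e := by
  induction m with
  | zero => exact analyticAt_const
  | succ m ih =>
    have h1 := (h m (by omega)).mul (ih fun i hi => h i (by omega))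
    exact (volterra.analyticAt _).comp h1

/-- Omit the term with number `k` of a sequence. -/
def dropAt {α : Type*} (k : ℕ) (κ : ℕ → α) : ℕ → α := fun i => if i < k then κ i else κ (i + 1)

/-- Integration by parts: the derivative of 1/(b - u) in u is its square. -/
theorem volterra_parts {b : ℂ} (h : ∀ t : unitInterval, b - ((t : ℝ) : ℂ) ≠ 0)
    (g : C(unitInterval, ℂ)) :
    volterra (kerInv b * kerInv b * volterra g + kerInv b * g) = kerInv b * volterra g := by
  have hg : Continuous (Set.IccExtend (zero_le_one (α := ℝ)) g) := g.continuous.Icc_extend'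
  refine volterra_eq_of_hasDerivAt (G := fun t : ℝ => (b - (t : ℂ))⁻¹ *
    ∫ u in (0 : ℝ)..t, Set.IccExtend zero_le_one g u) (fun t => ?_) (by simp) (fun t => ?_)
  · have h1 : HasDerivAt (fun t : ℝ => (b - (t : ℂ))⁻¹) (((b - ((t : ℝ) : ℂ)) ^ 2)⁻¹) (t : ℝ) := by
      have h2 : HasDerivAt (fun z : ℂ => (b - z)⁻¹) (((b - ((t : ℝ) : ℂ)) ^ 2)⁻¹) ((t : ℝ) : ℂ) := by
        have := ((hasDerivAt_id ((t : ℝ) : ℂ)).const_sub b).fun_inv (h t)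
        simpa [div_eq_mul_inv] using this
      exact h2.comp_ofReal
    have h3 : HasDerivAt (fun t : ℝ => ∫ u in (0 : ℝ)..t, Set.IccExtend zero_le_one g u)
        (g t) (t : ℝ) := by
      have := intervalIntegral.integral_hasDerivAt_right (hg.intervalIntegrable 0 (t : ℝ))
        hg.aestronglyMeasurable.stronglyMeasurableAtFilter hg.continuousAt
      rwa [Set.IccExtend_of_mem _ _ t.2] at this
    refine (h1.fun_mul h3).congr_deriv ?_
    rw [ContinuousMap.add_apply, ContinuousMap.mul_apply, ContinuousMap.mul_apply,
      ContinuousMap.mul_apply, kerInv_apply h, volterra_apply]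
    congr 1
    rw [pow_two, mul_inv]
  · simp [kerInv_apply h, volterra_apply]

theorem volterra_kerInv_sq {b : ℂ} (h : ∀ t : unitInterval, b - ((t : ℝ) : ℂ) ≠ 0) :
    volterra (kerInv b * kerInv b) = kerInv b - b⁻¹ • 1 := by
  refine volterra_eq_of_hasDerivAt (G := fun t : ℝ => (b - (t : ℂ))⁻¹ - b⁻¹)
    (fun t => ?_) (by simp) (fun t => ?_)
  · have h2 : HasDerivAt (fun z : ℂ => (b - z)⁻¹ - b⁻¹) (((b - ((t : ℝ) : ℂ)) ^ 2)⁻¹)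
        ((t : ℝ) : ℂ) := by
      have := ((hasDerivAt_id ((t : ℝ) : ℂ)).const_sub b).fun_inv (h t)
      simpa [div_eq_mul_inv] using this.sub_const b⁻¹
    refine h2.comp_ofReal.congr_deriv ?_
    rw [ContinuousMap.mul_apply, kerInv_apply h, pow_two, mul_inv]
  · simp [kerInv_apply h]

/-- Partial fractions. A product of two adjacent kernels thus splits into single kernels, which is
what removes one singular point from a differentiated integral. -/
theorem kerInv_sub_kerInv {b c : ℂ} (hb : ∀ t : unitInterval, b - ((t : ℝ) : ℂ) ≠ 0)
    (hc : ∀ t : unitInterval, c - ((t : ℝ) : ℂ) ≠ 0) :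
    kerInv b - kerInv c = (c - b) • (kerInv b * kerInv c) := by
  ext t
  simp only [ContinuousMap.sub_apply, kerInv_apply hb, kerInv_apply hc, ContinuousMap.smul_apply,
    ContinuousMap.mul_apply, smul_eq_mul]
  have h1 := hb t
  have h2 := hc t
  field_simp
  ring

/-- The logarithmic derivative of the difference of consecutive terms. -/
def dlogDiff (b d : ℕ → ℂ) (k : ℕ) : ℂ := (d (k + 1) - d k) / (b (k + 1) - b k)

/-- The derivative of the iterated integral with kernels `1 / (b (i + 1) - u)`, `i < m`, in the
direction `d`. -/
def iterDeriv (b d : ℕ → ℂ) (m : ℕ) : C(unitInterval, ℂ) :=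
  ∑ k ∈ Finset.range (m - 1), (dlogDiff b d k - dlogDiff b d (k + 1)) •
      iter (dropAt k fun i => kerInv (b (i + 1))) (m - 1) +
    if m = 0 then 0 else (dlogDiff b d (m - 1) • 1 - d m • kerInv (b m)) *
      iter (fun i => kerInv (b (i + 1))) (m - 1)

/-- The left side is the product rule for the outermost integration. The squared kernel is
integrated by parts, and the products of the last two kernels are separated by partial fractions.
What remains are integrals with one kernel omitted, and the boundary term moves one step outwards.
-/
theorem iterDeriv_succ {b d : ℕ → ℂ} {m : ℕ} (hb0 : b 0 = 0) (hd0 : d 0 = 0)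
    (hb : ∀ i ≤ m, ∀ t : unitInterval, b (i + 1) - ((t : ℝ) : ℂ) ≠ 0)
    (hne : ∀ i ≤ m, b (i + 1) ≠ b i) :
    volterra (-(d (m + 1)) • (kerInv (b (m + 1)) * kerInv (b (m + 1))) *
      iter (fun i => kerInv (b (i + 1))) m + kerInv (b (m + 1)) * iterDeriv b d m) =
      iterDeriv b d (m + 1) := by
  cases m with
  | zero =>
    have hb1 : b 1 ≠ 0 := by simpa [hb0] using hne 0 le_rfl
    simp only [iterDeriv, iter, dlogDiff, hb0, hd0]
    simp only [zero_add, mul_one, Nat.zero_sub, Nat.sub_self, Finset.range_zero, Finset.sum_empty,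
      if_true, mul_zero, add_zero, sub_zero, one_ne_zero, if_false]
    rw [map_smul, volterra_kerInv_sq (hb 0 le_rfl), iter]
    ext t
    simp [div_eq_mul_inv]
    ring
  | succ m =>
    have hL : dlogDiff b d (m + 1) * (b (m + 2) - b (m + 1)) = d (m + 2) - d (m + 1) :=
      div_mul_cancel₀ _ (sub_ne_zero.2 (hne (m + 1) le_rfl))
    set K := kerInv (b (m + 2)) with hK
    set K' := kerInv (b (m + 1)) with hK'
    set J := iter (fun i => kerInv (b (i + 1))) m with hJ
    have hKK : K' - K = (b (m + 2) - b (m + 1)) • (K' * K) :=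
      kerInv_sub_kerInv (hb m (by omega)) (hb (m + 1) le_rfl)
    have hJs : iter (fun i => kerInv (b (i + 1))) (m + 1) = volterra (K' * J) := rfl
    have homit : ∀ k < m + 1, iter (dropAt k fun i => kerInv (b (i + 1))) (m + 1) =
        volterra (K * iter (dropAt k fun i => kerInv (b (i + 1))) m) := by
      intro k hk
      rw [iter]
      congr 2
      simp [dropAt, show ¬ m < k by omega, hK]
    have homit' : iter (dropAt m fun i => kerInv (b (i + 1))) m = J :=
      iter_congr fun i hi => by simp [dropAt, hi]
    simp only [iterDeriv, Nat.add_sub_cancel, Nat.add_eq_zero_iff, one_ne_zero, and_false, if_false]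
    have hR : ∑ k ∈ Finset.range (m + 1), (dlogDiff b d k - dlogDiff b d (k + 1)) •
        iter (dropAt k fun i => kerInv (b (i + 1))) (m + 1) = ∑ k ∈ Finset.range (m + 1),
        (dlogDiff b d k - dlogDiff b d (k + 1)) •
        volterra (K * iter (dropAt k fun i => kerInv (b (i + 1))) m) :=
      Finset.sum_congr rfl fun k hk => by rw [homit k (Finset.mem_range.1 hk)]
    rw [hR, Finset.sum_range_succ, homit', hJs]
    set L := dlogDiff b d (m + 1)
    set L' := dlogDiff b d m
    have hparts := volterra_parts (hb (m + 1) le_rfl) (K' * J)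
    rw [← hK] at hparts
    have hsum : volterra (K * ∑ k ∈ Finset.range m, (dlogDiff b d k - dlogDiff b d (k + 1)) •
        iter (dropAt k fun i => kerInv (b (i + 1))) m) = ∑ k ∈ Finset.range m,
        (dlogDiff b d k - dlogDiff b d (k + 1)) •
        volterra (K * iter (dropAt k fun i => kerInv (b (i + 1))) m) := by
      rw [Finset.mul_sum, map_sum]
      refine Finset.sum_congr rfl fun k _ => ?_
      rw [mul_smul_comm, map_smul]
    have e1 : (L • 1 - d (m + 2) • K) * volterra (K' * J) =
        L • volterra (K' * J) - d (m + 2) • (K * volterra (K' * J)) := by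
      rw [sub_mul, smul_mul_assoc, one_mul, smul_mul_assoc]
    -- Partial fractions together with the defining relation of the logarithmic derivative L; the
    -- multiple of K * (K' * J) left over cancels against the term from integration by parts.
    have e2 : K * (L' • 1 - d (m + 1) • K') * J =
        (L' - L) • (K * J) + L • (K' * J) - d (m + 2) • (K * (K' * J)) := by
      ext t
      have h1 := congrArg (fun f : C(unitInterval, ℂ) => f t) hKK
      simp only [ContinuousMap.sub_apply, ContinuousMap.smul_apply, ContinuousMap.mul_apply,
        smul_eq_mul] at h1
      simp only [ContinuousMap.sub_apply, ContinuousMap.smul_apply, ContinuousMap.mul_apply,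
        ContinuousMap.add_apply, ContinuousMap.one_apply, smul_eq_mul]
      linear_combination (-(L * J t)) * h1 - J t * K' t * K t * hL
    have hp : volterra (K * K * volterra (K' * J)) =
        K * volterra (K' * J) - volterra (K * (K' * J)) := by
      rw [← hparts, map_add]; abel
    rw [mul_add, ← mul_assoc K, e2, e1, smul_mul_assoc, map_add, map_add, map_sub, map_add, hsum,
      map_smul, map_smul, map_smul, map_smul, hp]
    generalize volterra (K * (K' * J)) = A
    generalize volterra (K' * J) = B
    generalize volterra (K * J) = C
    ext t
    simp only [ContinuousMap.sub_apply, ContinuousMap.smul_apply, ContinuousMap.mul_apply,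
        ContinuousMap.add_apply, smul_eq_mul]
    ring

/-- The entry with number 0 is the fixed starting point 0 of integration; including it in the
sequence makes the first logarithmic difference have the same shape as the others. -/
theorem hasFDerivAt_iter {b : ℕ → E → ℂ} {b' : ℕ → E →L[ℂ] ℂ} {e : E} {m : ℕ}
    (hb' : ∀ i ≤ m, HasFDerivAt (b i) (b' i) e) (hb0 : b 0 e = 0) (hb'0 : b' 0 = 0)
    (hb : ∀ i < m, ∀ t : unitInterval, b (i + 1) e - ((t : ℝ) : ℂ) ≠ 0)
    (hne : ∀ i < m, b (i + 1) e ≠ b i e) :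
    ∃ D : E →L[ℂ] C(unitInterval, ℂ),
      HasFDerivAt (fun z => iter (fun i => kerInv (b (i + 1) z)) m) D e ∧
      ∀ v, D v = iterDeriv (fun i => b i e) (fun i => b' i v) m := by
  induction m with
  | zero => exact ⟨0, hasFDerivAt_const _ _, fun v => by simp [iterDeriv]⟩
  | succ m ih =>
    obtain ⟨D, hD, hDv⟩ := ih (fun i hi => hb' i (by omega)) (fun i hi => hb i (by omega))
      (fun i hi => hne i (by omega))
    have h1 : HasFDerivAt (fun z => b (m + 1) z • (1 : C(unitInterval, ℂ)) - coordI)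
        ((b' (m + 1)).smulRight 1) e := ((hb' (m + 1) le_rfl).smul_const 1).sub_const _
    obtain ⟨u, hu⟩ := isUnit_kerInv (hb m (by omega))
    have h2 : HasFDerivAt (fun z => kerInv (b (m + 1) z)) _ e :=
      HasFDerivAt.comp e (g := Ring.inverse)
        (f := fun z => b (m + 1) z • (1 : C(unitInterval, ℂ)) - coordI)
        (hu ▸ hasFDerivAt_ringInverse (𝕜 := ℂ) u) h1
    have h3 := volterra.hasFDerivAt.comp e (h2.mul hD)
    refine ⟨_, h3, fun v => ?_⟩
    rw [← iterDeriv_succ hb0 (by rw [hb'0]; rfl) (fun i hi => hb i (by omega))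
      (fun i hi => hne i (by omega))]
    have hinv : ((u⁻¹ : C(unitInterval, ℂ)ˣ) : C(unitInterval, ℂ)) = kerInv (b (m + 1) e) := by
      rw [kerInv, ← hu, Ring.inverse_unit]
    rw [ContinuousLinearMap.comp_apply]
    congr 1
    rw [add_apply, smul_apply, smul_apply, ContinuousLinearMap.comp_apply, hDv, hinv, add_comm,
      neg_apply, ContinuousLinearMap.mulLeftRight_apply, ContinuousLinearMap.smulRight_apply]
    ext t
    simp only [ContinuousMap.smul_apply, ContinuousMap.mul_apply,
        ContinuousMap.add_apply, ContinuousMap.neg_apply, ContinuousMap.one_apply, smul_eq_mul]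
    ring

end Deriv
end IteratedIntegrals

/-! ### Iterated integrals between points of the plane and their total differential -/

section PolyInt

theorem notMem_segment_iff {a s b : ℂ} :
    b ∉ segment ℝ a s ↔ ∀ t : unitInterval, b - (a + ((t : ℝ) : ℂ) * (s - a)) ≠ 0 := by
  rw [segment_eq_image']
  constructor
  · rintro h t h0
    exact h ⟨t, t.2, by simpa [sub_eq_zero, eq_comm] using h0⟩
  · rintro h ⟨t, ht, h0⟩
    apply h ⟨t, ht⟩
    rw [← h0]
    simp

/-- The iterated integral of `ds / (p 1 - s), …, ds / (p m - s)` along the segment from `p 0` to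
`p (m + 1)`. -/
def polyInt (m : ℕ) (p : ℕ → ℂ) : ℂ :=
  iter (fun i => ker ((p (m + 1) - p 0) / (p (i + 1) - p 0))) m 1

/-- The singular points do not lie on the segment of integration. -/
def Unobstructed (m : ℕ) (p : ℕ → ℂ) : Prop :=
  ∀ i < m, p (i + 1) ∉ segment ℝ (p 0) (p (m + 1))

@[simp] theorem polyInt_zero (p : ℕ → ℂ) : polyInt 0 p = 1 := rfl

theorem polyInt_congr {m : ℕ} {p q : ℕ → ℂ} (h : ∀ i ≤ m + 1, p i = q i) :
    polyInt m p = polyInt m q := by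
  rw [polyInt, polyInt, iter_congr fun i hi => ?_]
  rw [h 0 (by omega), h (m + 1) le_rfl, h (i + 1) (by omega)]

/-- Only ratios of differences of the points enter. This allows the normalization in which the
integration runs from 1 to 0. -/
theorem polyInt_affine {m : ℕ} {p : ℕ → ℂ} {c d : ℂ} (hc : c ≠ 0) :
    polyInt m (fun i => c * p i + d) = polyInt m p := by
  rw [polyInt, polyInt, iter_congr fun i hi => ?_]
  rw [show c * p (m + 1) + d - (c * p 0 + d) = c * (p (m + 1) - p 0) by ring,
    show c * p (i + 1) + d - (c * p 0 + d) = c * (p (i + 1) - p 0) by ring, mul_div_mul_left _ _ hc]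

/-- When the end points coincide, every kernel vanishes. This supplies the initial values in the
reversal formula and at a logarithmic singularity. -/
theorem polyInt_eq_zero {m : ℕ} {p : ℕ → ℂ} (h : p (m + 2) = p 0) : polyInt (m + 1) p = 0 := by
  have h0 : ker 0 = 0 := by
    ext t
    simp [ker]
  simp only [polyInt, iter, h, sub_self, zero_div, h0, zero_mul, map_zero, ContinuousMap.zero_apply]

theorem ne_of_notMem_segment {a s b : ℂ} (h : b ∉ segment ℝ a s) : b - a ≠ 0 := by
  rintro h0
  exact h (sub_eq_zero.1 h0 ▸ left_mem_segment ℝ a s)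

theorem slit_of_notMem_segment {a s b : ℂ} (h : b ∉ segment ℝ a s) : Slit ((s - a) / (b - a)) := by
  intro t h0
  have h1 := ne_of_notMem_segment h
  apply notMem_segment_iff.1 h t
  field_simp at h0
  linear_combination h0

section

variable {E : Type*} [NormedAddCommGroup E] [NormedSpace ℂ E]

/-- The points need not be distinct: coincidences of singular points, and of the two end points, are
harmless as long as the segment is unobstructed. -/
theorem analyticAt_polyInt {p : ℕ → E → ℂ} {e : E} {m : ℕ}
    (hp : ∀ i ≤ m + 1, AnalyticAt ℂ (p i) e) (h : Unobstructed m fun i => p i e) :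
    AnalyticAt ℂ (fun z => polyInt m fun i => p i z) e := by
  have h1 : AnalyticAt ℂ (fun z => iter (fun i => ker ((p (m + 1) z - p 0 z) / (p (i + 1) z - p 0 z)))
      m) e := by
    refine analyticAt_iter (κ := fun i z => ker ((p (m + 1) z - p 0 z) / (p (i + 1) z - p 0 z)))
      fun i hi => ?_
    refine AnalyticAt.comp (g := ker)
      (f := fun z => (p (m + 1) z - p 0 z) / (p (i + 1) z - p 0 z))
      (slit_of_notMem_segment (h i hi)).analyticAt_ker ?_
    exact ((hp _ le_rfl).sub (hp 0 (by omega))).div ((hp (i + 1) (by omega)).sub (hp 0 (by omega)))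
      (ne_of_notMem_segment (h i hi))
  exact ((ContinuousMap.evalCLM ℂ (1 : unitInterval)).analyticAt _).comp h1

/-- Openness comes from compactness of the parameter interval of the segment. -/
theorem eventually_notMem_segment {X : Type*} [TopologicalSpace X] {a s b : X → ℂ} {e : X}
    (ha : ContinuousAt a e) (hs : ContinuousAt s e) (hb : ContinuousAt b e)
    (h : b e ∉ segment ℝ (a e) (s e)) : ∀ᶠ z in 𝓝 e, b z ∉ segment ℝ (a z) (s z) := by
  have := isCompact_univ.eventually_forall_of_forall_eventually (x₀ := e)
    (K := (Set.univ : Set unitInterval))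
    (P := fun z t => b z - (a z + ((t : ℝ) : ℂ) * (s z - a z)) ≠ 0) (fun t _ => by
      have h1 := notMem_segment_iff.1 h t
      have hfst : Tendsto (Prod.fst : X × unitInterval → X) (𝓝 (e, t)) (𝓝 e) := continuousAt_fst
      have hc : ContinuousAt (fun z : X × unitInterval =>
          b z.1 - (a z.1 + ((z.2 : ℝ) : ℂ) * (s z.1 - a z.1))) (e, t) := by
        have ha' : ContinuousAt (fun z : X × unitInterval => a z.1) (e, t) := ha.comp_of_eq hfst rfl
        have hb' : ContinuousAt (fun z : X × unitInterval => b z.1) (e, t) := hb.comp_of_eq hfst rfl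
        have hs' : ContinuousAt (fun z : X × unitInterval => s z.1) (e, t) := hs.comp_of_eq hfst rfl
        have ht' : ContinuousAt (fun z : X × unitInterval => ((z.2 : ℝ) : ℂ)) (e, t) := by fun_prop
        exact hb'.sub (ha'.add (ht'.mul (hs'.sub ha')))
      exact hc.eventually_ne h1)
  filter_upwards [this] with z hz
  exact notMem_segment_iff.2 fun t => hz t trivial

theorem Unobstructed.eventually {X : Type*} [TopologicalSpace X] {p : ℕ → X → ℂ} {e : X} {m : ℕ}
    (hp : ∀ i ≤ m + 1, ContinuousAt (p i) e) (h : Unobstructed m fun i => p i e) :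
    ∀ᶠ z in 𝓝 e, Unobstructed m fun i => p i z := by
  have : ∀ᶠ z in 𝓝 e, ∀ i ∈ Finset.range m, p (i + 1) z ∉ segment ℝ (p 0 z) (p (m + 1) z) := by
    rw [Finset.eventually_all]
    intro i hi
    have hi' := Finset.mem_range.1 hi
    exact eventually_notMem_segment (hp 0 (by omega)) (hp _ le_rfl) (hp _ (by omega)) (h i hi')
  filter_upwards [this] with z hz i hi using hz i (Finset.mem_range.2 hi)

/-- The logarithmic differential of `p (k + 1) - p k`. -/
def dlogForm (p : ℕ → ℂ) (p' : ℕ → E →L[ℂ] ℂ) (k : ℕ) : E →L[ℂ] ℂ :=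
  (p (k + 1) - p k)⁻¹ • (p' (k + 1) - p' k)

/-- After the affine change b_i = (p_i - p_0)/(p_{m+1} - p_0), this is `hasFDerivAt_iter` evaluated
at the end 1. Every term has smaller depth, so continuation and reversal can be proved by induction
on the depth. -/
theorem hasFDerivAt_polyInt {p : ℕ → E → ℂ} {p' : ℕ → E →L[ℂ] ℂ} {e : E} {m : ℕ}
    (hp : ∀ i ≤ m + 1, HasFDerivAt (p i) (p' i) e) (h : Unobstructed m fun i => p i e)
    (hne : ∀ i ≤ m, p (i + 1) e ≠ p i e) (h0 : p (m + 1) e ≠ p 0 e) :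
    HasFDerivAt (fun z => polyInt m fun i => p i z)
      (∑ k ∈ Finset.range m, polyInt (m - 1) (dropAt (k + 1) fun i => p i e) •
        (dlogForm (fun i => p i e) p' k - dlogForm (fun i => p i e) p' (k + 1))) e := by
  have hD0 : p (m + 1) e - p 0 e ≠ 0 := sub_ne_zero.2 h0
  have hpc : ∀ i ≤ m + 1, ContinuousAt (p i) e := fun i hi => (hp i hi).continuousAt
  let b : ℕ → E → ℂ := fun i z => (p i z - p 0 z) / (p (m + 1) z - p 0 z)
  let δ : ℕ → E →L[ℂ] ℂ := fun i => (p (m + 1) e - p 0 e)⁻¹ • (p' i - p' 0) -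
    ((p i e - p 0 e) / (p (m + 1) e - p 0 e) ^ 2) • (p' (m + 1) - p' 0)
  have hb : ∀ i ≤ m + 1, HasFDerivAt (b i) (δ i) e := by
    intro i hi
    have h1 := (hp i hi).fun_sub (hp 0 (by omega))
    have h2 := (hp (m + 1) le_rfl).fun_sub (hp 0 (by omega))
    have h3 := h1.fun_mul (((hasDerivAt_inv hD0).comp_hasFDerivAt e h2))
    refine (h3.congr_fderiv ?_).congr_of_eventuallyEq (Eventually.of_forall fun z => ?_)
    · ext v
      simp [δ]
      field_simp
      ring
    · simp [b, div_eq_mul_inv]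
  have hbt : ∀ i < m, ∀ t : unitInterval, b (i + 1) e - ((t : ℝ) : ℂ) ≠ 0 := by
    intro i hi t ht
    apply notMem_segment_iff.1 (h i hi) t
    simp only [b] at ht
    field_simp at ht
    linear_combination ht
  obtain ⟨D, hD, hDv⟩ := hasFDerivAt_iter (b := b) (b' := δ) (e := e) (m := m)
    (fun i hi => hb i (by omega)) (by simp [b]) (by ext v; simp [δ]) hbt (by
      intro i hi hh
      simp only [b] at hh
      rw [div_left_inj' hD0, sub_left_inj] at hh
      exact hne i (by omega) hh)
  have hev := (ContinuousMap.evalCLM ℂ (1 : unitInterval)).hasFDerivAt.comp e hD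
  have hker : ∀ i < m, ∀ z, Unobstructed m (fun i => p i z) → p (m + 1) z ≠ p 0 z →
      ker ((p (m + 1) z - p 0 z) / (p (i + 1) z - p 0 z)) = kerInv (b (i + 1) z) := by
    intro i hi z hz hz0
    rw [(slit_of_notMem_segment (hz i hi)).ker_eq_kerInv, inv_div]
    exact div_ne_zero (sub_ne_zero.2 hz0) (ne_of_notMem_segment (hz i hi))
  refine (hev.congr_fderiv ?_).congr_of_eventuallyEq ?_
  · ext v
    simp only [ContinuousLinearMap.comp_apply, hDv, ContinuousMap.evalCLM_apply]
    rcases m with _ | m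
    · simp [iterDeriv]
    -- Normalizing the interval subtracts dlog(p_{m+2} - p_0) from every logarithmic differential;
    -- it cancels in the differences of consecutive ones.
    · have hL : ∀ k, k < m + 2 → dlogDiff (fun i => b i e) (fun i => δ i v) k =
          dlogForm (fun i => p i e) p' k v - (p' (m + 2) v - p' 0 v) / (p (m + 2) e - p 0 e) := by
        intro k hk
        have h1 : p (k + 1) e - p k e ≠ 0 := sub_ne_zero.2 (hne k (by omega))
        have h2 : b (k + 1) e - b k e = (p (k + 1) e - p k e) / (p (m + 2) e - p 0 e) := by
          simp only [b]; ring
        have h3 : δ (k + 1) v - δ k v = (p' (k + 1) v - p' k v) / (p (m + 2) e - p 0 e) -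
            (p (k + 1) e - p k e) * (p' (m + 2) v - p' 0 v) / (p (m + 2) e - p 0 e) ^ 2 := by
          simp [δ]; ring
        rw [dlogDiff, h2, h3]
        simp [dlogForm]
        field_simp
      have hdrop : ∀ k < m + 1, iter (dropAt k fun i => kerInv (b (i + 1) e)) m 1 =
          polyInt m (dropAt (k + 1) fun i => p i e) := by
        intro k hk
        rw [polyInt]
        rw [iter_congr fun i hi => ?_]
        by_cases hik : i < k
        · simp only [dropAt, hik, if_true, Nat.succ_pos, show ¬ m + 1 < k + 1 by omega, if_false,
            Nat.succ_lt_succ_iff]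
          rw [hker i (by omega) e h h0]
        · simp only [dropAt, hik, if_true, Nat.succ_pos, show ¬ m + 1 < k + 1 by omega, if_false,
            Nat.succ_lt_succ_iff]
          rw [hker (i + 1) (by omega) e h h0]
      have hδ : δ (m + 2) v = 0 := by
        simp [δ]
        field_simp
        ring
      -- The boundary term at the end 1 is itself a logarithmic difference, because the normalized
      -- end point is constantly 1.
      have hlast : dlogDiff (fun i => b i e) (fun i => δ i v) m - δ (m + 1) v *
          (b (m + 1) e - 1)⁻¹ = dlogForm (fun i => p i e) p' m v -
          dlogForm (fun i => p i e) p' (m + 1) v := by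
        have h5 : b (m + 2) e = 1 := div_self hD0
        have h4 := hL (m + 1) (by omega)
        rw [dlogDiff, h5, hδ] at h4
        have h6 : (0 - δ (m + 1) v) / (1 - b (m + 1) e) = δ (m + 1) v * (b (m + 1) e - 1)⁻¹ := by
          rw [zero_sub, ← div_eq_mul_inv, ← neg_sub (b (m + 1) e), neg_div_neg_eq]
        rw [← h6, h4, hL m (by omega)]
        ring
      simp only [iterDeriv, Nat.add_sub_cancel]
      rw [ContinuousMap.add_apply, ContinuousMap.coe_sum, Finset.sum_apply, Finset.sum_range_succ]
      simp only [Nat.add_eq_zero_iff, one_ne_zero, and_false, if_false, ContinuousMap.mul_apply,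
        ContinuousMap.sub_apply, ContinuousMap.smul_apply, smul_eq_mul, ContinuousMap.one_apply,
        mul_one]
      rw [kerInv_apply (hbt m (by omega))]
      rw [add_apply, sum_apply]
      congr 1
      · refine Finset.sum_congr rfl fun k hk => ?_
        have hk' := Finset.mem_range.1 hk
        rw [hdrop k (by omega), hL k (by omega), hL (k + 1) (by omega)]
        simp
        ring
      · have h7 := hdrop m (by omega)
        rw [iter_congr (κ' := fun i => kerInv (b (i + 1) e)) fun i hi => by simp [dropAt, hi]] at h7
        rw [h7]
        simp only [Set.Icc.coe_one, Complex.ofReal_one, hlast, smul_apply, sub_apply,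
          smul_eq_mul]
        ring
  · have h1 := Unobstructed.eventually hpc h
    have h2 : ∀ᶠ z in 𝓝 e, p (m + 1) z ≠ p 0 z := by
      have := ((hpc (m + 1) le_rfl).sub (hpc 0 (by omega))).eventually_ne hD0
      filter_upwards [this] with z hz using sub_ne_zero.1 hz
    filter_upwards [h1, h2] with z hz1 hz2
    rw [polyInt, iter_congr fun i hi => hker i hi z hz1 hz2]
    rfl

end
end PolyInt

/-! ### Continuation of iterated integrals along paths of distinct points -/

section Continuation

variable {E : Type*} [NormedAddCommGroup E] [NormedSpace ℂ E]

theorem dropAt_apply_map {α β : Type*} (k i : ℕ) (κ : ℕ → α) (g : α → β) :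
    g (dropAt k κ i) = dropAt k (fun j => g (κ j)) i := by
  simp only [dropAt]
  split_ifs <;> rfl

theorem dropAt_eq_index {α : Type*} (k : ℕ) (κ : ℕ → α) (i : ℕ) :
    dropAt k κ i = κ (dropAt k id i) := (dropAt_apply_map k i id κ).symm

theorem dropAt_id_lt {k i j : ℕ} (h : i < j) : dropAt k id i < dropAt k id j := by
  simp only [dropAt, id]
  split_ifs <;> omega

theorem dropAt_id_le (k i : ℕ) : dropAt k id i ≤ i + 1 := by
  simp only [dropAt, id]
  split_ifs <;> omega

theorem Unobstructed.dropAt {m : ℕ} {p : ℕ → ℂ} (h : Unobstructed (m + 1) p) {k : ℕ}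
    (hk : k ≤ m) : Unobstructed m (dropAt (k + 1) p) := by
  intro i hi
  simp only [MultipleLog.dropAt, Nat.succ_pos, if_true, show ¬ m + 1 < k + 1 by omega, if_false]
  split_ifs with h1
  · exact h i (by omega)
  · exact h (i + 1) (by omega)

theorem isGermFamily_sum_smul {S : Set ℝ} {γ : ℝ → E} {ι : Type*} (s : Finset ι)
    {G : ι → ℝ → E → ℂ} (hG : ∀ i ∈ s, IsGermFamily S γ (G i)) {ω : ι → E → E →L[ℂ] ℂ}
    (hω : ∀ i ∈ s, ∀ t ∈ S, AnalyticAt ℂ (ω i) (γ t)) :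
    IsGermFamily S γ (fun t z => ∑ i ∈ s, G i t z • ω i z) := by
  refine ⟨fun t ht => Finset.analyticAt_fun_sum _ fun i hi =>
    ((hG i hi).1 t ht).smul (hω i hi t ht), fun t ht => ?_⟩
  have : ∀ᶠ u in 𝓝[S] t, ∀ i ∈ s, G i u =ᶠ[𝓝 (γ u)] G i t :=
    (Finset.eventually_all s).2 fun i hi => (hG i hi).2 t ht
  filter_upwards [this] with u hu
  filter_upwards [(Finset.eventually_all s).2 hu] with z hz
  exact Finset.sum_congr rfl fun i hi => by rw [hz i hi]

theorem analyticAt_dlogForm [CompleteSpace E] {p : ℕ → E → ℂ} {k : ℕ} {e : E}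
    (h1 : AnalyticAt ℂ (p k) e)
    (h2 : AnalyticAt ℂ (p (k + 1)) e) (hne : p (k + 1) e ≠ p k e) :
    AnalyticAt ℂ (fun z => dlogForm (fun i => p i z) (fun i => fderiv ℂ (p i) z) k) e :=
  ((h2.sub h1).inv (sub_ne_zero.2 hne)).smul (h2.fderiv.sub h1.fderiv)

/-- Induction on the depth: the coefficients of the differential are integrals with one point
dropped and continue by hypothesis; the logarithmic forms are regular while the points are distinct;
and a germ continues as soon as its differential does. Unobstructedness is needed only at the start.
-/
theorem exists_cont_polyInt [CompleteSpace E] {m : ℕ} {p : ℕ → E → ℂ} {γ : ℝ → E}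
    (hγ : Continuous γ) {a b : ℝ}
    (hab : a ≤ b) (hp : ∀ i ≤ m + 1, ∀ t ∈ Set.Icc a b, AnalyticAt ℂ (p i) (γ t))
    (hne : ∀ i j, i < j → j ≤ m + 1 → ∀ t ∈ Set.Icc a b, p i (γ t) ≠ p j (γ t))
    (h : Unobstructed m fun i => p i (γ a)) :
    ∃ g, Cont γ a b (fun z => polyInt m fun i => p i z) g := by
  induction m generalizing p with
  | zero => exact ⟨_, Cont.const (f := fun _ => (1 : ℂ)) fun _ _ => analyticAt_const⟩
  | succ m ih =>
    have ha : a ∈ Set.Icc a b := Set.left_mem_Icc.2 hab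
    have hIH : ∀ k ∈ Finset.range (m + 1), ∃ G : ℝ → E → ℂ, IsGermFamily (Set.Icc a b) γ G ∧
        G a =ᶠ[𝓝 (γ a)] fun z => polyInt m (dropAt (k + 1) fun i => p i z) := by
      intro k hk
      have hk' := Finset.mem_range.1 hk
      obtain ⟨g, G, hG, hGa, -⟩ := ih (p := dropAt (k + 1) p) (fun i hi t ht => by
          rw [dropAt_eq_index]
          exact hp _ ((dropAt_id_le _ _).trans (by omega)) t ht)
        (fun i j hij hj t ht => by
          rw [dropAt_eq_index, dropAt_eq_index (κ := p) (i := j)]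
          exact hne _ _ (dropAt_id_lt hij) ((dropAt_id_le _ _).trans (by omega)) t ht)
        (by
          have := h.dropAt (k := k) (by omega)
          intro i hi
          have := this i hi
          simp only [dropAt_apply_map _ _ p (fun f => f (γ a))]
          exact this)
      refine ⟨G, hG, hGa.trans (Eventually.of_forall fun z => ?_)⟩
      refine congrArg _ (funext fun i => ?_)
      exact dropAt_apply_map _ _ p (fun f => f z)
    choose! G hG hGa using hIH
    refine exists_cont_of_fderiv hγ hab (isGermFamily_sum_smul (Finset.range (m + 1)) hG
      (ω := fun k z => dlogForm (fun i => p i z) (fun i => fderiv ℂ (p i) z) k -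
        dlogForm (fun i => p i z) (fun i => fderiv ℂ (p i) z) (k + 1))
      fun k hk t ht => ?_) ?_
    · have hk' := Finset.mem_range.1 hk
      exact (analyticAt_dlogForm (hp _ (by omega) t ht) (hp _ (by omega) t ht)
        (hne _ _ (by omega) (by omega) t ht).symm).sub (analyticAt_dlogForm
        (hp _ (by omega) t ht) (hp _ (by omega) t ht) (hne _ _ (by omega) (by omega) t ht).symm)
    · have hpa : ∀ i ≤ m + 2, AnalyticAt ℂ (p i) (γ a) := fun i hi => hp i hi a ha
      have h1 : ∀ᶠ z in 𝓝 (γ a), ∀ i ∈ Finset.range (m + 3), AnalyticAt ℂ (p i) z :=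
        (Finset.eventually_all _).2 fun i hi =>
          (hpa i (by have := Finset.mem_range.1 hi; omega)).eventually_analyticAt
      have h2 : ∀ᶠ z in 𝓝 (γ a), ∀ i ∈ Finset.range (m + 2), p (i + 1) z ≠ p i z :=
        (Finset.eventually_all _).2 fun i hi => by
          have hi' := Finset.mem_range.1 hi
          filter_upwards [((hpa (i + 1) (by omega)).continuousAt.sub
            (hpa i (by omega)).continuousAt).eventually_ne
            (sub_ne_zero.2 (hne i (i + 1) (by omega) (by omega) a ha).symm)] with z hz
          exact sub_ne_zero.1 hz
      have h3 : ∀ᶠ z in 𝓝 (γ a), p (m + 2) z ≠ p 0 z := by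
        filter_upwards [((hpa (m + 2) (by omega)).continuousAt.sub
            (hpa 0 (by omega)).continuousAt).eventually_ne
            (sub_ne_zero.2 (hne 0 (m + 2) (by omega) (by omega) a ha).symm)] with z hz
        exact sub_ne_zero.1 hz
      filter_upwards [h1, h2, h3, (Finset.eventually_all _).2 hGa,
        Unobstructed.eventually (fun i hi => (hpa i hi).continuousAt) h] with z h1 h2 h3 h4 h5
      refine (hasFDerivAt_polyInt (p' := fun i => fderiv ℂ (p i) z)
        (fun i hi => (h1 i (Finset.mem_range.2 (by omega))).differentiableAt.hasFDerivAt) h5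
        (fun i hi => h2 i (Finset.mem_range.2 (by omega))) h3).congr_fderiv ?_
      refine Finset.sum_congr rfl fun k hk => ?_
      simp only [Nat.add_sub_cancel]
      rw [h4 k hk]

end Continuation

/-! ### Reversal of the path of integration -/

section Reverse

theorem dropAt_reverse {α : Type*} {m k i : ℕ} (hk : k ≤ m) (hi : i ≤ m + 1) (p : ℕ → α) :
    dropAt (k + 1) (fun i => p (m + 2 - i)) i = dropAt (m - k + 1) p (m + 1 - i) := by
  simp only [dropAt]
  split_ifs <;> first | omega | (congr 1; omega)

theorem Unobstructed.reverse {m : ℕ} {p : ℕ → ℂ} (h : Unobstructed m p) :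
    Unobstructed m fun i => p (m + 1 - i) := by
  intro i hi
  simp only [Nat.sub_zero, Nat.sub_self]
  rw [segment_symm]
  have := h (m - 1 - i) (by omega)
  rwa [show m - 1 - i + 1 = m + 1 - (i + 1) by omega] at this

theorem inv_sub_smul_sub_comm {E : Type*} [NormedAddCommGroup E] [NormedSpace ℂ E] (a b : ℂ)
    (A B : E →L[ℂ] ℂ) : (a - b)⁻¹ • (A - B) = (b - a)⁻¹ • (B - A) := by
  ext v
  rw [← neg_sub b a, inv_neg]
  simp
  ring

/-- Let the end point move along the segment towards p_0. By induction on the depth both sides have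
the same derivative, and both vanish in the limit when the segment has length zero. -/
theorem polyInt_reverse {m : ℕ} {p : ℕ → ℂ} (h : Unobstructed m p)
    (hne : ∀ i j, i < j → j ≤ m + 1 → p i ≠ p j) :
    polyInt m p = (-1) ^ m * polyInt m fun i => p (m + 1 - i) := by
  induction m generalizing p with
  | zero => simp
  | succ m ih =>
    have h0 : p (m + 2) ≠ p 0 := (hne 0 (m + 2) (by omega) le_rfl).symm
    -- The configuration with its last point moved to the proportion τ of the segment. Shorter
    -- segments remain unobstructed.
    let P : ℕ → ℂ → ℂ := fun i τ => if i = m + 2 then p 0 + τ * (p (m + 2) - p 0) else p i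
    have hP : ∀ i τ, i ≠ m + 2 → P i τ = p i := fun i τ hi => if_neg hi
    have hP' : ∀ τ, P (m + 2) τ = p 0 + τ * (p (m + 2) - p 0) := fun τ => if_pos rfl
    have hPd : ∀ i τ, DifferentiableAt ℂ (P i) τ := by
      intro i τ
      by_cases hi : i = m + 2
      · subst hi
        rw [funext hP']
        fun_prop
      · rw [funext fun τ => hP i τ hi]
        fun_prop
    have hPa : ∀ i τ, AnalyticAt ℂ (P i) τ := by
      intro i τ
      by_cases hi : i = m + 2
      · subst hi
        rw [funext hP']
        fun_prop
      · rw [funext fun τ => hP i τ hi]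
        fun_prop
    have hmem : ∀ τ : ℝ, 0 ≤ τ → τ ≤ 1 → p 0 + (τ : ℂ) * (p (m + 2) - p 0) ∈
        segment ℝ (p 0) (p (m + 2)) := by
      intro τ h1 h2
      rw [segment_eq_image']
      exact ⟨τ, ⟨h1, h2⟩, by simp⟩
    have hU : ∀ τ : ℝ, 0 ≤ τ → τ ≤ 1 → Unobstructed (m + 1) fun i => P i τ := by
      intro τ h1 h2 i hi hmem'
      simp only [hP', hP 0 _ (by omega), hP (i + 1) _ (show i + 1 ≠ m + 2 by omega)] at hmem'
      exact h i hi ((convex_segment (p 0) (p (m + 2))).segment_subset (left_mem_segment ℝ _ _)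
        (hmem τ h1 h2) hmem')
    have hN : ∀ τ : ℝ, 0 < τ → τ ≤ 1 → ∀ i j, i < j → j ≤ m + 2 → P i τ ≠ P j τ := by
      intro τ h1 h2 i j hij hj
      rw [hP i _ (by omega)]
      by_cases hj' : j = m + 2
      · subst hj'
        rw [hP']
        rcases i with _ | i
        · intro h3
          have : (τ : ℂ) * (p (m + 2) - p 0) = 0 := by linear_combination -h3
          exact mul_ne_zero (by exact_mod_cast h1.ne') (sub_ne_zero.2 h0) this
        · intro h3
          exact h i (by omega) (h3 ▸ hmem τ h1.le h2)
      · rw [hP j _ hj']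
        exact hne i j hij hj
    let D : ℂ → ℂ := fun τ => (polyInt (m + 1) fun i => P i τ) -
      (-1) ^ (m + 1) * polyInt (m + 1) fun i => P (m + 2 - i) τ
    have hDa : ∀ τ : ℝ, 0 ≤ τ → τ ≤ 1 → AnalyticAt ℂ D τ := by
      intro τ h1 h2
      exact (analyticAt_polyInt (fun i _ => hPa i τ) (hU τ h1 h2)).sub (analyticAt_const.mul
        (analyticAt_polyInt (fun i _ => hPa (m + 2 - i) τ) (hU τ h1 h2).reverse))
    have hDd : ∀ τ : ℝ, 0 < τ → τ ≤ 1 → HasDerivAt D 0 τ := by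
      intro τ h1 h2
      have hn := hN τ h1 h2
      have e1 := hasFDerivAt_polyInt (p := P) (p' := fun i => fderiv ℂ (P i) τ) (e := (τ : ℂ))
        (m := m + 1) (fun i _ => (hPd i τ).hasFDerivAt) (hU τ h1.le h2)
        (fun i hi => (hn i (i + 1) (by omega) (by omega)).symm)
        (hn 0 (m + 2) (by omega) le_rfl).symm
      have e2 := hasFDerivAt_polyInt (p := fun i => P (m + 2 - i))
        (p' := fun i => fderiv ℂ (P (m + 2 - i)) τ) (e := (τ : ℂ))
        (m := m + 1) (fun i _ => (hPd (m + 2 - i) τ).hasFDerivAt) (hU τ h1.le h2).reverse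
        (fun i hi => hn _ _ (by omega) (by omega))
        (by simpa using hn 0 (m + 2) (by omega) le_rfl)
      have e3 : HasFDerivAt D (0 : ℂ →L[ℂ] ℂ) (τ : ℂ) := by
        refine (e1.fun_sub (e2.const_mul ((-1) ^ (m + 1)))).congr_fderiv ?_
        rw [← Finset.sum_range_reflect, Finset.smul_sum, ← Finset.sum_sub_distrib]
        refine Finset.sum_eq_zero fun k hk => ?_
        have hk' := Finset.mem_range.1 hk
        have hd : dlogForm (fun i => P (m + 2 - i) τ) (fun i => fderiv ℂ (P (m + 2 - i)) τ) k =
            dlogForm (fun i => P i τ) (fun i => fderiv ℂ (P i) τ) (m - k + 1) := by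
          simp only [dlogForm]
          rw [show m + 2 - (k + 1) = m - k + 1 by omega, show m + 2 - k = m - k + 1 + 1 by omega]
          exact inv_sub_smul_sub_comm ..
        have hd' : dlogForm (fun i => P (m + 2 - i) τ) (fun i => fderiv ℂ (P (m + 2 - i)) τ)
            (k + 1) = dlogForm (fun i => P i τ) (fun i => fderiv ℂ (P i) τ) (m - k) := by
          simp only [dlogForm]
          rw [show m + 2 - (k + 1 + 1) = m - k by omega, show m + 2 - (k + 1) = m - k + 1 by omega]
          exact inv_sub_smul_sub_comm ..
        have hI := ih (p := dropAt (m - k + 1) fun i => P i τ)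
          ((hU τ h1.le h2).dropAt (by omega)) (fun i j hij hj => by
            rw [dropAt_eq_index, dropAt_eq_index (i := j)]
            exact hn _ _ (dropAt_id_lt hij) ((dropAt_id_le _ _).trans (by omega)))
        rw [hd, hd']
        simp only [Nat.add_sub_cancel] at hI ⊢
        rw [hI]
        rw [polyInt_congr (p := dropAt (k + 1) _) (q := fun i =>
          dropAt (m - k + 1) (fun i => P i τ) (m + 1 - i)) fun i hi =>
          dropAt_reverse (p := fun i => P i τ) (by omega) hi]
        ext
        simp
        ring
      exact e3.hasDerivAt
    -- The parameter is u = 1 - τ because the derivative is known for τ > 0 only: at τ = 0 the end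
    -- points coincide and just continuity is available.
    have hc := constant_of_has_deriv_right_zero (f := fun u : ℝ => D ((1 - u : ℝ) : ℂ)) (a := 0)
      (b := 1) (fun u hu => by
        have h1 := (hDa (1 - u) (by linarith [hu.2]) (by linarith [hu.1])).continuousAt
        have h2 : ContinuousAt (fun u : ℝ => ((1 - u : ℝ) : ℂ)) u := by fun_prop
        exact (ContinuousAt.comp (g := D) (f := fun u : ℝ => ((1 - u : ℝ) : ℂ)) h1 h2).continuousWithinAt)
      (fun u hu => by
        have h1 := hDd (1 - u) (by linarith [hu.2]) (by linarith [hu.1])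
        have h2 : HasDerivAt (fun u : ℝ => 1 - u) (-1) u := by
          simpa using (hasDerivAt_id u).const_sub 1
        have h3 := HasDerivAt.scomp u h1.comp_ofReal h2
        simp only [smul_zero] at h3
        exact h3.hasDerivWithinAt) 1 (by simp)
    have hD0 : D 0 = 0 := by
      simp only [D]
      rw [polyInt_eq_zero (by simp [hP', hP]), polyInt_eq_zero (by simp [hP', hP])]
      simp
    have hP1 : ∀ i ≤ m + 2, P i 1 = p i := by
      intro i hi
      by_cases h1 : i = m + 2
      · subst h1; simp [hP']
      · exact hP i 1 h1
    have hD1 : D 1 = polyInt (m + 1) p - (-1) ^ (m + 1) * polyInt (m + 1) fun i => p (m + 2 - i) := by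
      simp only [D]
      rw [polyInt_congr fun i hi => hP1 i hi, polyInt_congr (p := fun i => P (m + 2 - i) 1)
        fun i hi => hP1 _ (by omega)]
    simp only [sub_self, sub_zero, Complex.ofReal_zero, Complex.ofReal_one, hD0, hD1] at hc
    exact sub_eq_zero.1 hc.symm

end Reverse

/-! ### The power series of the multiple logarithm as an iterated integral -/

section ChainSum

/-- The terms of the power series of the multiple logarithm. -/
def chainTerm (m : ℕ) (y : ℕ → ℂ) (k : Fin m → ℕ) : ℂ := ∏ i : Fin m, y i ^ k i / (k i : ℂ)

/-- Strictly increasing sequences of positive integers bounded by `N`. -/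
def chains (m : ℕ) (N : ℕ∞) : Set (Fin m → ℕ) :=
  {k | StrictMono k ∧ ∀ i, 0 < k i ∧ (k i : ℕ∞) < N}

/-- The sum of the terms of the power series of the multiple logarithm with exponents below `N`. -/
def chainSum (m : ℕ) (y : ℕ → ℂ) (N : ℕ∞) : ℂ := ∑' k, (chains m N).indicator (chainTerm m y) k

theorem norm_pow_div_natCast_le {z : ℂ} {r : ℝ} (h : ‖z‖ ≤ r) (k : ℕ) :
    ‖z ^ k / (k : ℂ)‖ ≤ r ^ k := by
  rcases k.eq_zero_or_pos with rfl | hk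
  · simp
  · rw [norm_div, norm_pow, Complex.norm_natCast]
    exact (div_le_self (by positivity) (by exact_mod_cast hk)).trans
      (pow_le_pow_left₀ (norm_nonneg _) h _)

theorem summable_prod_pow {r : ℝ} (h0 : 0 ≤ r) (h1 : r < 1) (m : ℕ) :
    Summable fun k : Fin m → ℕ => ∏ i, r ^ k i := by
  induction m with
  | zero => exact (hasSum_fintype _).summable
  | succ m ih =>
    rw [← (Fin.snocEquiv fun _ => ℕ).summable_iff]
    refine ((ih.mul_of_nonneg (summable_geometric_of_lt_one h0 h1) (fun k => by positivity)
      fun k => by positivity).comp_injective (Equiv.prodComm ℕ (Fin m → ℕ)).injective).congr ?_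
    rintro ⟨N, k⟩
    simp [Fin.snocEquiv, Fin.prod_univ_castSucc]

variable {y : ℕ → ℂ} {r : ℝ}

theorem norm_chainTerm_le (h : ∀ i, ‖y i‖ ≤ r) {m : ℕ} (N : ℕ∞) (k : Fin m → ℕ) :
    ‖(chains m N).indicator (chainTerm m y) k‖ ≤ ∏ i, r ^ k i := by
  have hr : 0 ≤ r := (norm_nonneg _).trans (h 0)
  refine (norm_indicator_le_norm_self _ _).trans ?_
  rw [chainTerm, norm_prod]
  exact Finset.prod_le_prod (fun i _ => norm_nonneg _) fun i _ => norm_pow_div_natCast_le (h i) _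

theorem summable_chainTerm (h : ∀ i, ‖y i‖ ≤ r) (h1 : r < 1) {m : ℕ} (N : ℕ∞) :
    Summable ((chains m N).indicator (chainTerm m y)) :=
  Summable.of_norm_bounded (summable_prod_pow ((norm_nonneg _).trans (h 0)) h1 m)
    (norm_chainTerm_le h N)

theorem norm_chainSum_le (h : ∀ i, ‖y i‖ ≤ r) (h1 : r < 1) (m : ℕ) (N : ℕ∞) :
    ‖chainSum m y N‖ ≤ ∑' k : Fin m → ℕ, ∏ i, r ^ k i :=
  tsum_of_norm_bounded (summable_prod_pow ((norm_nonneg _).trans (h 0)) h1 m).hasSum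
    (norm_chainTerm_le h N)

theorem snoc_mem_chains {m : ℕ} {k : Fin m → ℕ} {a : ℕ} {N : ℕ∞} :
    (Fin.snoc k a : Fin (m + 1) → ℕ) ∈ chains (m + 1) N ↔ 0 < a ∧ (a : ℕ∞) < N ∧ k ∈ chains m a := by
  constructor
  · rintro ⟨hs, h⟩
    have ha := h (Fin.last m)
    rw [Fin.snoc_last] at ha
    refine ⟨ha.1, ha.2, fun i j hij => ?_, fun i => ⟨?_, ?_⟩⟩
    · simpa using hs (Fin.castSucc_lt_castSucc_iff.2 hij)
    · simpa using (h i.castSucc).1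
    · simpa using hs (Fin.castSucc_lt_last i)
  · rintro ⟨ha, haN, hs, h⟩
    refine ⟨fun i j hij => ?_, fun i => ?_⟩
    · induction j using Fin.lastCases with
      | last =>
        induction i using Fin.lastCases with
        | last => exact absurd hij (lt_irrefl _)
        | cast i => simpa using (h i).2
      | cast j =>
        induction i using Fin.lastCases with
        | last => exact absurd (hij.trans (Fin.castSucc_lt_last j)) (lt_irrefl _)
        | cast i => simpa using hs (Fin.castSucc_lt_castSucc_iff.1 hij)
    · induction i using Fin.lastCases with
      | last => simpa using ⟨ha, haN⟩
      | cast i => simpa using ⟨(h i).1, (h i).2.trans haN⟩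

/-- The summation is grouped by the largest exponent a; the remaining exponents form a chain below
a. -/
theorem chainSum_succ (h : ∀ i, ‖y i‖ ≤ r) (h1 : r < 1) (m : ℕ) (N : ℕ∞) :
    chainSum (m + 1) y N =
      ∑' a : ℕ, if (a : ℕ∞) < N then y m ^ a / (a : ℂ) * chainSum m y a else 0 := by
  have hS := ((Fin.snocEquiv fun _ => ℕ).summable_iff).2 (summable_chainTerm h h1 (m := m + 1) N)
  rw [chainSum, ← (Fin.snocEquiv fun _ => ℕ).tsum_eq]
  refine hS.tsum_prod.trans (tsum_congr fun a => ?_)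
  rw [chainSum, ← tsum_mul_left]
  split_ifs with haN
  · refine tsum_congr fun k => ?_
    have e : (Fin.snocEquiv fun _ => ℕ) (a, k) = (Fin.snoc k a : Fin (m + 1) → ℕ) := rfl
    simp only [Function.comp_apply, e]
    have ht : chainTerm (m + 1) y (Fin.snoc k a : Fin (m + 1) → ℕ) =
        y m ^ a / (a : ℂ) * chainTerm m y k := by
      simp only [chainTerm, Fin.prod_univ_castSucc, Fin.snoc_castSucc, Fin.snoc_last,
        Fin.val_castSucc, Fin.val_last]
      rw [mul_comm]
    by_cases hk : k ∈ chains m a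
    -- Exponents must be positive; the spurious term a = 0 vanishes anyway since division by 0 gives
    -- 0.
    · rcases a.eq_zero_or_pos with rfl | ha
      · rw [Set.indicator_of_notMem fun hh => (snoc_mem_chains.1 hh).1.ne rfl]
        simp
      · rw [Set.indicator_of_mem (snoc_mem_chains.2 ⟨ha, haN, hk⟩), Set.indicator_of_mem hk, ht]
    · rw [Set.indicator_of_notMem fun hh => hk (snoc_mem_chains.1 hh).2.2,
        Set.indicator_of_notMem hk, mul_zero]
  · rw [← tsum_zero (α := ℂ) (β := Fin m → ℕ)]
    exact tsum_congr fun k => Set.indicator_of_notMem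
      (fun hh => haN (snoc_mem_chains.1 hh).2.1) _

theorem chainSum_succ_natCast (h : ∀ i, ‖y i‖ ≤ r) (h1 : r < 1) (m N : ℕ) :
    chainSum (m + 1) y N = ∑ a ∈ Finset.range N, y m ^ a / (a : ℂ) * chainSum m y a := by
  rw [chainSum_succ h h1, tsum_eq_sum (s := Finset.range N)]
  · exact Finset.sum_congr rfl fun a ha => if_pos (by simpa using ha)
  · exact fun a ha => if_neg (by simpa using ha)

theorem chainSum_succ_top (h : ∀ i, ‖y i‖ ≤ r) (h1 : r < 1) (m : ℕ) :
    chainSum (m + 1) y ⊤ = ∑' a : ℕ, y m ^ a / (a : ℂ) * chainSum m y a := by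
  rw [chainSum_succ h h1]
  exact tsum_congr fun a => if_pos (ENat.natCast_lt_top a)

theorem chainSum_zero (y : ℕ → ℂ) (N : ℕ∞) : chainSum 0 y N = 1 := by
  rw [chainSum, tsum_eq_single (default : Fin 0 → ℕ) fun k hk => (hk (Subsingleton.elim _ _)).elim,
    Set.indicator_of_mem (show (default : Fin 0 → ℕ) ∈ chains 0 N from
      ⟨Subsingleton.strictMono _, fun i => i.elim0⟩)]
  simp [chainTerm]

theorem multilogSeries_eq_chainSum (m : ℕ) (y : ℕ → ℂ) :
    multilogSeries m (fun i => y i) = chainSum m y ⊤ := by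
  rw [multilogSeries, chainSum, ← tsum_subtype]
  have : chains m ⊤ = {k : Fin m → ℕ | StrictMono k ∧ ∀ i, 0 < k i} := by
    ext k
    simp [chains]
  rw [this]
  rfl

theorem volterra_coordI_pow (k : ℕ) :
    volterra (coordI ^ k) = ((k + 1 : ℕ) : ℂ)⁻¹ • coordI ^ (k + 1) := by
  refine volterra_eq_of_hasDerivAt (G := fun t => ((k + 1 : ℕ) : ℂ)⁻¹ * (t : ℂ) ^ (k + 1))
    (fun t => ?_) (by simp) fun t => by simp
  have h1 := ((hasDerivAt_pow (k + 1) ((t : ℝ) : ℂ)).comp_ofReal).const_mul ((k + 1 : ℕ) : ℂ)⁻¹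
  refine h1.congr_deriv ?_
  have : ((k + 1 : ℕ) : ℂ) ≠ 0 := by exact_mod_cast k.succ_ne_zero
  simp only [Nat.add_sub_cancel, ContinuousMap.pow_apply, coordI_apply]
  field_simp

theorem norm_coordI_le : ‖coordI‖ ≤ 1 := by
  rw [ContinuousMap.norm_le _ zero_le_one]
  intro t
  rw [coordI_apply, Complex.norm_real, Real.norm_of_nonneg t.2.1]
  exact t.2.2

theorem summable_smul_coordI_pow {c : ℕ → ℂ} {ρ C : ℝ} (h0 : 0 ≤ ρ) (h : ρ < 1)
    (hc : ∀ N, ‖c N‖ ≤ C * ρ ^ N) : Summable fun N => c N • coordI ^ N := by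
  refine Summable.of_norm_bounded ((summable_geometric_of_lt_one h0 h).mul_left C) fun N => ?_
  rw [norm_smul]
  refine (mul_le_of_le_one_right (norm_nonneg _) ?_).trans (hc N)
  exact (norm_pow_le _ _).trans (pow_le_one₀ (norm_nonneg _) norm_coordI_le)

/-- The weights of the iterated integral which represents the multiple logarithm. -/
def weight (y : ℕ → ℂ) (s : ℂ) (m i : ℕ) : ℂ := s * ∏ j ∈ Finset.Ico i m, y j

/-- The outermost kernel c/(1 - cu), with c = s·y_m, cancels the factor 1 - cu of the inner
integral, and the remaining power series is integrated termwise. It converges even for ‖s‖ = 1, as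
required for the final value s = 1. -/
theorem iter_weight_succ_of {m : ℕ} (h : ∀ i, ‖y i‖ ≤ r) (h1 : r < 1) {s : ℂ} (hs : ‖s‖ ≤ 1)
    (hm : iter (fun i => ker (weight y (s * y m) m i)) m = (1 - (s * y m) • coordI) *
      ∑' N : ℕ, (chainSum m y (N + 1 : ℕ) * (s * y m) ^ N) • coordI ^ N) :
    iter (fun i => ker (weight y s (m + 1) i)) (m + 1) =
      ∑' N : ℕ, (y m ^ N / (N : ℂ) * chainSum m y N * s ^ N) • coordI ^ N := by
  have hr : 0 ≤ r := (norm_nonneg _).trans (h 0)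
  set c := s * y m with hc
  have hcr : ‖c‖ ≤ r := by
    rw [hc, norm_mul]
    exact (mul_le_of_le_one_left (norm_nonneg _) hs).trans (h m)
  set C := ∑' k : Fin m → ℕ, ∏ i, r ^ k i with hC
  have hCn : 0 ≤ C := tsum_nonneg fun k => by positivity
  have hS : Summable fun N : ℕ => (chainSum m y (N + 1 : ℕ) * c ^ N) • coordI ^ N :=
    summable_smul_coordI_pow (C := C) hr h1 fun N => by
      rw [norm_mul, norm_pow]
      gcongr
      exact norm_chainSum_le h h1 m _
  have hslit : Slit c := by
    intro t h0
    have h2 : ‖c * ((t : ℝ) : ℂ)‖ < 1 := by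
      rw [norm_mul, Complex.norm_real, Real.norm_of_nonneg t.2.1]
      exact (mul_le_of_le_one_right (norm_nonneg _) t.2.2).trans_lt (hcr.trans_lt h1)
    rw [← sub_eq_zero.1 h0] at h2
    simp at h2
  rw [iter, iter_congr (κ' := fun i => ker (weight y c m i)) fun i hi => by
    simp only [weight]
    rw [Finset.prod_Ico_succ_top hi.le, hc]
    congr 1
    ring]
  have hw : weight y s (m + 1) m = c := by simp [weight, hc]
  have hkc : ker c * (1 - c • coordI) = c • 1 := by
    rw [ker, smul_mul_assoc, Ring.inverse_mul_cancel _ hslit.isUnit]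
  have hterm : ∀ N : ℕ, c • volterra ((chainSum m y (N + 1 : ℕ) * c ^ N) • coordI ^ N) =
      (y m ^ (N + 1) / ((N + 1 : ℕ) : ℂ) * chainSum m y (N + 1 : ℕ) * s ^ (N + 1)) •
        coordI ^ (N + 1) := by
    intro N
    rw [map_smul, volterra_coordI_pow]
    ext t
    simp only [ContinuousMap.smul_apply, smul_eq_mul, hc]
    ring
  have hS' := ((volterra.summable hS).const_smul c).congr fun N => hterm N
  rw [hm, hw, ← mul_assoc, hkc, smul_mul_assoc, one_mul, map_smul, volterra.map_tsum hS,
    ← tsum_const_smul'' c, tsum_congr hterm, tsum_eq_zero_add' (f := fun N : ℕ =>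
      (y m ^ N / (N : ℂ) * chainSum m y N * s ^ N) • coordI ^ N) hS']
  refine (add_eq_right.2 ?_).symm
  ext t
  simp

/-- Abel summation: multiplying the generating series of the partial sums by 1 - su turns it into
the series of the increments. The series of partial sums is where ‖s‖ < 1 is used. -/
theorem iter_weight_of_norm_lt (h : ∀ i, ‖y i‖ ≤ r) (h1 : r < 1) (m : ℕ) {s : ℂ} (hs : ‖s‖ < 1) :
    iter (fun i => ker (weight y s m i)) m = (1 - s • coordI) *
      ∑' N : ℕ, (chainSum m y (N + 1 : ℕ) * s ^ N) • coordI ^ N := by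
  have hr : 0 ≤ r := (norm_nonneg _).trans (h 0)
  induction m generalizing s with
  | zero =>
    have hX : ‖s • coordI‖ < 1 := by
      rw [norm_smul]
      exact (mul_le_of_le_one_right (norm_nonneg _) norm_coordI_le).trans_lt hs
    simp only [chainSum_zero, one_mul, iter]
    rw [tsum_congr fun N => (smul_pow s coordI N).symm]
    exact (mul_neg_geom_series (s • coordI) hX).symm
  | succ m ih =>
    have hsm : ‖s * y m‖ < 1 := by
      rw [norm_mul]
      exact (mul_le_of_le_one_left (norm_nonneg _) hs.le).trans_lt ((h m).trans_lt h1)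
    rw [iter_weight_succ_of h h1 hs.le (ih hsm)]
    set C := ∑' k : Fin (m + 1) → ℕ, ∏ i, r ^ k i with hC
    have hA : Summable fun N : ℕ => (chainSum (m + 1) y (N + 1 : ℕ) * s ^ N) • coordI ^ N :=
      summable_smul_coordI_pow (C := C) (norm_nonneg s) hs fun N => by
        rw [norm_mul, norm_pow]
        gcongr
        exact norm_chainSum_le h h1 _ _
    have hB : Summable fun N : ℕ => (chainSum (m + 1) y N * s ^ N) • coordI ^ N :=
      summable_smul_coordI_pow (C := C) (norm_nonneg s) hs fun N => by
        rw [norm_mul, norm_pow]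
        gcongr
        exact norm_chainSum_le h h1 _ _
    have h0 : chainSum (m + 1) y (0 : ℕ) = 0 := by
      rw [chainSum_succ_natCast h h1]
      simp
    -- Multiplication by su shifts the index; no term is lost because the partial sum below 0 is
    -- zero.
    have e1 : ∑' N : ℕ, (chainSum (m + 1) y N * s ^ N) • coordI ^ N =
        s • coordI * ∑' N : ℕ, (chainSum (m + 1) y (N + 1 : ℕ) * s ^ N) • coordI ^ N := by
      have e2 := hA.tsum_mul_left (s • coordI)
      rw [hB.tsum_eq_zero_add, ← e2, h0]
      have e3 : ((0 : ℂ) * s ^ 0) • coordI ^ 0 = 0 := by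
        ext t
        simp
      rw [e3, zero_add]
      refine tsum_congr fun N => ?_
      ext t
      simp only [ContinuousMap.smul_apply, ContinuousMap.mul_apply, smul_eq_mul,
        ContinuousMap.pow_apply]
      ring
    have e4 := hA.tsum_sub hB
    rw [sub_mul, one_mul, ← e1, ← e4]
    refine tsum_congr fun N => ?_
    rw [chainSum_succ_natCast h h1, Finset.sum_range_succ, ← chainSum_succ_natCast h h1]
    ext t
    simp only [ContinuousMap.smul_apply, ContinuousMap.sub_apply, smul_eq_mul]
    ring

theorem multilogSeries_eq_iter (h : ∀ i, ‖y i‖ ≤ r) (h1 : r < 1) (m : ℕ) :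
    multilogSeries m (fun i => y i) = iter (fun i => ker (∏ j ∈ Finset.Ico i m, y j)) m 1 := by
  rw [multilogSeries_eq_chainSum]
  rcases m with _ | m
  · rw [chainSum_zero]
    rfl
  · have h2 := iter_weight_succ_of h h1 (s := 1) (by simp)
      (iter_weight_of_norm_lt h h1 m (by simpa using (h m).trans_lt h1))
    simp only [weight, one_mul] at h2
    have hr : 0 ≤ r := (norm_nonneg _).trans (h 0)
    have hS : Summable fun N : ℕ => (y m ^ N / (N : ℂ) * chainSum m y N * 1 ^ N) • coordI ^ N :=
      summable_smul_coordI_pow (C := ∑' k : Fin m → ℕ, ∏ i, r ^ k i) hr h1 fun N => by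
        rw [one_pow, mul_one, norm_mul, mul_comm]
        gcongr
        · exact norm_chainSum_le h h1 _ _
        · exact norm_pow_div_natCast_le (h m) N
    rw [h2, ← ContinuousMap.evalCLM_apply ℂ (1 : unitInterval),
      (ContinuousMap.evalCLM ℂ (1 : unitInterval)).map_tsum hS, chainSum_succ_top h h1]
    refine tsum_congr fun N => ?_
    simp

end ChainSum

/-! ### Principal germs of F_ab as iterated integrals over the partial products -/

section Principal

/-- Extension of a tuple by zeros. -/
def extendZero {m : ℕ} (z : Fin m → ℂ) (j : ℕ) : ℂ := if h : j < m then z ⟨j, h⟩ else 0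

theorem analyticAt_extendZero {m : ℕ} (j : ℕ) (z : Fin m → ℂ) :
    AnalyticAt ℂ (fun z : Fin m → ℂ => extendZero z j) z := by
  by_cases h : j < m
  · simp only [extendZero, h, dif_pos]
    exact (ContinuousLinearMap.proj (R := ℂ) (φ := fun _ : Fin m => ℂ) ⟨j, h⟩).analyticAt z
  · simp only [extendZero, h]
    exact analyticAt_const

theorem norm_extendZero_le {m : ℕ} (z : Fin m → ℂ) (j : ℕ) : ‖extendZero z j‖ ≤ ‖z‖ := by
  rw [extendZero]
  split_ifs with h
  · exact norm_le_pi_norm z _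
  · simp

theorem extendZero_val {m : ℕ} (z : Fin m → ℂ) (i : Fin m) : extendZero z i = z i := by
  simp [extendZero]

/-- The multiple logarithm as an iterated integral along the unit interval. -/
def multilogIntegral (m : ℕ) (z : Fin m → ℂ) : ℂ :=
  iter (fun i => ker (∏ j ∈ Finset.Ico i m, extendZero z j)) m 1

theorem analyticAt_multilogIntegral {m : ℕ} {z : Fin m → ℂ}
    (h : ∀ i < m, Slit (∏ j ∈ Finset.Ico i m, extendZero z j)) :
    AnalyticAt ℂ (multilogIntegral m) z := by
  refine ((ContinuousMap.evalCLM ℂ (1 : unitInterval)).analyticAt _).comp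
    (f := fun z => iter (fun i => ker (∏ j ∈ Finset.Ico i m, extendZero z j)) m) ?_
  refine analyticAt_iter (κ := fun i z => ker (∏ j ∈ Finset.Ico i m, extendZero z j))
    fun i hi => ?_
  exact AnalyticAt.comp (g := ker) (f := fun z => ∏ j ∈ Finset.Ico i m, extendZero z j)
    (h i hi).analyticAt_ker (Finset.analyticAt_fun_prod _ fun j _ => analyticAt_extendZero j z)

theorem Slit.mul_unitInterval {w : ℂ} (h : Slit w) (t : unitInterval) :
    Slit (((t : ℝ) : ℂ) * w) := by
  intro u
  have := h (t * u)
  convert this using 2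
  push_cast
  ring

/-- On the ray t·y the i-th weight is multiplied by t^(m-i), which lies in [0, 1], so it never
reaches the slit. A single analytic function therefore serves on the whole ray, and near 0 it is the
power series. -/
theorem isPrincipalMultilog_multilogIntegral {m : ℕ} {y : Fin m → ℂ}
    (h : ∀ i < m, Slit (∏ j ∈ Finset.Ico i m, extendZero y j)) :
    IsPrincipalMultilog m y (multilogIntegral m) := by
  refine ⟨fun _ => multilogIntegral m, fun t => ?_, fun t => Eventually.of_forall fun s =>
    EventuallyEq.rfl, ?_, EventuallyEq.rfl⟩
  · refine analyticAt_multilogIntegral fun i hi => ?_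
    have h1 : ∏ j ∈ Finset.Ico i m, extendZero (((t : ℝ) : ℂ) • y) j =
        (((t ^ (m - i) : unitInterval) : ℝ) : ℂ) * ∏ j ∈ Finset.Ico i m, extendZero y j := by
      have h2 : ∀ j, extendZero (((t : ℝ) : ℂ) • y) j = ((t : ℝ) : ℂ) * extendZero y j := by
        intro j
        simp only [extendZero]
        split_ifs <;> simp
      simp only [h2, Finset.prod_mul_distrib, Finset.prod_const, Nat.card_Ico]
      push_cast
      rfl
    rw [h1]
    exact (h i hi).mul_unitInterval _
  · have h0 : (((0 : unitInterval) : ℝ) : ℂ) • y = 0 := by simp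
    simp only [h0]
    filter_upwards [Metric.ball_mem_nhds (0 : Fin m → ℂ) (show (0 : ℝ) < 1 / 2 by norm_num)] with z hz
    have hz' : ‖z‖ < 1 / 2 := by simpa using hz
    have := multilogSeries_eq_iter (y := extendZero z) (r := 1 / 2)
      (fun i => (norm_extendZero_le z i).trans hz'.le) (by norm_num) m
    simp only [extendZero_val] at this
    exact this.symm

variable {n : ℕ}

theorem block_mul_block (x : Fin n → ℂ) {a b c : ℕ} (hab : a ≤ b + 1) (hbc : b ≤ c) :
    block x a b * block x (b + 1) c = block x a c := by
  rw [block, block, block, ← Finset.prod_union]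
  · refine Finset.prod_congr ?_ fun _ _ => rfl
    ext i
    simp only [Finset.mem_union, Finset.mem_filter, Finset.mem_univ, true_and]
    omega
  · rw [Finset.disjoint_filter]
    intro i _ h
    omega

theorem block_of_lt (x : Fin n → ℂ) {a b : ℕ} (h : b < a) : block x a b = 1 := by
  rw [block, Finset.filter_false_of_mem, Finset.prod_empty]
  intro i _ h1
  omega

@[simp] theorem partialProd_zero (x : Fin n → ℂ) : partialProd x 0 = 1 := block_of_lt x one_pos

theorem partialProd_mul_block (x : Fin n → ℂ) {a b : ℕ} (h : a ≤ b) :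
    partialProd x a * block x (a + 1) b = partialProd x b :=
  block_mul_block x (by omega) h

theorem partialProd_succ (x : Fin n → ℂ) (k : ℕ) :
    partialProd x (k + 1) = partialProd x k * block x (k + 1) (k + 1) :=
  (partialProd_mul_block x k.le_succ).symm

theorem analyticAt_block (a b : ℕ) (x : Fin n → ℂ) :
    AnalyticAt ℂ (fun x : Fin n → ℂ => block x a b) x :=
  Finset.analyticAt_fun_prod _ fun i _ =>
    (ContinuousLinearMap.proj (R := ℂ) (φ := fun _ : Fin n => ℂ) i).analyticAt x

theorem analyticAt_partialProd (k : ℕ) (x : Fin n → ℂ) :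
    AnalyticAt ℂ (fun x : Fin n → ℂ => partialProd x k) x := analyticAt_block 1 k x

theorem partialProd_ne_zero {x : Fin n → ℂ} {k : ℕ}
    (h : ∀ j, 1 ≤ j → j ≤ k → block x j j ≠ 0) : partialProd x k ≠ 0 := by
  induction k with
  | zero => simp
  | succ k ih =>
    rw [partialProd_succ]
    exact mul_ne_zero (ih fun j h1 h2 => h j h1 (by omega)) (h _ (by omega) le_rfl)

theorem partialProd_ne_zero_of_mem {x : Fin n → ℂ} (hx : x ∈ regularSet n) {k : ℕ} (hk : k ≤ n) :
    partialProd x k ≠ 0 :=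
  partialProd_ne_zero fun j h1 h2 => hx (.zero j) ⟨h1, h2.trans hk⟩

theorem partialProd_ne_of_mem {x : Fin n → ℂ} (hx : x ∈ regularSet n) {a b : ℕ} (hab : a < b)
    (hb : b ≤ n) : partialProd x a ≠ partialProd x b := by
  intro h
  have h1 := partialProd_mul_block x hab.le
  have h2 := partialProd_ne_zero_of_mem hx (hab.le.trans hb)
  have h3 : (Component.one (a + 1) b).eqn x ≠ 0 := hx (.one (a + 1) b) ⟨by omega, hab, hb⟩
  apply h3
  simp only [Component.eqn]
  rw [← h] at h1
  rw [mul_right_eq_self₀.1 h1 |>.resolve_right h2, sub_self]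

/-- The iterated integral `F_ab` in terms of the partial products. -/
def intF (a b : ℕ) (z : Fin n → ℂ) : ℂ := polyInt (b - a) fun i => partialProd z (a - 1 + i)

/-- The products of ratios telescope, and multiplication of numerator and denominator by -v_{a-1}
turns them into ratios of differences of partial products. Unobstructed segments correspond exactly
to weights off the slit. -/
theorem isPrincipalF_intF {a b : ℕ} (ha : 1 ≤ a) (hab : a ≤ b) (hb : b ≤ n) {x : Fin n → ℂ}
    (hx : x ∈ regularSet n) (h : Unobstructed (b - a) fun i => partialProd x (a - 1 + i)) :
    IsPrincipalF a b x (intF a b) := by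
  have hden : ∀ z : Fin n → ℂ, (∀ c, a ≤ c → c < b → 1 - block z a c ≠ 0) → ∀ i < b - a,
      ∏ j ∈ Finset.Ico i (b - a), extendZero (ratioPoint a b z) j =
        (1 - block z a b) / (1 - block z a (a + i)) := by
    intro z hz i hi
    have h1 : ∀ j ∈ Finset.Ico i (b - a), extendZero (ratioPoint a b z) j =
        (1 - block z a (a + (j + 1))) / (1 - block z a (a + j)) := by
      intro j hj
      simp only [extendZero, (Finset.mem_Ico.1 hj).2, dif_pos, ratioPoint, add_assoc]
    rw [Finset.prod_congr rfl h1]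
    have h2 : ∀ k, i ≤ k → k ≤ b - a → ∏ j ∈ Finset.Ico i k,
        (1 - block z a (a + (j + 1))) / (1 - block z a (a + j)) =
        (1 - block z a (a + k)) / (1 - block z a (a + i)) := by
      intro k hk hk'
      induction k, hk using Nat.le_induction with
      | base => rw [Finset.Ico_self, Finset.prod_empty, div_self (hz _ (by omega) (by omega))]
      | succ k hk ih =>
        have h3 := hz (a + k) (by omega) (by omega)
        have h4 := hz (a + i) (by omega) (by omega)
        rw [Finset.prod_Ico_succ_top hk, ih (by omega)]
        field_simp
    rw [h2 _ hi.le le_rfl, show a + (b - a) = b by omega]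
  have hw : ∀ z : Fin n → ℂ, partialProd z (a - 1) ≠ 0 → ∀ i,
      (partialProd z (a - 1 + (b - a + 1)) - partialProd z (a - 1 + 0)) /
        (partialProd z (a - 1 + (i + 1)) - partialProd z (a - 1 + 0)) =
        (1 - block z a b) / (1 - block z a (a + i)) := by
    intro z hz i
    have h1 : ∀ c, a ≤ c → partialProd z c - partialProd z (a - 1) =
        -partialProd z (a - 1) * (1 - block z a c) := by
      intro c hc
      have h2 := partialProd_mul_block z (a := a - 1) (b := c) (by omega)
      rw [show a - 1 + 1 = a by omega] at h2
      rw [← h2]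
      ring
    rw [add_zero, show a - 1 + (b - a + 1) = b by omega, show a - 1 + (i + 1) = a + i by omega,
      h1 b hab, h1 (a + i) (by omega), mul_div_mul_left _ _ (neg_ne_zero.2 hz)]
  have hxc : ∀ c, a ≤ c → c < b → 1 - block x a c ≠ 0 := fun c h1 h2 =>
    hx (.one a c) ⟨ha, h1, by omega⟩
  have hx0 := partialProd_ne_zero_of_mem hx (k := a - 1) (by omega)
  refine ⟨multilogIntegral (b - a), isPrincipalMultilog_multilogIntegral fun i hi => ?_, ?_⟩
  · rw [hden x hxc i hi, ← hw x hx0 i]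
    exact slit_of_notMem_segment (h i hi)
  · have e1 : ∀ᶠ z in 𝓝 x, partialProd z (a - 1) ≠ 0 :=
      (analyticAt_partialProd (a - 1) x).continuousAt.eventually_ne hx0
    have e2 : ∀ᶠ z in 𝓝 x, ∀ c ∈ Finset.Ico a b, 1 - block z a c ≠ 0 :=
      (Finset.eventually_all _).2 fun c hc => (analyticAt_const.sub
        (analyticAt_block a c x)).continuousAt.eventually_ne
          (hxc c (Finset.mem_Ico.1 hc).1 (Finset.mem_Ico.1 hc).2)
    filter_upwards [e1, e2] with z h1 h2
    rw [intF, polyInt, multilogIntegral, iter_congr fun i hi => ?_]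
    rw [hden z (fun c hc hc' => h2 c (Finset.mem_Ico.2 ⟨hc, hc'⟩)) i hi, hw z h1 i]

end Principal

/-! ### Dependence on the end point alone -/

section OneVariable

/-- The sequence `v 0, …, v k, z`. -/
def withEnd (k : ℕ) (v : ℕ → ℂ) (z : ℂ) : ℕ → ℂ := fun i => if i ≤ k then v i else z

theorem withEnd_of_le {k i : ℕ} (h : i ≤ k) (v : ℕ → ℂ) (z : ℂ) : withEnd k v z i = v i := if_pos h

theorem withEnd_of_lt {k i : ℕ} (h : k < i) (v : ℕ → ℂ) (z : ℂ) : withEnd k v z i = z :=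
  if_neg (not_le.2 h)

theorem analyticAt_withEnd (k : ℕ) (v : ℕ → ℂ) (i : ℕ) (z : ℂ) :
    AnalyticAt ℂ (fun z => withEnd k v z i) z := by
  by_cases h : i ≤ k
  · simp only [withEnd_of_le h]
    exact analyticAt_const
  · simp only [withEnd_of_lt (not_le.1 h)]
    exact analyticAt_id

theorem unobstructed_withEnd {k : ℕ} {v : ℕ → ℂ} {z : ℂ}
    (h : ∀ i < k, v (i + 1) ∉ segment ℝ (v 0) z) : Unobstructed k (withEnd k v z) := by
  intro i hi
  rw [withEnd_of_le (show i + 1 ≤ k by omega), withEnd_of_le (Nat.zero_le k),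
    withEnd_of_lt (show k < k + 1 by omega)]
  exact h i hi

theorem analyticAt_polyInt_withEnd {k : ℕ} {v : ℕ → ℂ} {z : ℂ}
    (h : ∀ i < k, v (i + 1) ∉ segment ℝ (v 0) z) :
    AnalyticAt ℂ (fun z => polyInt k (withEnd k v z)) z :=
  analyticAt_polyInt (p := fun i z => withEnd k v z i) (fun i _ => analyticAt_withEnd k v i z)
    (unobstructed_withEnd h)

/-- When only the end moves, just the last logarithmic form of the total differential is nonzero,
and its coefficient omits the last singular point. -/
theorem hasDerivAt_polyInt_withEnd {m : ℕ} {v : ℕ → ℂ} {z : ℂ}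
    (h : ∀ i < m + 1, v (i + 1) ∉ segment ℝ (v 0) z)
    (hne : ∀ i ≤ m, v (i + 1) ≠ v i) (h0 : z ≠ v 0) :
    HasDerivAt (fun z => polyInt (m + 1) (withEnd (m + 1) v z))
      (polyInt m (withEnd m v z) / (v (m + 1) - z)) z := by
  have hz : z ≠ v (m + 1) := by
    rintro rfl
    exact h m (by omega) (right_mem_segment ℝ _ _)
  let p' : ℕ → ℂ →L[ℂ] ℂ := fun i => if i ≤ m + 1 then 0 else ContinuousLinearMap.id ℂ ℂ
  have hp' : ∀ i ≤ m + 1, p' i = 0 := fun i hi => if_pos hi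
  have hp'' : p' (m + 2) = ContinuousLinearMap.id ℂ ℂ := if_neg (by omega)
  have := hasFDerivAt_polyInt (p := fun i z => withEnd (m + 1) v z i) (p' := p') (e := z)
    (m := m + 1) (fun i hi => by
      by_cases h1 : i ≤ m + 1
      · simp only [withEnd_of_le h1, hp' i h1]
        exact hasFDerivAt_const _ _
      · obtain rfl : i = m + 2 := by omega
        simp only [withEnd_of_lt (show m + 1 < m + 2 by omega), hp'']
        exact hasFDerivAt_id z) (unobstructed_withEnd h) (fun i hi => by
      by_cases h1 : i ≤ m
      · simp only [withEnd_of_le (show i ≤ m + 1 by omega),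
          withEnd_of_le (show i + 1 ≤ m + 1 by omega)]
        exact hne i h1
      · obtain rfl : i = m + 1 := by omega
        simp only [withEnd_of_le le_rfl, withEnd_of_lt (show m + 1 < m + 1 + 1 by omega)]
        exact hz) (by
      simp only [withEnd_of_le (show 0 ≤ m + 1 by omega),
        withEnd_of_lt (show m + 1 < m + 1 + 1 by omega)]
      exact h0)
  have h2 := this.hasDerivAt
  refine h2.congr_deriv ?_
  rw [sum_apply, Finset.sum_range_succ, Finset.sum_eq_zero fun k hk => ?_]
  · simp only [zero_add, Nat.add_sub_cancel]
    have e1 : polyInt m (dropAt (m + 1) fun i => withEnd (m + 1) v z i) =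
        polyInt m (withEnd m v z) := by
      refine polyInt_congr fun i hi => ?_
      simp only [dropAt, withEnd]
      split_ifs <;> first | rfl | omega
    rw [e1]
    simp only [dlogForm, hp'', hp' m (by omega), hp' (m + 1) le_rfl, withEnd_of_le le_rfl,
      withEnd_of_lt (show m + 1 < m + 1 + 1 by omega), sub_zero, sub_self, smul_zero, zero_sub]
    simp only [smul_apply, neg_apply, ContinuousLinearMap.id_apply, smul_eq_mul, mul_one]
    rw [← neg_sub z, div_neg, div_eq_mul_inv]
    ring
  · have hk' := Finset.mem_range.1 hk
    simp only [dlogForm, hp' k (by omega), hp' (k + 1) (by omega), hp' (k + 1 + 1) (by omega)]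
    simp

theorem exists_deriv_eq_on_ball {φ : ℂ → ℂ} {x y : ℂ} {δ : ℝ}
    (hφ : AnalyticOnNhd ℂ φ (Metric.ball x δ)) (hy : y ∈ Metric.ball x δ) {h : ℂ → ℂ}
    (hh : ∀ᶠ z in 𝓝 y, HasDerivAt h (φ z) z) :
    ∃ k, k =ᶠ[𝓝 y] h ∧ AnalyticOnNhd ℂ k (Metric.ball x δ) := by
  obtain ⟨k, hk, hk'⟩ := exists_primitive_on_ball
    (ω := fun z => φ z • ContinuousLinearMap.id ℂ ℂ) (x := x) (δ := δ)
    (fun z hz => (hφ z hz).smul analyticAt_const) hy (h := h) (by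
      filter_upwards [hh] with z hz
      refine hz.hasFDerivAt.congr_fderiv ?_
      ext
      simp)
  refine ⟨k, hk, DifferentiableOn.analyticOnNhd (fun z hz =>
    (hk' z hz).differentiableAt.differentiableWithinAt) Metric.isOpen_ball⟩

/-- The difference quotient (A(z) - A(p))/(z - p) has a removable singularity; this is how simple
poles are split off below. -/
theorem analyticOnNhd_dslope {A : ℂ → ℂ} {p : ℂ} {δ : ℝ} (hδ : 0 < δ)
    (hA : AnalyticOnNhd ℂ A (Metric.ball p δ)) : AnalyticOnNhd ℂ (dslope A p) (Metric.ball p δ) :=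
  DifferentiableOn.analyticOnNhd ((Complex.differentiableOn_dslope
    (Metric.ball_mem_nhds p hδ)).2 hA.differentiableOn) Metric.isOpen_ball

/-- The logarithm of `z - p` along a circle around `p`. -/
theorem cont_log_circle {p s : ℂ} (h : s ≠ p) :
    Cont (fun t : ℝ => p + Complex.exp (2 * Real.pi * Complex.I * t) * (s - p)) 0 1
      (fun z => Complex.log ((z - p) / (s - p)))
      (fun z => Complex.log ((z - p) / (s - p)) + 2 * Real.pi * Complex.I) := by
  have h0 : s - p ≠ 0 := sub_ne_zero.2 h
  let e : ℝ → ℂ := fun t => Complex.exp (2 * Real.pi * Complex.I * t)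
  have he : ∀ t, e t ≠ 0 := fun t => Complex.exp_ne_zero _
  -- At time t the principal logarithm is taken relative to the current point of the circle, where
  -- its argument is 1, and the accumulated angle is added.
  refine ⟨fun t z => Complex.log ((z - p) / (s - p) / e t) + 2 * Real.pi * Complex.I * t,
    ⟨fun t _ => ?_, fun t _ => ?_⟩, Eventually.of_forall fun z => ?_,
    Eventually.of_forall fun z => ?_⟩
  · refine AnalyticAt.add (AnalyticAt.clog ?_ ?_) analyticAt_const
    · exact ((analyticAt_id.sub analyticAt_const).div analyticAt_const h0).div analyticAt_const
        (he t)
    · have : (p + e t * (s - p) - p) / (s - p) / e t = 1 := by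
        have := he t
        field_simp
        ring
      rw [this]
      exact Complex.one_mem_slitPlane
  -- A change of angle below a quarter turn and an argument below a quarter turn add up to less than
  -- π, so the principal branches match.
  · have h1 : ∀ᶠ u : ℝ in 𝓝 t, |2 * Real.pi * (u - t)| < Real.pi / 2 := by
      have : ContinuousAt (fun u : ℝ => |2 * Real.pi * (u - t)|) t := by fun_prop
      exact this.eventually_lt_const (by simp [Real.pi_pos])
    refine (h1.filter_mono nhdsWithin_le_nhds).mono fun u hu => ?_
    have hcont : ContinuousAt (fun z => ((z - p) / (s - p) / e t).re) (p + e u * (s - p)) := by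
      fun_prop
    have hval : (p + e u * (s - p) - p) / (s - p) / e t =
        Complex.exp ((2 * Real.pi * (u - t) : ℝ) * Complex.I) := by
      have : Complex.exp ((2 * Real.pi * (u - t) : ℝ) * Complex.I) = e u / e t := by
        simp only [e]
        rw [← Complex.exp_sub]
        congr 1
        push_cast
        ring
      rw [this]
      field_simp
      ring
    have hpos : 0 < ((p + e u * (s - p) - p) / (s - p) / e t).re := by
      rw [hval, Complex.exp_ofReal_mul_I_re]
      exact Real.cos_pos_of_mem_Ioo ⟨by linarith [(abs_lt.1 hu).1], (abs_lt.1 hu).2⟩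
    filter_upwards [hcont.eventually (lt_mem_nhds hpos)] with z hz
    set w := (z - p) / (s - p) / e t with hw
    have hw0 : w ≠ 0 := by
      rintro h0
      rw [h0] at hz
      simp at hz
    have e1 : (z - p) / (s - p) / e u =
        Complex.exp (Complex.log w - (2 * Real.pi * (u - t) : ℝ) * Complex.I) := by
      rw [Complex.exp_sub, Complex.exp_log hw0]
      have : Complex.exp ((2 * Real.pi * (u - t) : ℝ) * Complex.I) = e u / e t := by
        simp only [e]
        rw [← Complex.exp_sub]
        congr 1
        push_cast
        ring
      rw [this, hw]
      have h1 := he t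
      have h2 := he u
      field_simp
    have harg := abs_lt.1 (Complex.abs_arg_lt_pi_div_two_iff.2 (Or.inl hz))
    have hu' := abs_lt.1 hu
    rw [e1, Complex.log_exp]
    · push_cast
      ring
    · simp only [Complex.sub_im, Complex.log_im, Complex.mul_im, Complex.ofReal_re, Complex.I_im,
        Complex.ofReal_im, Complex.I_re]
      linarith [harg.1, hu'.2]
    · simp only [Complex.sub_im, Complex.log_im, Complex.mul_im, Complex.ofReal_re, Complex.I_im,
        Complex.ofReal_im, Complex.I_re]
      linarith [harg.2, hu'.1]
  · simp [e]
  · simp [e, Complex.exp_two_pi_mul_I]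

end OneVariable

/-! ### The logarithmic singularity at a singular point -/

section Circle

variable {v : ℕ → ℂ} {s : ℂ} {m : ℕ}

/-- Induction on the depth k by integrating the derivative I_k(z)/(v_{k+1} - z) of I_{k+1}. Nothing
singular happens for k + 1 < m; at k + 1 = m a simple pole creates the logarithm; afterwards its
coefficient satisfies the same differential equation as the integral from v_m to z. -/
theorem exists_log_decomposition {N : ℕ} (hm : 1 ≤ m) (hmN : m ≤ N) {R : ℝ}
    (hs : s ≠ v m) (hsR : dist s (v m) < R)
    (hR : ∀ i ≤ N, i ≠ m → R ≤ dist (v i) (v m))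
    (hT : ∀ i ≤ N, 1 ≤ i → i ≠ m → ∀ t : unitInterval,
      v i ∉ segment ℝ (v 0) (v m + ((t : ℝ) : ℂ) * (s - v m)))
    (hseg : v m ∉ segment ℝ (v 0) s) (hne : ∀ i < N, v (i + 1) ≠ v i) {k : ℕ} (hk : k ≤ N) :
    ∃ A, AnalyticOnNhd ℂ A (Metric.ball (v m) R) ∧
      ∀ᶠ z in 𝓝 s, polyInt k (withEnd k v z) = A z -
        if m ≤ k then polyInt (m - 1) v * Complex.log ((z - v m) / (s - v m)) *
          polyInt (k - m) (withEnd (k - m) (fun i => v (m + i)) z) else 0 := by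
  have hRpos : 0 < R := dist_nonneg.trans_lt hsR
  have hball : ∀ i ≤ N, i ≠ m → ∀ z ∈ Metric.ball (v m) R, v i - z ≠ 0 := by
    intro i hi him z hz h0
    rw [sub_eq_zero] at h0
    exact absurd (hR i hi him) (not_le.2 (h0 ▸ hz))
  have hsb : s ∈ Metric.ball (v m) R := hsR
  have hs0 : s ≠ v 0 := fun h => hball 0 (by omega) (by omega) s hsb (by rw [h, sub_self])
  have hvs : ∀ i < N, v (i + 1) ∉ segment ℝ (v 0) s := by
    intro i hi
    by_cases him : i + 1 = m
    · exact him ▸ hseg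
    · simpa using hT (i + 1) (by omega) (by omega) him 1
  -- derivatives of the iterated integrals near `s`
  have hder : ∀ k, k + 1 ≤ N → ∀ᶠ z in 𝓝 s, HasDerivAt
      (fun z => polyInt (k + 1) (withEnd (k + 1) v z)) (polyInt k (withEnd k v z) / (v (k + 1) - z))
      z := by
    intro k hk
    have h1 : ∀ᶠ z in 𝓝 s, ∀ i ∈ Finset.range (k + 1), v (i + 1) ∉ segment ℝ (v 0) z :=
      (Finset.eventually_all _).2 fun i hi => eventually_notMem_segment continuousAt_const
        continuousAt_id continuousAt_const (hvs i (by have := Finset.mem_range.1 hi; omega))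
    filter_upwards [h1, isOpen_ne.mem_nhds hs0] with z h1 h2
    exact hasDerivAt_polyInt_withEnd (fun i hi => h1 i (Finset.mem_range.2 hi))
      (fun i hi => hne i (by omega)) h2
  -- the coefficients near `v m`
  let g : ℕ → ℂ → ℂ := fun k z => polyInt (k - m) (withEnd (k - m) (fun i => v (m + i)) z)
  have hgseg : ∀ k ≤ N, ∀ z ∈ Metric.ball (v m) R, ∀ i < k - m,
      v (m + (i + 1)) ∉ segment ℝ (v (m + 0)) z := by
    intro k hk z hz i hi hmem
    have := (convex_ball (v m) R).segment_subset (Metric.mem_ball_self hRpos) hz hmem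
    exact hball _ (by omega) (by omega) _ this (sub_self _)
  have hg : ∀ k ≤ N, AnalyticOnNhd ℂ (g k) (Metric.ball (v m) R) := fun k hk z hz =>
    analyticAt_polyInt_withEnd (hgseg k hk z hz)
  have hgd : ∀ k, m ≤ k → k + 1 ≤ N → ∀ z ∈ Metric.ball (v m) R, z ≠ v m →
      HasDerivAt (g (k + 1)) (g k z / (v (k + 1) - z)) z := by
    intro k hmk hk z hz hzm
    have h1 := hasDerivAt_polyInt_withEnd (m := k - m) (v := fun i => v (m + i)) (z := z)
      (fun i hi => hgseg (k + 1) hk z hz i (by omega)) (fun i hi => hne (m + i) (by omega)) hzm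
    rw [show m + (k - m + 1) = k + 1 by omega, show k - m + 1 = k + 1 - m by omega] at h1
    exact h1
  have hgm : ∀ z, g m z = 1 := by simp [g]
  have hg0 : ∀ k, m ≤ k → g (k + 1) (v m) = 0 := by
    intro k hmk
    simp only [g]
    rw [show k + 1 - m = k - m + 1 by omega]
    refine polyInt_eq_zero ?_
    rw [withEnd_of_lt (by omega), withEnd_of_le (by omega), add_zero]
  set c := polyInt (m - 1) v with hc
  have hlog : ∀ᶠ z in 𝓝 s, HasDerivAt (fun z => Complex.log ((z - v m) / (s - v m)))
      (z - v m)⁻¹ z := by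
    have h0 : s - v m ≠ 0 := sub_ne_zero.2 hs
    have h1 : ContinuousAt (fun z => (z - v m) / (s - v m)) s := by fun_prop
    have h2 : ∀ᶠ z in 𝓝 s, (z - v m) / (s - v m) ∈ Complex.slitPlane := by
      refine h1.eventually (Complex.isOpen_slitPlane.mem_nhds ?_)
      simp only [div_self h0]
      exact Complex.one_mem_slitPlane
    filter_upwards [h2, isOpen_ne.mem_nhds hs] with z h3 h4
    have h5 : z - v m ≠ 0 := sub_ne_zero.2 h4
    refine ((((hasDerivAt_id z).sub_const (v m)).div_const (s - v m)).clog h3).congr_deriv ?_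
    simp only [id]
    field_simp
  have hnear : ∀ᶠ z in 𝓝 s, z ∈ Metric.ball (v m) R ∧ z ≠ v m :=
    Filter.Eventually.and (Metric.isOpen_ball.mem_nhds hsb) (isOpen_ne.mem_nhds hs)
  induction k with
  | zero =>
    refine ⟨fun _ => 1, fun _ _ => analyticAt_const, Eventually.of_forall fun z => ?_⟩
    rw [if_neg (by omega), polyInt_zero, sub_zero]
  | succ k ih =>
    obtain ⟨A, hA, hAz⟩ := ih (by omega)
    rcases lt_trichotomy (k + 1) m with hlt | heq | hgt
    · obtain ⟨B, hB, hB'⟩ := exists_deriv_eq_on_ball (φ := fun z => A z / (v (k + 1) - z))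
        (fun z hz => (hA z hz).div (analyticAt_const.sub analyticAt_id)
          (hball _ hk (by omega) z hz)) hsb
        (h := fun z => polyInt (k + 1) (withEnd (k + 1) v z)) (by
          filter_upwards [hder k hk, hAz] with z h1 h2
          rwa [h2, if_neg (by omega), sub_zero] at h1)
      refine ⟨B, hB', hB.mono fun z hz => ?_⟩
      simp only [hz, if_neg (show ¬ m ≤ k + 1 by omega), sub_zero]
    · subst heq
      -- The residue is the integral ending at v_m itself. By the triangle condition the integral is
      -- analytic all along the segment from s to v_m, so there it agrees with A.
      have hAc : A (v (k + 1)) = c := by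
        have hmem : ∀ t : unitInterval, v (k + 1) + ((t : ℝ) : ℂ) * (s - v (k + 1)) ∈
            Metric.ball (v (k + 1)) R := by
          intro t
          rw [Metric.mem_ball, dist_eq_norm, add_sub_cancel_left, norm_mul, Complex.norm_real,
            Real.norm_of_nonneg t.2.1, ← dist_eq_norm]
          exact (mul_le_of_le_one_left dist_nonneg t.2.2).trans_lt hsR
        have h1 : Set.EqOn (fun z => polyInt k (withEnd k v z)) A
            (segment ℝ (v (k + 1)) s) := by
          have hseg_im : ∀ z ∈ segment ℝ (v (k + 1)) s, ∃ t : unitInterval,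
              v (k + 1) + ((t : ℝ) : ℂ) * (s - v (k + 1)) = z := by
            intro z hz
            rw [segment_eq_image'] at hz
            obtain ⟨t, ht, rfl⟩ := hz
            exact ⟨⟨t, ht⟩, by simp⟩
          refine AnalyticOnNhd.eqOn_of_preconnected_of_eventuallyEq (𝕜 := ℂ) (z₀ := s) ?_ ?_
            (convex_segment _ _).isPreconnected (right_mem_segment ℝ _ _) ?_
          · intro z hz
            obtain ⟨t, rfl⟩ := hseg_im z hz
            exact analyticAt_polyInt_withEnd fun i hi =>
              hT (i + 1) (by omega) (by omega) (by omega) t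
          · intro z hz
            obtain ⟨t, rfl⟩ := hseg_im z hz
            exact hA _ (hmem t)
          · filter_upwards [hAz] with z hz
            rw [hz, if_neg (by omega), sub_zero]
        rw [← h1 (left_mem_segment ℝ _ _), hc, Nat.add_sub_cancel]
        refine polyInt_congr fun i hi => ?_
        by_cases h : i ≤ k
        · rw [withEnd_of_le h]
        · rw [withEnd_of_lt (not_le.1 h), show i = k + 1 by omega]
      -- Adding c times the logarithm cancels the pole of A(z)/(v_m - z), leaving a difference
      -- quotient of A.
      obtain ⟨B, hB, hB'⟩ := exists_deriv_eq_on_ball (φ := fun z => -dslope A (v (k + 1)) z)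
        (analyticOnNhd_dslope hRpos hA).neg hsb
        (h := fun z => polyInt (k + 1) (withEnd (k + 1) v z) +
          c * Complex.log ((z - v (k + 1)) / (s - v (k + 1)))) (by
          filter_upwards [hder k hk, hAz, hlog, hnear] with z h1 h2 h3 h4
          refine (h1.fun_add (h3.const_mul c)).congr_deriv ?_
          have h5 : z - v (k + 1) ≠ 0 := sub_ne_zero.2 h4.2
          have h6 : v (k + 1) - z ≠ 0 := sub_ne_zero.2 h4.2.symm
          rw [h2, if_neg (by omega), dslope_of_ne _ h4.2, slope_def_field, hAc]
          field_simp
          ring)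
      refine ⟨B, hB', hB.mono fun z hz => ?_⟩
      have := hgm z
      simp only [g] at this
      simp only [hz, le_refl, if_true, this]
      ring
    -- The product rule for c·log·g cancels all logarithms; the remaining term g_{k+1}(z)/(z - v_m)
    -- is regular because g_{k+1} vanishes at v_m.
    · obtain ⟨B, hB, hB'⟩ := exists_deriv_eq_on_ball
        (φ := fun z => A z / (v (k + 1) - z) + c * dslope (g (k + 1)) (v m) z)
        (fun z hz => ((hA z hz).div (analyticAt_const.sub analyticAt_id)
          (hball _ hk (by omega) z hz)).add (analyticAt_const.mul
            (analyticOnNhd_dslope hRpos (hg _ hk) z hz))) hsb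
        (h := fun z => polyInt (k + 1) (withEnd (k + 1) v z) +
          c * Complex.log ((z - v m) / (s - v m)) * g (k + 1) z) (by
          filter_upwards [hder k hk, hAz, hlog, hnear] with z h1 h2 h3 h4
          refine (h1.fun_add ((h3.const_mul c).fun_mul
            (hgd k (by omega) hk z h4.1 h4.2))).congr_deriv ?_
          have h5 : z - v m ≠ 0 := sub_ne_zero.2 h4.2
          have h6 : v (k + 1) - z ≠ 0 := hball _ hk (by omega) z h4.1
          rw [h2, if_pos (by omega), dslope_of_ne _ h4.2, slope_def_field, hg0 k (by omega)]
          simp only [g]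
          field_simp
          ring)
      refine ⟨B, hB', hB.mono fun z hz => ?_⟩
      simp only [g] at hz
      rw [if_pos (by omega), hz]
      ring

/-- Monodromy of an iterated integral when its end point circles around a singular point. -/
theorem cont_polyInt_withEnd_circle {N : ℕ} (hm : 1 ≤ m) (hmN : m ≤ N) (hs : s ≠ v m)
    (hR : ∀ i ≤ N, i ≠ m → dist s (v m) < dist (v i) (v m))
    (hT : ∀ i ≤ N, 1 ≤ i → i ≠ m → ∀ t : unitInterval,
      v i ∉ segment ℝ (v 0) (v m + ((t : ℝ) : ℂ) * (s - v m)))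
    (hseg : v m ∉ segment ℝ (v 0) s) (hne : ∀ i < N, v (i + 1) ≠ v i) :
    Cont (fun t : ℝ => v m + Complex.exp (2 * Real.pi * Complex.I * t) * (s - v m)) 0 1
      (fun z => polyInt N (withEnd N v z))
      (fun z => polyInt N (withEnd N v z) - 2 * Real.pi * Complex.I * (polyInt (m - 1) v *
          polyInt (N - m) (withEnd (N - m) (fun i => v (m + i)) z))) := by
  -- The radius of the ball is the distance from v_m to the nearest other point.
  obtain ⟨j, hj, hjmin⟩ := Finset.exists_min_image ((Finset.range (N + 1)).erase m)
    (fun i => dist (v i) (v m)) ⟨0, by simp; omega⟩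
  have hj' : j ≠ m ∧ j < N + 1 := by simpa using hj
  set R := dist (v j) (v m) with hRdef
  have hsR : dist s (v m) < R := hR j (by omega) hj'.1
  have hRpos : 0 < R := dist_nonneg.trans_lt hsR
  have hRi : ∀ i ≤ N, i ≠ m → R ≤ dist (v i) (v m) := fun i hi him =>
    hjmin i (by simp; omega)
  obtain ⟨A, hA, hAz⟩ := exists_log_decomposition hm hmN hs hsR hRi hT hseg hne le_rfl
  have hmem : ∀ t : ℝ, v m + Complex.exp (2 * Real.pi * Complex.I * t) * (s - v m) ∈
      Metric.ball (v m) R := by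
    intro t
    have h1 : ‖Complex.exp (2 * Real.pi * Complex.I * t)‖ = 1 := by
      rw [show 2 * Real.pi * Complex.I * t = ((2 * Real.pi * t : ℝ) : ℂ) * Complex.I by
        push_cast; ring]
      exact Complex.norm_exp_ofReal_mul_I _
    rw [Metric.mem_ball, dist_eq_norm, add_sub_cancel_left, norm_mul, h1, one_mul, ← dist_eq_norm]
    exact hsR
  let g : ℂ → ℂ := fun z => polyInt (N - m) (withEnd (N - m) (fun i => v (m + i)) z)
  have hg : AnalyticOnNhd ℂ g (Metric.ball (v m) R) := by
    intro z hz
    refine analyticAt_polyInt_withEnd fun i hi hmem => ?_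
    have := (convex_ball (v m) R).segment_subset (Metric.mem_ball_self hRpos) hz hmem
    exact absurd (hRi (m + (i + 1)) (by omega) (by omega)) (not_le.2 this)
  have h1 := (Cont.const (F := ℂ) (γ := fun t : ℝ => v m +
    Complex.exp (2 * Real.pi * Complex.I * t) * (s - v m)) (a := 0) (b := 1)
    fun t _ => hA _ (hmem t)).add
    (((cont_log_circle hs).mul (Cont.const fun t _ => hg _ (hmem t))).const_mul
      (-polyInt (m - 1) v))
  have e0 : ∀ t : ℝ, t = 0 ∨ t = 1 →
      v m + Complex.exp (2 * Real.pi * Complex.I * t) * (s - v m) = s := by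
    rintro t (rfl | rfl)
    · simp
    · simp [Complex.exp_two_pi_mul_I]
  refine h1.congr ?_ ?_
  · simp only [e0 0 (Or.inl rfl)]
    filter_upwards [hAz] with z hz
    rw [hz, if_pos hmN]
    simp only [g]
    ring
  · simp only [e0 1 (Or.inr rfl)]
    filter_upwards [hAz] with z hz
    rw [hz, if_pos hmN]
    simp only [g]
    ring

end Circle

/-! ### Configurations of points and the end point circling a singular point -/

section Configurations

variable {n : ℕ}

/-- The points of a configuration, numbered by natural numbers. -/
def pt (k : ℕ) (z : Fin (n + 1) → ℂ) : ℂ := z (Fin.ofNat (n + 1) k)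

theorem analyticAt_pt (k : ℕ) (z : Fin (n + 1) → ℂ) : AnalyticAt ℂ (pt k) z :=
  (ContinuousLinearMap.proj (R := ℂ) (φ := fun _ : Fin (n + 1) => ℂ)
    (Fin.ofNat (n + 1) k)).analyticAt z

theorem continuous_pt (k : ℕ) : Continuous (pt k : (Fin (n + 1) → ℂ) → ℂ) :=
  continuous_apply _

theorem dist_pt_le (k : ℕ) (z w : Fin (n + 1) → ℂ) : dist (pt k z) (pt k w) ≤ dist z w :=
  dist_le_pi_dist z w _

theorem pt_mk {k : ℕ} (hk : k < n + 1) (z : Fin (n + 1) → ℂ) : pt k z = z ⟨k, hk⟩ := by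
  rw [pt]
  congr 1
  ext
  exact Nat.mod_eq_of_lt hk

theorem pt_val (z : Fin (n + 1) → ℂ) (i : Fin (n + 1)) : pt i z = z i := pt_mk i.2 z

theorem pt_last (z : Fin (n + 1) → ℂ) : pt n z = z (Fin.last n) := pt_mk n.lt_succ_self z

theorem pt_update_last_of_lt {k : ℕ} (hk : k < n) (z : Fin (n + 1) → ℂ) (w : ℂ) :
    pt k (Function.update z (Fin.last n) w) = pt k z := by
  rw [pt_mk (by omega), pt_mk (by omega), Function.update_of_ne]
  exact (Fin.ne_of_lt hk)

theorem pt_update_last (z : Fin (n + 1) → ℂ) (w : ℂ) :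
    pt n (Function.update z (Fin.last n) w) = w := by
  rw [pt_last, Function.update_self]

theorem pt_ne {z : Fin (n + 1) → ℂ} (h : Function.Injective z) {i j : ℕ} (hij : i ≠ j)
    (hi : i ≤ n) (hj : j ≤ n) : pt i z ≠ pt j z := by
  rw [pt_mk (by omega), pt_mk (by omega)]
  exact fun h' => hij (congrArg Fin.val (h h'))

theorem injective_of_pt_ne {z : Fin (n + 1) → ℂ}
    (h : ∀ i j, i < j → j ≤ n → pt i z ≠ pt j z) : Function.Injective z := by
  intro i j hij
  rw [← pt_val z i, ← pt_val z j] at hij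
  rcases lt_trichotomy (i : ℕ) j with h1 | h1 | h1
  · exact absurd hij (h _ _ h1 (by omega))
  · exact Fin.ext h1
  · exact absurd hij.symm (h _ _ h1 (by omega))

/-- The iterated integral from the point with number `a` to the point with number `b`. -/
def confInt (a b : ℕ) (z : Fin (n + 1) → ℂ) : ℂ := polyInt (b - a - 1) fun i => pt (a + i) z

/-- The points between number `a` and number `b` do not lie on the segment of integration. -/
def Free (a b : ℕ) (z : Fin (n + 1) → ℂ) : Prop :=
  ∀ i, a < i → i < b → pt i z ∉ segment ℝ (pt a z) (pt b z)

theorem Free.unobstructed {a b : ℕ} {z : Fin (n + 1) → ℂ} (hab : a < b) (h : Free a b z) :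
    Unobstructed (b - a - 1) fun i => pt (a + i) z := by
  intro i hi
  simp only [add_zero]
  rw [show a + (b - a - 1 + 1) = b by omega]
  exact h _ (by omega) (by omega)

theorem Free.analyticAt {a b : ℕ} {z : Fin (n + 1) → ℂ} (hab : a < b) (h : Free a b z) :
    AnalyticAt ℂ (confInt a b) z :=
  analyticAt_polyInt (p := fun i z => pt (a + i) z) (fun _ _ => analyticAt_pt _ z)
    (h.unobstructed hab)

theorem exists_cont_confInt {a b : ℕ} (hab : a < b) (hb : b ≤ n) {γ : ℝ → Fin (n + 1) → ℂ}
    (hγ : Continuous γ) (hinj : ∀ t ∈ Set.Icc (0 : ℝ) 1, Function.Injective (γ t))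
    (h : Free a b (γ 0)) : ∃ g, Cont γ 0 1 (confInt a b) g :=
  exists_cont_polyInt (p := fun i z => pt (a + i) z) hγ zero_le_one
    (fun _ _ _ _ => analyticAt_pt _ _)
    (fun i j hij hj t ht => pt_ne (hinj t ht) (by omega) (by omega) (by omega))
    (h.unobstructed hab)

/-- The continuations demanded by `Cont.homotopy` exist because the points stay distinct and each
starting configuration is unobstructed. -/
theorem cont_confInt_homotopy {a b : ℕ} (hab : a < b) (hb : b ≤ n)
    {Φ : ℝ → ℝ → Fin (n + 1) → ℂ} (hΦ : Continuous (Function.uncurry Φ))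
    (hinj : ∀ s ∈ Set.Icc (0 : ℝ) 1, ∀ t ∈ Set.Icc (0 : ℝ) 1, Function.Injective (Φ s t))
    (hf : ∀ s ∈ Set.Icc (0 : ℝ) 1, Free a b (Φ s 0)) {g : (Fin (n + 1) → ℂ) → ℂ}
    (hg : ∀ s ∈ Set.Icc (0 : ℝ) 1, AnalyticAt ℂ g (Φ s 1))
    (h0 : Cont (Φ 0) 0 1 (confInt a b) g) : Cont (Φ 1) 0 1 (confInt a b) g :=
  Cont.homotopy hΦ hg (fun s hs => exists_cont_confInt hab hb
    (hΦ.comp (Continuous.prodMk_right s)) (hinj s hs) (hf s hs)) h0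

theorem eventually_forall_notMem_segment {X : Type*} [TopologicalSpace X] {a b c d : X → ℂ} {e : X}
    (ha : ContinuousAt a e) (hb : ContinuousAt b e) (hc : ContinuousAt c e) (hd : ContinuousAt d e)
    (h : ∀ t : unitInterval, d e ∉ segment ℝ (a e) (b e + ((t : ℝ) : ℂ) * (c e - b e))) :
    ∀ᶠ z in 𝓝 e, ∀ t : unitInterval, d z ∉ segment ℝ (a z) (b z + ((t : ℝ) : ℂ) * (c z - b z)) := by
  have := isCompact_univ.eventually_forall_of_forall_eventually (x₀ := e)
    (K := (Set.univ : Set unitInterval))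
    (P := fun z t => d z ∉ segment ℝ (a z) (b z + ((t : ℝ) : ℂ) * (c z - b z))) (fun t _ => by
      have hfst : Tendsto (Prod.fst : X × unitInterval → X) (𝓝 (e, t)) (𝓝 e) := continuousAt_fst
      have hc' : ContinuousAt (fun z : X × unitInterval =>
          b z.1 + ((z.2 : ℝ) : ℂ) * (c z.1 - b z.1)) (e, t) := by
        have hb' : ContinuousAt (fun z : X × unitInterval => b z.1) (e, t) := hb.comp_of_eq hfst rfl
        have hs' : ContinuousAt (fun z : X × unitInterval => c z.1) (e, t) := hc.comp_of_eq hfst rfl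
        have ht' : ContinuousAt (fun z : X × unitInterval => ((z.2 : ℝ) : ℂ)) (e, t) := by fun_prop
        exact hb'.add (ht'.mul (hs'.sub hb'))
      exact eventually_notMem_segment (ContinuousAt.comp_of_eq ha hfst rfl) hc'
        (ContinuousAt.comp_of_eq hd hfst rfl) (h t))
  filter_upwards [this] with z hz t using hz t trivial

theorem analyticAt_update_last (η : Fin (n + 1) → ℂ) (z : ℂ) :
    AnalyticAt ℂ (fun z => Function.update η (Fin.last n) z) z := by
  rw [analyticAt_pi_iff]
  intro i
  by_cases hi : i = Fin.last n
  · subst hi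
    simp only [Function.update_self]
    exact analyticAt_id
  · simp only [Function.update_of_ne hi]
    exact analyticAt_const

/-- Monodromy of `confInt 0 n` when its end point circles around the point with number `m`. -/
theorem cont_confInt_circle {m : ℕ} (hm : 1 ≤ m) (hmn : m < n) {ξ : Fin (n + 1) → ℂ}
    (hinj : Function.Injective ξ)
    (hR : ∀ i < n, i ≠ m → dist (pt n ξ) (pt m ξ) < dist (pt i ξ) (pt m ξ))
    (hT : ∀ i < n, 1 ≤ i → i ≠ m → ∀ t : unitInterval,
      pt i ξ ∉ segment ℝ (pt 0 ξ) (pt m ξ + ((t : ℝ) : ℂ) * (pt n ξ - pt m ξ)))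
    (hseg : pt m ξ ∉ segment ℝ (pt 0 ξ) (pt n ξ)) :
    Cont (fun t : ℝ => Function.update ξ (Fin.last n)
        (pt m ξ + Complex.exp (2 * Real.pi * Complex.I * t) * (pt n ξ - pt m ξ))) 0 1 (confInt 0 n)
      (fun z => confInt 0 n z - 2 * Real.pi * Complex.I * (confInt 0 m z * confInt m n z)) := by
  let lam : (Fin (n + 1) → ℂ) → ℝ → Fin (n + 1) → ℂ := fun η t => Function.update η (Fin.last n)
    (pt m η + Complex.exp (2 * Real.pi * Complex.I * t) * (pt n η - pt m η))
  have hnorm : ∀ t : ℝ, ‖Complex.exp (2 * Real.pi * Complex.I * t)‖ = 1 := by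
    intro t
    rw [show 2 * Real.pi * Complex.I * t = ((2 * Real.pi * t : ℝ) : ℂ) * Complex.I by
      push_cast; ring]
    exact Complex.norm_exp_ofReal_mul_I _
  have hlam : Continuous (lam ξ) := by
    refine continuous_pi fun i => ?_
    by_cases hi : i = Fin.last n
    · subst hi
      simp only [lam, Function.update_self]
      fun_prop
    · simp only [lam, Function.update_of_ne hi]
      fun_prop
  have hlam0 : lam ξ 0 = ξ := by
    simp [lam, pt_last]
  have hlam1 : lam ξ 1 = ξ := by
    simp [lam, pt_last, Complex.exp_two_pi_mul_I]
  have hne : pt n ξ ≠ pt m ξ := pt_ne hinj hmn.ne' le_rfl hmn.le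
  have hFree : Free 0 n ξ := by
    intro i h1 h2
    by_cases him : i = m
    · exact him ▸ hseg
    · simpa using hT i h2 h1 him 1
  -- The moved point depends on points m and n: one contribution comes from the centre and two from
  -- the rotated difference.
  have hdist : ∀ η t, dist (lam η t) (lam ξ t) ≤ 3 * dist η ξ := by
    intro η t
    refine (dist_pi_le_iff (by positivity)).2 fun i => ?_
    have hi0 := dist_le_pi_dist η ξ i
    by_cases hi : i = Fin.last n
    · subst hi
      simp only [lam, Function.update_self]
      have e1 := dist_pt_le m η ξ
      have e2 := dist_pt_le n η ξ
      rw [dist_eq_norm] at e1 e2 ⊢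
      calc _ = ‖(pt m η - pt m ξ) + Complex.exp (2 * Real.pi * Complex.I * t) *
            ((pt n η - pt n ξ) - (pt m η - pt m ξ))‖ := by congr 1; ring
        _ ≤ ‖pt m η - pt m ξ‖ + (‖pt n η - pt n ξ‖ + ‖pt m η - pt m ξ‖) := by
          refine (norm_add_le _ _).trans ?_
          rw [norm_mul, hnorm, one_mul]
          gcongr
          exact norm_sub_le _ _
        _ ≤ 3 * dist η ξ := by linarith
    · simp only [lam, Function.update_of_ne hi]
      linarith [dist_nonneg (x := η) (y := ξ)]
  obtain ⟨g, hg⟩ := exists_cont_confInt (n := n) (a := 0) (b := n) (by omega) le_rfl hlam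
    (fun t _ => injective_of_pt_ne fun i j hij hj => by
      simp only [lam]
      rw [pt_update_last_of_lt (by omega)]
      by_cases hjn : j = n
      · subst hjn
        rw [pt_update_last]
        intro h
        have h1 : dist (pt i ξ) (pt m ξ) = dist (pt j ξ) (pt m ξ) := by
          rw [h, dist_eq_norm, add_sub_cancel_left, norm_mul, hnorm, one_mul, dist_eq_norm]
        by_cases him : i = m
        · subst him
          rw [dist_self] at h1
          exact hne (dist_eq_zero.1 h1.symm)
        · exact absurd (hR i hij him) (not_lt.2 h1.le)
      · rw [pt_update_last_of_lt (by omega)]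
        exact pt_ne hinj hij.ne (by omega) hj) (hlam0.symm ▸ hFree)
  refine hg.congr EventuallyEq.rfl ?_
  obtain ⟨G, hG, hG0, hG1⟩ := hg
  obtain ⟨δ, hδ, K, hK, hKG, hKK⟩ := hG.normal_form isCompact_Icc hlam.continuousOn
  have hK0 := (hKG 0 (by simp)).trans hG0
  have hK1 := (hKG 1 (by simp)).trans hG1
  change g =ᶠ[𝓝 (lam ξ 1)] _
  change K 0 =ᶠ[𝓝 (lam ξ 0)] _ at hK0
  change K 1 =ᶠ[𝓝 (lam ξ 1)] _ at hK1
  rw [hlam1] at hK1 ⊢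
  rw [hlam0] at hK0
  have hcp : ∀ k, ContinuousAt (pt k) ξ := fun k => (continuous_pt k).continuousAt
  have ev1 : ∀ᶠ η in 𝓝 ξ, ∀ i ∈ Finset.range n, i ≠ m →
      dist (pt n η) (pt m η) < dist (pt i η) (pt m η) :=
    (Finset.eventually_all _).2 fun i hi => by
      by_cases him : i = m
      · exact Eventually.of_forall fun _ h => absurd him h
      · filter_upwards [((hcp n).dist (hcp m)).eventually_lt ((hcp i).dist (hcp m))
          (hR i (Finset.mem_range.1 hi) him)] with η h _ using h
  have ev2 : ∀ᶠ η in 𝓝 ξ, ∀ i ∈ Finset.range n, 1 ≤ i → i ≠ m → ∀ t : unitInterval,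
      pt i η ∉ segment ℝ (pt 0 η) (pt m η + ((t : ℝ) : ℂ) * (pt n η - pt m η)) :=
    (Finset.eventually_all _).2 fun i hi => by
      by_cases him : 1 ≤ i ∧ i ≠ m
      · filter_upwards [eventually_forall_notMem_segment (hcp 0) (hcp m) (hcp n) (hcp i)
          (hT i (Finset.mem_range.1 hi) him.1 him.2)] with η h _ _ using h
      · exact Eventually.of_forall fun _ h1 h2 => absurd ⟨h1, h2⟩ him
  have ev3 := eventually_notMem_segment (hcp 0) (hcp n) (hcp m) hseg
  have ev4 : ∀ᶠ η in 𝓝 ξ, ∀ i ∈ Finset.range n, pt (i + 1) η ≠ pt i η :=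
    (Finset.eventually_all _).2 fun i hi => by
      have hi' := Finset.mem_range.1 hi
      filter_upwards [((hcp (i + 1)).sub (hcp i)).eventually_ne (sub_ne_zero.2
        (pt_ne hinj i.succ_ne_self (by omega) (by omega)))] with η h using sub_ne_zero.1 h
  have ev5 : ∀ᶠ η in 𝓝 ξ, pt n η ≠ pt m η := by
    filter_upwards [((hcp n).sub (hcp m)).eventually_ne (sub_ne_zero.2 hne)] with η h
      using sub_ne_zero.1 h
  have ev6 : ∀ᶠ η in 𝓝 ξ, 3 * dist η ξ < δ := by
    have : ContinuousAt (fun η => 3 * dist η ξ) ξ := by fun_prop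
    exact this.eventually_lt_const (by simpa using hδ)
  filter_upwards [ev1, ev2, ev3, ev4, ev5, ev6, hK1, eventually_eventually_nhds.2 hK0]
    with η h1 h2 h3 h4 h5 h6 h7 h8
  -- For every configuration η near ξ, the continuation is restricted to the line where only the
  -- last point varies, and compared there with the one-variable result. Equality of the values at
  -- all such η is equality of germs at ξ.
  let ι : ℂ → Fin (n + 1) → ℂ := fun z => Function.update η (Fin.last n) z
  have hι : ι (pt n η) = η := by simp [ι, pt_last]
  let γ₁ : ℝ → ℂ := fun t => pt m η + Complex.exp (2 * Real.pi * Complex.I * t) *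
    (pt n η - pt m η)
  have hγ₁ : Continuous γ₁ := by fun_prop
  have hγ0 : γ₁ 0 = pt n η := by simp [γ₁]
  have hγ1 : γ₁ 1 = pt n η := by simp [γ₁, Complex.exp_two_pi_mul_I]
  have hlamη : Continuous (lam η) := by
    refine continuous_pi fun i => ?_
    by_cases hi : i = Fin.last n
    · subst hi
      simp only [lam, Function.update_self]
      fun_prop
    · simp only [lam, Function.update_of_ne hi]
      fun_prop
  have hfam : IsGermFamily (Set.Icc 0 1) (lam η) K := isGermFamily_of_dist_lt hK hKK
    hlamη.continuousOn fun t _ => (hdist η t).trans_lt h6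
  have hC : Cont γ₁ 0 1 (K 0 ∘ ι) (K 1 ∘ ι) :=
    Cont.pullback (γ := lam η) ⟨K, hfam, EventuallyEq.rfl, EventuallyEq.rfl⟩ zero_le_one
      (fun t _ => analyticAt_update_last η _) fun t _ => rfl
  have hD := cont_polyInt_withEnd_circle (N := n - 1) (v := fun i => pt i η) (s := pt n η)
    hm (by omega) h5 (fun i hi him => h1 i (Finset.mem_range.2 (by omega)) him)
    (fun i hi hi1 him => h2 i (Finset.mem_range.2 (by omega)) hi1 him) h3
    (fun i hi => h4 i (Finset.mem_range.2 (by omega)))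
  have hslice : ∀ z, confInt 0 n (ι z) = polyInt (n - 1) (withEnd (n - 1) (fun i => pt i η) z) := by
    intro z
    refine polyInt_congr fun i hi => ?_
    simp only [zero_add, ι]
    by_cases hin : i ≤ n - 1
    · rw [withEnd_of_le hin, pt_update_last_of_lt (by omega)]
    · rw [withEnd_of_lt (not_le.1 hin), show i = n by omega, pt_update_last]
  have hstart : (fun z => polyInt (n - 1) (withEnd (n - 1) (fun i => pt i η) z)) =ᶠ[𝓝 (γ₁ 0)]
      K 0 ∘ ι := by
    have : Tendsto ι (𝓝 (pt n η)) (𝓝 η) := by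
      have := (analyticAt_update_last η (pt n η)).continuousAt.tendsto
      rwa [show Function.update η (Fin.last n) (pt n η) = η from hι] at this
    rw [hγ0]
    filter_upwards [this.eventually h8] with z hz
    rw [Function.comp_apply, hz, hslice]
  have hU := Cont.unique hγ₁.continuousOn zero_le_one hC (hD.congr hstart EventuallyEq.rfl)
  rw [hγ1] at hU
  have hval := hU.self_of_nhds
  simp only [Function.comp_apply, hι, h7] at hval
  rw [hval, ← hslice, hι]
  congr 3
  · refine polyInt_congr fun i hi => ?_
    simp only [zero_add]
  · rw [confInt, show n - m - 1 = n - 1 - m by omega]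
    refine (polyInt_congr fun i hi => ?_).symm
    by_cases hin : i ≤ n - 1 - m
    · rw [withEnd_of_le hin]
    · rw [withEnd_of_lt (not_le.1 hin), show m + i = n by omega]

end Configurations

/-! ### The unit circle and continuous logarithms -/

section Lifts

/-- The point of the unit circle with argument `2πt`. -/
def circ (t : ℝ) : ℂ := Complex.exp (2 * Real.pi * Complex.I * t)

@[fun_prop] theorem continuous_circ : Continuous circ := by
  unfold circ
  fun_prop

@[simp] theorem circ_zero : circ 0 = 1 := by simp [circ]

@[simp] theorem circ_one : circ 1 = 1 := by simp [circ, Complex.exp_two_pi_mul_I]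

@[simp] theorem norm_circ (t : ℝ) : ‖circ t‖ = 1 := by
  rw [circ, show 2 * Real.pi * Complex.I * t = ((2 * Real.pi * t : ℝ) : ℂ) * Complex.I by
    push_cast; ring]
  exact Complex.norm_exp_ofReal_mul_I _

theorem circ_ne_zero (t : ℝ) : circ t ≠ 0 := Complex.exp_ne_zero _

/-- The exponential is a covering of the punctured plane, and a real normed space is contractible
and locally contractible, so the lift exists globally. -/
theorem exists_log_of_ne_zero {X : Type*} [NormedAddCommGroup X] [NormedSpace ℝ X] {H : X → ℂ}
    (hH : Continuous H) (h0 : ∀ x, H x ≠ 0) :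
    ∃ l : X → ℂ, Continuous l ∧ ∀ x, Complex.exp (l x) = H x := by
  obtain ⟨l, ⟨-, hl⟩, -⟩ := Complex.isCoveringMap_exp.existsUnique_continuousMap_lifts
    (⟨fun x => ⟨H x, h0 x⟩, hH.subtype_mk h0⟩ : C(X, {z : ℂ // z ≠ 0})) (0 : X)
    (Complex.log (H 0)) (Subtype.ext (Complex.exp_log (h0 0)))
  exact ⟨l, l.continuous, fun x => congrArg Subtype.val (congrFun hl x)⟩

/-- Two continuous logarithms of the same function differ by a constant, since the fibres of the
exponential are discrete. -/
theorem sub_eq_sub_of_exp_eq {A : Type*} [TopologicalSpace A] [PreconnectedSpace A] {l l' : A → ℂ}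
    (hl : Continuous l) (hl' : Continuous l') (h : ∀ a, Complex.exp (l a) = Complex.exp (l' a))
    (a b : A) : l a - l b = l' a - l' b := by
  have h1 : ∀ a, Complex.exp (l a - l' a) = 1 := fun a => by
    rw [Complex.exp_sub, h, div_self (Complex.exp_ne_zero _)]
  have := Complex.isCoveringMap_exp.const_of_comp (hl.sub hl')
    (fun a b => Subtype.ext ((h1 a).trans (h1 b).symm)) a b
  simp only [Pi.sub_apply] at this
  linear_combination this

end Lifts

/-! ### Monodromy where the end point and one singular point collide -/

section Collision

variable {n : ℕ}

/-- The triangle with vertices number `0`, `m`, `n` is nondegenerate enough and contains no other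
point of the configuration. -/
def TriangleFree (m : ℕ) (z : Fin (n + 1) → ℂ) : Prop :=
  pt m z ∉ segment ℝ (pt 0 z) (pt n z) ∧ ∀ i < n, 1 ≤ i → i ≠ m → ∀ t : unitInterval,
    pt i z ∉ segment ℝ (pt 0 z) (pt m z + ((t : ℝ) : ℂ) * (pt n z - pt m z))

theorem TriangleFree.free {m : ℕ} {z : Fin (n + 1) → ℂ} (h : TriangleFree m z) : Free 0 n z := by
  intro i h1 h2
  by_cases him : i = m
  · exact him ▸ h.1
  · simpa using h.2 i h2 h1 him 1

theorem TriangleFree.free_left {m : ℕ} (hmn : m < n) {z : Fin (n + 1) → ℂ} (h : TriangleFree m z) :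
    Free 0 m z := by
  intro i h1 h2
  simpa using h.2 i (by omega) h1 h2.ne 0

theorem TriangleFree.free_right {m : ℕ} (hm : 1 ≤ m) {z : Fin (n + 1) → ℂ}
    (h : TriangleFree m z) : Free m n z := by
  intro i h1 h2 h3
  rw [segment_eq_image'] at h3
  obtain ⟨t, ht, h3⟩ := h3
  refine h.2 i h2 (by omega) h1.ne' ⟨t, ht⟩ ?_
  rw [← h3]
  convert right_mem_segment ℝ _ _ using 2
  exact Complex.real_smul.symm

/-- The result of the continuation of `confInt 0 n` around the collision of `m` and `n`. -/
def loopGerm (m : ℕ) (z : Fin (n + 1) → ℂ) : ℂ :=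
  confInt 0 n z - 2 * Real.pi * Complex.I * (confInt 0 m z * confInt m n z)

theorem TriangleFree.analyticAt_loopGerm {m : ℕ} (hm : 1 ≤ m) (hmn : m < n) {z : Fin (n + 1) → ℂ}
    (h : TriangleFree m z) : AnalyticAt ℂ (loopGerm m) z :=
  (h.free.analyticAt (by omega)).sub (analyticAt_const.mul
    (((h.free_left hmn).analyticAt (by omega)).mul ((h.free_right hm).analyticAt hmn)))

/-- Monodromy of `confInt 0 n` around a divisor where the points `m` and `n` collide. -/
theorem cont_confInt_collision {m : ℕ} (hm : 1 ≤ m) (hmn : m < n) {ψ : ℂ → Fin (n + 1) → ℂ}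
    (hψ : Continuous ψ) (hinj : ∀ z, ‖z‖ ≤ 1 → z ≠ 0 → Function.Injective (ψ z))
    (h0 : ∀ i j, i < j → j ≤ n → ¬(i = m ∧ j = n) → pt i (ψ 0) ≠ pt j (ψ 0))
    (hmn0 : pt m (ψ 0) = pt n (ψ 0)) (hreg : ∀ r : ℝ, 0 < r → r ≤ 1 → TriangleFree m (ψ r))
    {l : ℝ → ℂ} (hl : Continuous l) (hlexp : ∀ t ∈ Set.Icc (0 : ℝ) 1,
      Complex.exp (l t) = pt m (ψ (circ t)) - pt n (ψ (circ t)))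
    (hl1 : l 1 - l 0 = 2 * Real.pi * Complex.I) :
    Cont (fun t => ψ (circ t)) 0 1 (confInt 0 n) (loopGerm m) := by
  have hcpt : ∀ k, Continuous (pt k : (Fin (n + 1) → ℂ) → ℂ) := continuous_pt
  -- a small radius
  obtain ⟨d, hd, hdij⟩ : ∃ d > 0, ∀ i j, i < j → j ≤ n → ¬(i = m ∧ j = n) →
      d ≤ dist (pt i (ψ 0)) (pt j (ψ 0)) := by
    let S : Finset (ℕ × ℕ) := ((Finset.range (n + 1)) ×ˢ (Finset.range (n + 1))).filter
      fun p => p.1 < p.2 ∧ ¬(p.1 = m ∧ p.2 = n)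
    have hS : S.Nonempty := ⟨(0, n), by simp [S]; omega⟩
    obtain ⟨q, hq, hqmin⟩ := S.exists_min_image (fun p => dist (pt p.1 (ψ 0)) (pt p.2 (ψ 0))) hS
    have hq' : (q.1 < n + 1 ∧ q.2 < n + 1) ∧ q.1 < q.2 ∧ (q.1 = m → q.2 ≠ n) := by
      simpa [S] using hq
    refine ⟨_, dist_pos.2 (h0 q.1 q.2 hq'.2.1 (by omega) fun h => hq'.2.2 h.1 h.2),
      fun i j hij hj hne => hqmin (i, j) ?_⟩
    simp only [S, Finset.mem_filter, Finset.mem_product, Finset.mem_range]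
    exact ⟨by omega, hij, hne⟩
  obtain ⟨δ, hδ, hδψ⟩ := Metric.continuous_iff.1 hψ 0 (d / 8) (by positivity)
  obtain ⟨ρ, hρ0, hρ1, hρδ⟩ : ∃ ρ : ℝ, 0 < ρ ∧ ρ ≤ 1 ∧ ρ < δ :=
    ⟨min 1 (δ / 2), by positivity, min_le_left _ _, (min_le_right _ _).trans_lt (by linarith)⟩
  have hnear : ∀ t k, ‖pt k (ψ (ρ * circ t)) - pt k (ψ 0)‖ < d / 8 := by
    intro t k
    rw [← dist_eq_norm]
    refine (dist_pt_le _ _ _).trans_lt (hδψ _ ?_)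
    rw [dist_zero_right, norm_mul, norm_circ, mul_one, Complex.norm_real,
      Real.norm_of_nonneg hρ0.le]
    exact hρδ
  -- the radius as a function of a parameter
  let rad : ℝ → ℝ := fun u => ρ + (Set.projIcc (0 : ℝ) 1 zero_le_one u : ℝ) * (1 - ρ)
  have hrad : Continuous rad :=
    continuous_const.add ((continuous_subtype_val.comp continuous_projIcc).mul continuous_const)
  have hrad0 : rad 0 = ρ := by simp [rad]
  have hrad1 : rad 1 = 1 := by simp [rad]
  have hradpos : ∀ u, 0 < rad u ∧ rad u ≤ 1 := by
    intro u
    have h1 := (Set.projIcc (0 : ℝ) 1 zero_le_one u).2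
    constructor
    · have := mul_nonneg h1.1 (sub_nonneg.2 hρ1)
      simp only [rad]
      linarith
    · have := mul_le_of_le_one_left (sub_nonneg.2 hρ1) h1.2
      simp only [rad]
      linarith
  have hz : ∀ u t, ‖(rad u : ℂ) * circ t‖ ≤ 1 ∧ (rad u : ℂ) * circ t ≠ 0 := by
    intro u t
    constructor
    · rw [norm_mul, norm_circ, mul_one, Complex.norm_real, Real.norm_of_nonneg (hradpos u).1.le]
      exact (hradpos u).2
    · exact mul_ne_zero (by exact_mod_cast (hradpos u).1.ne') (circ_ne_zero t)
  -- the logarithm of the difference of the colliding points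
  let D : ℝ × ℝ → ℂ := fun x => pt m (ψ ((rad x.1 : ℂ) * circ x.2)) -
    pt n (ψ ((rad x.1 : ℂ) * circ x.2))
  have hD : Continuous D := by
    have : Continuous fun x : ℝ × ℝ => (rad x.1 : ℂ) * circ x.2 := by fun_prop
    exact ((hcpt m).comp (hψ.comp this)).sub ((hcpt n).comp (hψ.comp this))
  obtain ⟨L, hL, hLexp⟩ := exists_log_of_ne_zero hD fun x =>
    sub_ne_zero.2 (pt_ne (hinj _ (hz x.1 x.2).1 (hz x.1 x.2).2) hmn.ne hmn.le le_rfl)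
  -- On the outer circle L and l are logarithms of the same function, so the increments agree. The
  -- logarithms at t = 0 and t = 1 have equal exponentials for every radius, so the increment does
  -- not depend on the radius.
  have hL1 : ∀ u, L (u, 1) - L (u, 0) = 2 * Real.pi * Complex.I := by
    have e1 := sub_eq_sub_of_exp_eq (A := unitInterval) (l := fun t => L (1, (t : ℝ)))
      (l' := fun t => l t) (by fun_prop) (by fun_prop) (fun t => by
        rw [hLexp, hlexp t t.2]
        simp [D, hrad1]) 1 0
    simp only [Set.Icc.coe_one, Set.Icc.coe_zero] at e1
    intro u
    have e2 := sub_eq_sub_of_exp_eq (A := ℝ) (l := fun u => L (u, 1)) (l' := fun u => L (u, 0))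
      (by fun_prop) (by fun_prop) (fun u => by simp [hLexp, D]) u 1
    linear_combination e2 + e1 + hl1
  set ξ := ψ ρ with hξ
  have hξreg : TriangleFree m ξ := hreg ρ hρ0 hρ1
  have hξinj : Function.Injective ξ := by
    have := hinj ((rad 0 : ℂ) * circ 0) (hz 0 0).1 (hz 0 0).2
    simpa [hrad0] using this
  have hξnear : ∀ k, ‖pt k ξ - pt k (ψ 0)‖ < d / 8 := by
    intro k
    simpa using hnear 0 k
  have hξD : ‖pt n ξ - pt m ξ‖ < d / 4 := by
    rw [show pt n ξ - pt m ξ = (pt n ξ - pt n (ψ 0)) - (pt m ξ - pt m (ψ 0)) by rw [hmn0]; ring]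
    exact (norm_sub_le _ _).trans_lt (by linarith [hξnear n, hξnear m])
  -- At the small radius points m and n are less than d/4 apart, and all other points are more than
  -- 3d/4 away from point m.
  have step1 := cont_confInt_circle hm hmn hξinj (fun i hi him => by
    rw [dist_eq_norm]
    refine hξD.trans ?_
    have h1 : d ≤ dist (pt i (ψ 0)) (pt m (ψ 0)) := by
      rcases lt_or_gt_of_ne him with h | h
      · exact hdij i m h hmn.le (by omega)
      · rw [dist_comm]
        exact hdij m i h hi.le (by omega)
    have h2 := dist_triangle4 (pt i (ψ 0)) (pt i ξ) (pt m ξ) (pt m (ψ 0))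
    have h3 := hξnear i
    have h4 := hξnear m
    rw [← dist_eq_norm] at h3 h4
    rw [dist_comm] at h3
    linarith) hξreg.2 hξreg.1
  -- straightening the small loop
  let P : ℕ → ℝ → ℝ → ℂ := fun k s t => (1 - s) * pt k ξ + s * pt k (ψ (ρ * circ t))
  -- The difference of the colliding points is interpolated through its logarithm, so it never
  -- vanishes: at s = 0 it traces a round circle, at s = 1 the given loop. As both logarithms
  -- increase by 2πi, the ends stay fixed.
  let Q : ℝ → ℝ → ℂ := fun s t =>
    P m s t - Complex.exp ((1 - s) * (L (0, 0) + 2 * Real.pi * Complex.I * t) + s * L (0, t))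
  let Φ : ℝ → ℝ → Fin (n + 1) → ℂ := fun s t =>
    Function.update (fun i => P i s t) (Fin.last n) (Q s t)
  have hPc : ∀ k, Continuous fun x : ℝ × ℝ => P k x.1 x.2 := by
    intro k
    have : Continuous fun x : ℝ × ℝ => pt k (ψ (ρ * circ x.2)) :=
      (hcpt k).comp (hψ.comp (by fun_prop))
    fun_prop
  have hQc : Continuous fun x : ℝ × ℝ => Q x.1 x.2 := by
    have h1 := hPc m
    fun_prop
  have hΦ : Continuous (Function.uncurry Φ) := by
    refine continuous_pi fun i => ?_
    by_cases hi : i = Fin.last n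
    · subst hi
      simpa only [Function.uncurry_def, Φ, Function.update_self] using hQc
    · simpa only [Function.uncurry_def, Φ, Function.update_of_ne hi] using hPc i
  have hΦpt : ∀ k < n, ∀ s t, pt k (Φ s t) = P k s t := by
    intro k hk s t
    rw [pt_update_last_of_lt hk, pt_mk (by omega)]
  have hΦn : ∀ s t, pt n (Φ s t) = Q s t := fun s t => pt_update_last _ _
  have hL0 : Complex.exp (L (0, 0)) = pt m ξ - pt n ξ := by
    rw [hLexp]
    simp [D, hrad0, ξ]
  have hstart : ∀ s, Φ s 0 = ξ := by
    intro s
    have hP0 : ∀ k, P k s 0 = pt k ξ := fun k => by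
      simp only [P, circ_zero, mul_one]
      ring
    funext i
    rw [← pt_val (Φ s 0), ← pt_val ξ]
    by_cases hi : (i : ℕ) = n
    · rw [hi, hΦn]
      simp only [Q, hP0]
      rw [show (1 - (s : ℂ)) * (L (0, 0) + 2 * Real.pi * Complex.I * ((0 : ℝ) : ℂ)) + s * L (0, 0) =
        L (0, 0) by push_cast; ring, hL0]
      ring
    · rw [hΦpt _ (by omega), hP0]
  have hend : ∀ s, Φ s 1 = ξ := by
    intro s
    have hP0 : ∀ k, P k s 1 = pt k ξ := fun k => by
      simp only [P, circ_one, mul_one]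
      ring
    funext i
    rw [← pt_val (Φ s 1), ← pt_val ξ]
    by_cases hi : (i : ℕ) = n
    · rw [hi, hΦn]
      simp only [Q, hP0]
      rw [show (1 - (s : ℂ)) * (L (0, 0) + 2 * Real.pi * Complex.I * ((1 : ℝ) : ℂ)) + s * L (0, 1) =
        L (0, 0) + 2 * Real.pi * Complex.I by
          push_cast
          linear_combination (s : ℂ) * hL1 0, Complex.exp_add, Complex.exp_two_pi_mul_I, hL0]
      ring
    · rw [hΦpt _ (by omega), hP0]
  have hPnear : ∀ k, ∀ s ∈ Set.Icc (0 : ℝ) 1, ∀ t, ‖P k s t - pt k (ψ 0)‖ < d / 8 := by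
    intro k s hs t
    have := (convex_ball (pt k (ψ 0)) (d / 8)) (mem_ball_iff_norm.2 (hξnear k))
      (mem_ball_iff_norm.2 (hnear t k)) (sub_nonneg.2 hs.2) hs.1 (by ring)
    rw [mem_ball_iff_norm] at this
    simpa only [P, Complex.real_smul, Complex.ofReal_sub, Complex.ofReal_one] using this
  have hDnear : ∀ s ∈ Set.Icc (0 : ℝ) 1, ∀ t, ‖Q s t - P m s t‖ < d / 4 := by
    intro s hs t
    have e1 : ‖Complex.exp (L (0, 0) + 2 * Real.pi * Complex.I * t)‖ < d / 4 := by
      have := norm_circ t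
      rw [circ] at this
      rw [Complex.exp_add, norm_mul, this, mul_one, hL0, norm_sub_rev]
      exact hξD
    have e2 : ‖Complex.exp (L (0, t))‖ < d / 4 := by
      rw [hLexp]
      simp only [D, hrad0]
      rw [show pt m (ψ (ρ * circ t)) - pt n (ψ (ρ * circ t)) = (pt m (ψ (ρ * circ t)) - pt m (ψ 0))
        - (pt n (ψ (ρ * circ t)) - pt n (ψ 0)) by rw [hmn0]; ring]
      exact (norm_sub_le _ _).trans_lt (by linarith [hnear t n, hnear t m])
    rw [Complex.norm_exp, ← Real.lt_log_iff_exp_lt (by positivity)] at e1 e2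
    have e3 := (convex_Iio (Real.log (d / 4))) e1 e2 (sub_nonneg.2 hs.2) hs.1 (by ring)
    simp only [Q, sub_sub_cancel_left, norm_neg]
    rw [Complex.norm_exp, ← Real.lt_log_iff_exp_lt (by positivity), Complex.add_re,
      show (1 - (s : ℂ)) = ((1 - s : ℝ) : ℂ) by push_cast; rfl, Complex.re_ofReal_mul,
      Complex.re_ofReal_mul]
    exact e3
  have hsep : ∀ i j, i < j → j ≤ n → ¬(i = m ∧ j = n) → ∀ z w : ℂ, ‖z - pt i (ψ 0)‖ < d / 2 →
      ‖w - pt j (ψ 0)‖ < d / 2 → z ≠ w := by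
    rintro i j hij hj hne z w hz hw rfl
    have h1 := hdij i j hij hj hne
    have h2 := dist_triangle (pt i (ψ 0)) z (pt j (ψ 0))
    rw [← dist_eq_norm] at hz hw
    rw [dist_comm] at hz
    linarith
  have hΦinj : ∀ s ∈ Set.Icc (0 : ℝ) 1, ∀ t ∈ Set.Icc (0 : ℝ) 1, Function.Injective (Φ s t) := by
    intro s hs t _
    refine injective_of_pt_ne fun i j hij hj => ?_
    rw [hΦpt i (by omega)]
    by_cases hjn : j = n
    · subst hjn
      rw [hΦn]
      by_cases him : i = m
      · subst him
        simp only [Q]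
        intro h
        exact Complex.exp_ne_zero _ (by linear_combination h)
      · refine hsep i j hij le_rfl (by omega) _ _ ((hPnear i s hs t).trans (by linarith)) ?_
        rw [← hmn0, show Q s t - pt m (ψ 0) = (Q s t - P m s t) + (P m s t - pt m (ψ 0)) by ring]
        exact (norm_add_le _ _).trans_lt (by linarith [hDnear s hs t, hPnear m s hs t])
    · rw [hΦpt j (by omega)]
      exact hsep i j hij hj (by omega) _ _ ((hPnear i s hs t).trans (by linarith))
        ((hPnear j s hs t).trans (by linarith))
  have step2 : Cont (Φ 1) 0 1 (confInt 0 n) (loopGerm m) := by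
    refine cont_confInt_homotopy (by omega) le_rfl hΦ hΦinj (fun s _ => ?_) (fun s _ => ?_) ?_
    · rw [hstart]
      exact hξreg.free
    · rw [hend]
      exact hξreg.analyticAt_loopGerm hm hmn
    · refine Cont.congr_path step1 zero_le_one fun t _ => ?_
      funext i
      have hP0 : ∀ k, P k 0 t = pt k ξ := fun k => by simp [P]
      rw [← pt_val (Φ 0 t)]
      by_cases hi : i = Fin.last n
      · subst hi
        rw [Function.update_self, Fin.val_last, hΦn]
        simp only [Q, hP0]
        rw [show (1 - ((0 : ℝ) : ℂ)) * (L (0, 0) + 2 * Real.pi * Complex.I * t) +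
          ((0 : ℝ) : ℂ) * L (0, t) = L (0, 0) + 2 * Real.pi * Complex.I * t by push_cast; ring,
          Complex.exp_add, hL0]
        ring
      · have hi' : (i : ℕ) < n := by
          have := i.2
          have h2 : (i : ℕ) ≠ n := fun h => hi (Fin.ext h)
          omega
        rw [Function.update_of_ne hi, hΦpt _ hi', hP0, pt_val]
  -- the radial homotopy
  have hend2 : ∀ s, ψ ((rad s : ℂ) * circ 1) = ψ (rad s : ℝ) := fun s => by simp
  have hstart2 : ∀ s, ψ ((rad s : ℂ) * circ 0) = ψ (rad s : ℝ) := fun s => by simp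
  have step3 := cont_confInt_homotopy (a := 0) (b := n) (Φ := fun s t => ψ ((rad s : ℂ) * circ t))
    (g := loopGerm m) (by omega) le_rfl (hψ.comp (by fun_prop))
    (fun s _ t _ => hinj _ (hz s t).1 (hz s t).2)
    (fun s _ => by
      rw [hstart2]
      exact (hreg _ (hradpos s).1 (hradpos s).2).free)
    (fun s _ => by
      rw [hend2]
      exact (hreg _ (hradpos s).1 (hradpos s).2).analyticAt_loopGerm hm hmn)
    (by
      refine step2.congr_path zero_le_one fun t _ => ?_
      funext i
      rw [← pt_val (Φ 1 t), ← pt_val (ψ _)]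
      have hP1 : ∀ k, P k 1 t = pt k (ψ (ρ * circ t)) := fun k => by simp [P]
      simp only [hrad0]
      by_cases hi : (i : ℕ) = n
      · rw [hi, hΦn]
        simp only [Q, hP1]
        rw [show (1 - ((1 : ℝ) : ℂ)) * (L (0, 0) + 2 * Real.pi * Complex.I * t) +
          ((1 : ℝ) : ℂ) * L (0, t) = L (0, t) by push_cast; ring, hLexp]
        simp [D, hrad0]
      · rw [hΦpt _ (by omega), hP1])
  simpa [hrad1] using step3

end Collision

/-! ### The divisors x_{m+1}⋯x_n = 1 and x_1⋯x_m = 1 -/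

section Divisors

variable {n : ℕ}

/-- The configuration of the partial products. -/
def prodConf (x : Fin n → ℂ) : Fin (n + 1) → ℂ := fun i => partialProd x i

/-- The configuration of the partial products in reverse order. -/
def revConf (x : Fin n → ℂ) : Fin (n + 1) → ℂ := fun i => partialProd x (n - i)

theorem pt_prodConf {k : ℕ} (hk : k ≤ n) (x : Fin n → ℂ) : pt k (prodConf x) = partialProd x k :=
  pt_mk (by omega) _

theorem pt_revConf {k : ℕ} (hk : k ≤ n) (x : Fin n → ℂ) :
    pt k (revConf x) = partialProd x (n - k) :=
  pt_mk (by omega) _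

theorem analyticAt_prodConf (x : Fin n → ℂ) : AnalyticAt ℂ prodConf x :=
  analyticAt_pi_iff.2 fun i => analyticAt_partialProd i x

theorem analyticAt_revConf (x : Fin n → ℂ) : AnalyticAt ℂ revConf x :=
  analyticAt_pi_iff.2 fun i => analyticAt_partialProd (n - i) x

theorem continuous_prodConf : Continuous (prodConf : (Fin n → ℂ) → _) :=
  continuous_iff_continuousAt.2 fun x => (analyticAt_prodConf x).continuousAt

theorem continuous_revConf : Continuous (revConf : (Fin n → ℂ) → _) :=
  continuous_iff_continuousAt.2 fun x => (analyticAt_revConf x).continuousAt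

theorem confInt_prodConf {a b : ℕ} (hab : a < b) (hb : b ≤ n) (x : Fin n → ℂ) :
    confInt a b (prodConf x) = intF (a + 1) b x := by
  rw [confInt, intF, show b - (a + 1) = b - a - 1 by omega]
  refine polyInt_congr fun i hi => ?_
  rw [pt_prodConf (by omega), Nat.add_sub_cancel]

theorem partialProd_ne_of_eqn {x : Fin n → ℂ} {a b : ℕ} (hab : a < b)
    (h0 : partialProd x b ≠ 0)
    (h : (Component.one (a + 1) b).eqn x ≠ 0) : partialProd x a ≠ partialProd x b := by
  intro h'
  apply h
  have h1 := partialProd_mul_block x hab.le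
  rw [h'] at h1
  simp only [Component.eqn]
  rw [mul_right_eq_self₀.1 h1 |>.resolve_right h0, sub_self]

theorem eqn_one {x : Fin n → ℂ} {a b : ℕ} (hab : a < b) :
    partialProd x a * (Component.one (a + 1) b).eqn x = partialProd x a - partialProd x b := by
  rw [← partialProd_mul_block x hab.le, Component.eqn]
  ring

theorem free_prodConf_iff {a b : ℕ} (hb : b ≤ n) {x : Fin n → ℂ} :
    Free a b (prodConf x) ↔ ∀ i, a < i → i < b →
      partialProd x i ∉ segment ℝ (partialProd x a) (partialProd x b) := by
  refine forall_congr' fun i => imp_congr_right fun h1 => imp_congr_right fun h2 => ?_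
  rw [pt_prodConf (by omega), pt_prodConf (by omega), pt_prodConf (by omega)]

theorem isPrincipalF_of_free {a b : ℕ} (hab : a < b) (hb : b ≤ n) {x : Fin n → ℂ}
    (hx : x ∈ regularSet n) (h : Free a b (prodConf x)) : IsPrincipalF (a + 1) b x (intF (a + 1) b) := by
  refine isPrincipalF_intF (by omega) hab hb hx fun i hi => ?_
  simp only [Nat.succ_eq_add_one, Nat.add_sub_cancel, add_zero,
    show a + (b - (a + 1) + 1) = b by omega]
  exact (free_prodConf_iff hb).1 h _ (by omega) (by omega)

theorem Free.eventually {a b : ℕ} {z : Fin (n + 1) → ℂ} (h : Free a b z) :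
    ∀ᶠ w in 𝓝 z, Free a b w := by
  have : ∀ᶠ w in 𝓝 z, ∀ i ∈ Finset.Ioo a b, pt i w ∉ segment ℝ (pt a w) (pt b w) :=
    (Finset.eventually_all _).2 fun i hi => eventually_notMem_segment
      (continuous_pt a).continuousAt (continuous_pt b).continuousAt (continuous_pt i).continuousAt
      (h i (Finset.mem_Ioo.1 hi).1 (Finset.mem_Ioo.1 hi).2)
  filter_upwards [this] with w hw i h1 h2 using hw i (Finset.mem_Ioo.2 ⟨h1, h2⟩)

theorem eventually_injective {z : Fin (n + 1) → ℂ} (h : Function.Injective z) :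
    ∀ᶠ w in 𝓝 z, Function.Injective w := by
  have : ∀ᶠ w in 𝓝 z, ∀ i j, i ≠ j → w i ≠ w j := by
    refine eventually_all.2 fun i => eventually_all.2 fun j => ?_
    by_cases hij : i = j
    · exact Eventually.of_forall fun _ h' => absurd hij h'
    · filter_upwards [((continuous_apply i).sub (continuous_apply j)).continuousAt.eventually_ne
        (sub_ne_zero.2 (h.ne hij))] with w hw _ using sub_ne_zero.1 hw
  filter_upwards [this] with w hw i j hij
  by_contra h'
  exact hw i j h' hij

/-- Reversal of the order of integration. -/
theorem confInt_revConf {a b : ℕ} (hab : a < b) (hb : b ≤ n) {x : Fin n → ℂ}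
    (hx : Function.Injective (prodConf x)) (h : Free a b (prodConf x)) :
    confInt (n - b) (n - a) (revConf x) = (-1) ^ (b - a - 1) * intF (a + 1) b x := by
  have h1 := polyInt_reverse (h.unobstructed hab) fun i j hij hj =>
    pt_ne hx (by omega) (by omega) (by omega)
  rw [← confInt_prodConf hab hb, confInt, confInt, h1, ← mul_assoc, ← mul_pow, neg_one_mul,
    neg_neg, one_pow, one_mul, show n - a - (n - b) - 1 = b - a - 1 by omega]
  refine polyInt_congr fun i hi => ?_
  rw [pt_revConf (by omega), pt_prodConf (by omega)]
  congr 1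
  omega

/-- The retraction of the plane to the closed unit disc. -/
def retract (z : ℂ) : ℂ := ((max 1 ‖z‖ : ℝ) : ℂ)⁻¹ * z

theorem retract_of_le {z : ℂ} (h : ‖z‖ ≤ 1) : retract z = z := by
  simp [retract, max_eq_left h]

theorem max_one_norm_pos (z : ℂ) : 0 < max 1 ‖z‖ := zero_lt_one.trans_le (le_max_left _ _)

theorem norm_retract_le (z : ℂ) : ‖retract z‖ ≤ 1 := by
  rw [retract, norm_mul, norm_inv, Complex.norm_real, Real.norm_of_nonneg (max_one_norm_pos z).le,
    inv_mul_le_iff₀ (max_one_norm_pos z), mul_one]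
  exact le_max_right _ _

theorem continuous_retract : Continuous retract := by
  unfold retract
  refine Continuous.mul (Continuous.inv₀ (by fun_prop) fun z => ?_) continuous_id
  exact_mod_cast (max_one_norm_pos z).ne'

/-- The data of a loop which turns once around a component, with all maps extended to the whole
plane or line. -/
theorem TurnsOnceAround.exists_extension {D : Component} {A : Set (Fin n → ℂ)} {x : Fin n → ℂ}
    {q : Path x x} (h : TurnsOnceAround D A q) :
    ∃ (φ : ℂ → Fin n → ℂ) (l : ℝ → ℂ), Continuous φ ∧ Continuous l ∧
      (∀ z, ‖z‖ ≤ 1 → z ≠ 0 → φ z ∈ regularSet n) ∧ D.eqn (φ 0) = 0 ∧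
      (∀ z, ∃ w, ‖w‖ ≤ 1 ∧ φ z = φ w) ∧
      (∀ D' : Component, D'.Valid n → D' ≠ D → D'.eqn (φ 0) ≠ 0) ∧
      (∀ r : ℝ, 0 < r → r ≤ 1 → φ (r : ℂ) ∈ A) ∧ (∀ t, q t = φ (circ t)) ∧
      (∀ t ∈ Set.Icc (0 : ℝ) 1, Complex.exp (l t) = D.eqn (φ (circ t))) ∧
      l 1 - l 0 = 2 * Real.pi * Complex.I := by
  obtain ⟨⟨φ, h1, h2, h3, h4, h5, h6⟩, l, hl, hl1, hl2⟩ := h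
  have hφ : ∀ z, ‖z‖ ≤ 1 → φ (retract z) = φ z := fun z hz => by rw [retract_of_le hz]
  have hq : ∀ t, q t = φ (retract (circ t)) := fun t => by
    rw [hφ _ (norm_circ _).le]
    exact h6 t
  refine ⟨fun z => φ (retract z), fun t => l (Set.projIcc 0 1 zero_le_one t),
    h1.comp_continuous continuous_retract fun z => by
      simpa using norm_retract_le z, hl.comp continuous_projIcc, fun z hz hz0 => ?_, ?_, fun z => ?_,
    ?_, fun r hr hr1 => ?_, hq, fun t ht => ?_, ?_⟩
  · simp only [hφ z hz]
    exact h2 z (by simpa using hz) hz0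
  · simpa only [hφ 0 (by simp)] using h3
  · exact ⟨retract z, norm_retract_le z, by simp only [retract_of_le (norm_retract_le z)]⟩
  · simpa only [hφ 0 (by simp)] using h4
  · simp only [hφ r (by rw [Complex.norm_real, Real.norm_of_nonneg hr.le]; exact hr1)]
    exact h5 r hr hr1
  · rw [hl1, Set.projIcc_of_mem _ ht, hq]
  · simpa using hl2

/-- The triangle contains the segments from one vertex to the points of the opposite side; this
connects the triangle condition with the segments of integration. -/
theorem triangle_subset {a b c : ℂ} {t : unitInterval} :
    segment ℝ a (b + ((t : ℝ) : ℂ) * (c - b)) ⊆ convexHull ℝ {a, b, c} := by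
  refine (convex_convexHull ℝ _).segment_subset (subset_convexHull ℝ _ (by simp)) ?_
  refine (convex_convexHull ℝ _).segment_subset (x := b) (y := c) (subset_convexHull ℝ _ (by simp))
    (subset_convexHull ℝ _ (by simp)) ?_
  rw [segment_eq_image']
  exact ⟨t, t.2, by simp⟩

theorem triangleFree_prodConf {m : ℕ} (hmn : m < n) {x : Fin n → ℂ}
    (h : x ∈ triangleRegion n m) : TriangleFree m (prodConf x) := by
  refine ⟨?_, fun i hi h1 him t hmem => ?_⟩
  · rw [pt_prodConf hmn.le, pt_prodConf (Nat.zero_le n), pt_prodConf (le_refl n)]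
    exact h.1
  · rw [pt_prodConf hmn.le, pt_prodConf (Nat.zero_le n), pt_prodConf (le_refl n),
      pt_prodConf hi.le] at hmem
    exact h.2 i h1 hi him (triangle_subset hmem)

theorem triangleFree_revConf {m : ℕ} (hm : 1 ≤ m) (hmn : m < n) {x : Fin n → ℂ}
    (h : x ∈ triangleRegion n m) : TriangleFree (n - m) (revConf x) := by
  refine ⟨?_, fun i hi h1 him t hmem => ?_⟩
  · rw [pt_revConf (Nat.sub_le n m), pt_revConf (Nat.zero_le n), pt_revConf (le_refl n),
      segment_symm]
    simp only [Nat.sub_zero, Nat.sub_self, show n - (n - m) = m by omega]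
    exact h.1
  · rw [pt_revConf (Nat.sub_le n m), pt_revConf (Nat.zero_le n), pt_revConf (le_refl n),
      pt_revConf hi.le] at hmem
    simp only [Nat.sub_zero, Nat.sub_self, show n - (n - m) = m by omega] at hmem
    refine h.2 (n - i) (by omega) (by omega) (by omega) ?_
    have := triangle_subset hmem
    rwa [show ({partialProd x n, partialProd x m, partialProd x 0} : Set ℂ) =
      {partialProd x 0, partialProd x m, partialProd x n} by ext; simp; tauto] at this

theorem injective_prodConf {x : Fin n → ℂ} (hx : x ∈ regularSet n) :
    Function.Injective (prodConf x) :=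
  injective_of_pt_ne fun i j hij hj => by
    rw [pt_prodConf (by omega), pt_prodConf hj]
    exact partialProd_ne_of_mem hx hij hj

theorem injective_revConf {x : Fin n → ℂ} (hx : x ∈ regularSet n) :
    Function.Injective (revConf x) :=
  injective_of_pt_ne fun i j hij hj => by
    rw [pt_revConf (by omega), pt_revConf hj]
    exact (partialProd_ne_of_mem hx (by omega) (by omega)).symm

/-- Continuation along a loop which turns once around `x_{m+1} ⋯ x_n = 1`. -/
theorem cont_around_one_right {m : ℕ} (hm : 1 ≤ m) (hmn : m < n) {x : Fin n → ℂ} {q : Path x x}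
    (h : TurnsOnceAround (Component.one (m + 1) n) (triangleRegion n m) q) :
    Cont (fun t : ℝ => q (Set.projIcc 0 1 zero_le_one t)) 0 1 (intF 1 n) (fun z =>
      intF 1 n z - 2 * Real.pi * Complex.I * (intF 1 m z * intF (m + 1) n z)) := by
  obtain ⟨φ, l, hφ, hl, hreg, h0, hw, hD, hA, hq, hlexp, hl1⟩ := h.exists_extension
  have hv0 : ∀ z, ‖z‖ ≤ 1 → ∀ k ≤ n, partialProd (φ z) k ≠ 0 := by
    intro z hz k hk
    by_cases hz0 : z = 0
    · subst hz0
      exact partialProd_ne_zero fun j h1 h2 => hD (.zero j) ⟨h1, h2.trans hk⟩ (by simp)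
    · exact partialProd_ne_zero_of_mem (hreg z hz hz0) hk
  have hcv : ∀ k, Continuous fun z => partialProd (φ z) k := fun k =>
    (continuous_iff_continuousAt.2 fun x => (analyticAt_partialProd k x).continuousAt).comp hφ
  -- The difference v_m - v_n is v_m times the equation of the component. The factor v_m has a
  -- logarithm on the whole disc, so it contributes nothing to the winding.
  obtain ⟨L, hL, hLexp⟩ := exists_log_of_ne_zero (hcv m) fun z => by
    obtain ⟨w, hw1, hw2⟩ := hw z
    rw [hw2]
    exact hv0 w hw1 m hmn.le
  have hC := cont_confInt_collision hm hmn (ψ := fun z => prodConf (φ z))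
    (continuous_prodConf.comp hφ) (fun z hz hz0 => injective_prodConf (hreg z hz hz0))
    (fun i j hij hj hne => by
      rw [pt_prodConf (by omega), pt_prodConf hj]
      refine partialProd_ne_of_eqn hij (hv0 0 (by simp) j hj)
        (hD _ ⟨by omega, hij, hj⟩ fun h => hne ?_)
      simpa using h)
    (by
      rw [pt_prodConf hmn.le, pt_prodConf le_rfl, ← sub_eq_zero, ← eqn_one hmn, h0, mul_zero])
    (fun r hr hr1 => triangleFree_prodConf hmn (hA r hr hr1))
    (l := fun t => L (circ t) + l t) ((hL.comp continuous_circ).add hl)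
    (fun t ht => by
      rw [Complex.exp_add, hLexp, hlexp t ht, pt_prodConf hmn.le, pt_prodConf le_rfl, eqn_one hmn])
    (by
      simp only [circ_one, circ_zero]
      linear_combination hl1)
  have hC' := hC.pullback (γ' := fun t : ℝ => q (Set.projIcc 0 1 zero_le_one t)) zero_le_one
    (fun t _ => analyticAt_prodConf _) fun t ht => by rw [hq, Set.projIcc_of_mem _ ht]
  refine hC'.congr (Eventually.of_forall fun z => ?_) (Eventually.of_forall fun z => ?_)
  · exact confInt_prodConf (by omega) le_rfl z
  · simp only [Function.comp_apply, loopGerm]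
    rw [confInt_prodConf (by omega) le_rfl, confInt_prodConf (by omega) hmn.le,
      confInt_prodConf hmn le_rfl]

theorem neg_one_pow_mul_self (k : ℕ) : ((-1 : ℂ) ^ k) * (-1) ^ k = 1 := by
  rw [← mul_pow]
  norm_num

/-- Continuation along a loop which turns once around `x_1 ⋯ x_m = 1`. -/
theorem cont_around_one_left {m : ℕ} (hm : 1 ≤ m) (hmn : m < n) {x : Fin n → ℂ} {q : Path x x}
    (h : TurnsOnceAround (Component.one 1 m) (triangleRegion n m) q) :
    Cont (fun t : ℝ => q (Set.projIcc 0 1 zero_le_one t)) 0 1 (intF 1 n) (fun z =>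
      intF 1 n z + 2 * Real.pi * Complex.I * (intF 1 m z * intF (m + 1) n z)) := by
  obtain ⟨φ, l, hφ, hl, hreg, h0, hw, hD, hA, hq, hlexp, hl1⟩ := h.exists_extension
  have hv0 : ∀ k ≤ n, partialProd (φ 0) k ≠ 0 := fun k hk =>
    partialProd_ne_zero fun j h1 h2 => hD (.zero j) ⟨h1, h2.trans hk⟩ (by simp)
  have heq : ∀ z : Fin n → ℂ, (Component.one 1 m).eqn z = partialProd z 0 - partialProd z m := by
    intro z
    rw [← eqn_one (by omega), partialProd_zero, one_mul]
  have hC := cont_confInt_collision (m := n - m) (by omega) (by omega)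
    (ψ := fun z => revConf (φ z))
    (continuous_revConf.comp hφ) (fun z hz hz0 => injective_revConf (hreg z hz hz0))
    (fun i j hij hj hne => by
      rw [pt_revConf (by omega), pt_revConf hj]
      refine (partialProd_ne_of_eqn (by omega) (hv0 _ (by omega))
        (hD _ ⟨by omega, by omega, by omega⟩ fun h => hne ?_)).symm
      simp only [Component.one.injEq] at h
      omega)
    (by
      rw [pt_revConf (by omega), pt_revConf le_rfl, ← sub_eq_zero, Nat.sub_self,
        show n - (n - m) = m by omega, ← neg_sub, ← heq, h0, neg_zero])
    (fun r hr hr1 => triangleFree_revConf hm hmn (hA r hr hr1))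
    -- The reversed order gives v_m - v_0, the negative of the equation; the constant πi accounts
    -- for the sign without affecting the winding.
    (l := fun t => Real.pi * Complex.I + l t) (continuous_const.add hl)
    (fun t ht => by
      rw [Complex.exp_add, hlexp t ht, Complex.exp_pi_mul_I, pt_revConf (by omega),
        pt_revConf le_rfl, Nat.sub_self, show n - (n - m) = m by omega, heq]
      ring)
    (by linear_combination hl1)
  have hC' := hC.pullback (γ' := fun t : ℝ => q (Set.projIcc 0 1 zero_le_one t)) zero_le_one
    (fun t _ => analyticAt_revConf _) fun t ht => by rw [hq, Set.projIcc_of_mem _ ht]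
  have hx : x = φ 1 := by
    have := hq 0
    simpa using this
  have hxr : x ∈ regularSet n := hx ▸ hreg 1 (by simp) one_ne_zero
  have hxA : x ∈ triangleRegion n m := by
    have := hA 1 one_pos le_rfl
    rwa [Complex.ofReal_one, ← hx] at this
  have hT := triangleFree_prodConf hmn hxA
  have hev : ∀ᶠ z in 𝓝 x, Function.Injective (prodConf z) ∧ Free 0 n (prodConf z) ∧
      Free 0 m (prodConf z) ∧ Free m n (prodConf z) := by
    have hc := (continuous_prodConf (n := n)).continuousAt (x := x)
    filter_upwards [hc.eventually (eventually_injective (injective_prodConf hxr)),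
      hc.eventually hT.free.eventually, hc.eventually (hT.free_left hmn).eventually,
      hc.eventually (hT.free_right hm).eventually] with z h1 h2 h3 h4 using ⟨h1, h2, h3, h4⟩
  -- The result for the reversed configuration is translated back near x, where all three integrals
  -- involved are unobstructed and can be reversed.
  have e := (hC'.const_mul ((-1) ^ (n - 1))).congr (f' := intF 1 n) (g' := fun z =>
      intF 1 n z + 2 * Real.pi * Complex.I * (intF 1 m z * intF (m + 1) n z)) ?_ ?_
  · exact e
  · rw [show q (Set.projIcc 0 1 zero_le_one 0) = x by simp]
    filter_upwards [hev] with z hz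
    have h1 := confInt_revConf (n := n) (a := 0) (b := n) (by omega) le_rfl hz.1 hz.2.1
    simp only [Nat.sub_zero, Nat.sub_self] at h1
    simp only [Function.comp_apply]
    rw [h1, ← mul_assoc, neg_one_pow_mul_self, one_mul]
  · rw [show q (Set.projIcc 0 1 zero_le_one 1) = x by simp]
    filter_upwards [hev] with z hz
    have h1 := confInt_revConf (n := n) (a := 0) (b := n) (by omega) le_rfl hz.1 hz.2.1
    have h2 := confInt_revConf (n := n) (a := 0) (b := m) (by omega) hmn.le hz.1 hz.2.2.1
    have h3 := confInt_revConf (n := n) (a := m) (b := n) (by omega) le_rfl hz.1 hz.2.2.2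
    simp only [Nat.sub_zero, Nat.sub_self, zero_add] at h1 h2 h3
    simp only [Function.comp_apply, loopGerm]
    rw [h1, h2, h3]
    have h4 := neg_one_pow_mul_self (n - 1)
    -- The two factors together have depth one less than the full integral. This odd difference
    -- changes the sign of the monodromy.
    have h5 : ((-1 : ℂ) ^ (n - 1)) * ((-1) ^ (m - 1) * (-1) ^ (n - m - 1)) = -1 := by
      rw [← pow_add, ← pow_add]
      have : n - 1 + (m - 1 + (n - m - 1)) = 2 * (n - 2) + 1 := by omega
      rw [this, pow_succ, pow_mul]
      norm_num
    linear_combination (intF 1 n z) * h4 - 2 * Real.pi * Complex.I *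
      (intF 1 m z * intF (m + 1) n z) * h5

end Divisors

/-! ### A singular point rotating around the end point -/

section Rotation

variable {n : ℕ}

theorem conf_ext {z w : Fin (n + 1) → ℂ} (h : ∀ k ≤ n, pt k z = pt k w) : z = w := by
  funext i
  rw [← pt_val z i, ← pt_val w i]
  exact h _ (by omega)

/-- Replace the point with number `j`. -/
def put (j : ℕ) (w : ℂ) (z : Fin (n + 1) → ℂ) : Fin (n + 1) → ℂ :=
  Function.update z (Fin.ofNat (n + 1) j) w

theorem pt_put_self (j : ℕ) (w : ℂ) (z : Fin (n + 1) → ℂ) : pt j (put j w z) = w :=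
  Function.update_self ..

theorem pt_put_of_ne {i j : ℕ} (hi : i ≤ n) (hj : j ≤ n) (h : i ≠ j) (w : ℂ)
    (z : Fin (n + 1) → ℂ) : pt i (put j w z) = pt i z := by
  refine Function.update_of_ne (fun h' => h ?_) _ _
  have := congrArg Fin.val h'
  simpa [Fin.ofNat, Nat.mod_eq_of_lt (show i < n + 1 by omega),
    Nat.mod_eq_of_lt (show j < n + 1 by omega)] using this

theorem continuous_put {X : Type*} [TopologicalSpace X] {f : X → ℂ} {g : X → Fin (n + 1) → ℂ}
    (j : ℕ) (hf : Continuous f) (hg : Continuous g) : Continuous fun x => put j (f x) (g x) :=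
  hg.update _ hf

theorem put_self (j : ℕ) (z : Fin (n + 1) → ℂ) : put j (pt j z) z = z :=
  Function.update_eq_self ..

theorem put_put (j : ℕ) (w w' : ℂ) (z : Fin (n + 1) → ℂ) : put j w (put j w' z) = put j w z :=
  Function.update_idem ..

/-- The point `m` rotates around the point `n`, which is the origin. -/
theorem cont_confInt_put_circle {m : ℕ} (hm : 1 ≤ m) (hmn : m < n) {ξ : Fin (n + 1) → ℂ}
    (hinj : Function.Injective ξ) (hn : pt n ξ = 0)
    (hR : ∀ i < n, i ≠ m → 4 * ‖pt m ξ‖ < ‖pt i ξ‖) (hT : TriangleFree m ξ) :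
    Cont (fun t => put m (circ t * pt m ξ) ξ) 0 1 (confInt 0 n) (loopGerm m) := by
  set a := pt m ξ with ha
  have ha0 : a ≠ 0 := fun h => pt_ne hinj hmn.ne hmn.le le_rfl (by rw [hn, ← ha, h])
  have hapos : 0 < ‖a‖ := norm_pos_iff.2 ha0
  have h1 := cont_confInt_circle hm hmn hinj (fun i hi him => by
    have h1 := hR i hi him
    have h2 := norm_sub_norm_le (pt i ξ) a
    rw [hn, dist_zero_left, dist_eq_norm]
    linarith) hT.2 hT.1
  -- The displacement is shifted gradually from point n to point m. Their difference is `circ t * a`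
  -- throughout, so at s = 0 point n circles point m and at s = 1 point m circles point n.
  let Φ : ℝ → ℝ → Fin (n + 1) → ℂ := fun s t =>
    put n ((1 - s) * (a - circ t * a)) (put m (a - s * (a - circ t * a)) ξ)
  have hΦn : ∀ s t, pt n (Φ s t) = (1 - s) * (a - circ t * a) := fun s t => pt_put_self ..
  have hΦm : ∀ s t, pt m (Φ s t) = a - s * (a - circ t * a) := fun s t => by
    rw [pt_put_of_ne hmn.le le_rfl hmn.ne, pt_put_self]
  have hΦi : ∀ i < n, i ≠ m → ∀ s t, pt i (Φ s t) = pt i ξ := fun i hi him s t => by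
    rw [pt_put_of_ne hi.le le_rfl hi.ne, pt_put_of_ne hi.le hmn.le him]
  have hΦ1 : ∀ s t, circ t = 1 → Φ s t = ξ := by
    intro s t ht
    refine conf_ext fun k hk => ?_
    by_cases hkn : k = n
    · subst hkn
      rw [hΦn, ht, hn]
      ring
    · by_cases hkm : k = m
      · subst hkm
        rw [hΦm, ht]
        ring
      · rw [hΦi k (by omega) hkm]
  have h2 := cont_confInt_homotopy (a := 0) (b := n) (Φ := Φ) (g := loopGerm m) (by omega) le_rfl
    (continuous_put n (by fun_prop) (continuous_put m (by fun_prop) continuous_const))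
    (fun s hs t _ => injective_of_pt_ne fun i k hik hk => by
      have hsn : ‖(s : ℂ)‖ ≤ 1 := by
        rw [Complex.norm_real, Real.norm_of_nonneg hs.1]
        exact hs.2
      have hsn' : ‖1 - (s : ℂ)‖ ≤ 1 := by
        rw [← Complex.ofReal_one, ← Complex.ofReal_sub, Complex.norm_real,
          Real.norm_of_nonneg (sub_nonneg.2 hs.2)]
        linarith [hs.1]
      have hd : ‖a - circ t * a‖ ≤ 2 * ‖a‖ := by
        refine (norm_sub_le _ _).trans ?_
        rw [norm_mul, norm_circ, one_mul]
        linarith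
      have hnb : ‖pt n (Φ s t)‖ ≤ 2 * ‖a‖ := by
        rw [hΦn, norm_mul]
        exact (mul_le_of_le_one_left (norm_nonneg _) hsn').trans hd
      have hmb : ‖pt m (Φ s t)‖ ≤ 3 * ‖a‖ := by
        rw [hΦm]
        refine (norm_sub_le _ _).trans ?_
        rw [norm_mul]
        linarith [(mul_le_of_le_one_left (norm_nonneg (a - circ t * a)) hsn).trans hd]
      have key : ∀ i < n, i ≠ m → pt i (Φ s t) ≠ pt n (Φ s t) ∧ pt i (Φ s t) ≠ pt m (Φ s t) := by
        intro i hi him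
        have h3 := hR i hi him
        rw [hΦi i hi him]
        exact ⟨fun h => by rw [h] at h3; linarith, fun h => by rw [h] at h3; linarith⟩
      have hmne : pt m (Φ s t) ≠ pt n (Φ s t) := by
        rw [hΦm, hΦn]
        intro h
        exact mul_ne_zero (circ_ne_zero t) ha0 (by linear_combination h)
      by_cases hkn : k = n
      · subst hkn
        by_cases him : i = m
        · exact him ▸ hmne
        · exact (key i hik him).1
      · by_cases him : i = m
        · subst him
          exact (key k (by omega) (by omega)).2.symm
        · by_cases hkm : k = m
          · subst hkm
            exact (key i (by omega) him).2
          · rw [hΦi i (by omega) him, hΦi k (by omega) hkm]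
            exact pt_ne hinj hik.ne (by omega) hk)
    (fun s _ => by
      rw [hΦ1 s 0 circ_zero]
      exact hT.free)
    (fun s _ => by
      rw [hΦ1 s 1 circ_one]
      exact hT.analyticAt_loopGerm hm hmn)
    (by
      refine h1.congr_path zero_le_one fun t _ => conf_ext fun k hk => ?_
      by_cases hkn : k = n
      · subst hkn
        rw [pt_update_last, hΦn, hn, ← circ]
        push_cast
        ring
      · rw [pt_update_last_of_lt (by omega)]
        by_cases hkm : k = m
        · subst hkm
          rw [hΦm]
          push_cast
          ring
        · rw [hΦi k (by omega) hkm])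
  refine h2.congr_path zero_le_one fun t _ => conf_ext fun k hk => ?_
  by_cases hkm : k = m
  · subst hkm
    rw [hΦm, pt_put_self]
    push_cast
    ring
  · rw [pt_put_of_ne hk hmn.le hkm]
    by_cases hkn : k = n
    · subst hkn
      rw [hΦn, hn]
      push_cast
      ring
    · rw [hΦi k (by omega) hkm]

theorem circ_ne_one {t : ℝ} (h0 : t ≠ 0) (h1 : |t| < 1) : circ t ≠ 1 := by
  intro h
  rw [circ, Complex.exp_eq_one_iff] at h
  obtain ⟨k, hk⟩ := h
  have h2 : (t : ℂ) = k := by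
    have := Complex.two_pi_I_ne_zero
    apply mul_left_cancel₀ this
    linear_combination hk
  have h3 : t = (k : ℝ) := by exact_mod_cast h2
  rw [h3] at h0 h1
  have h4 : |k| < 1 := by exact_mod_cast h1
  exact h0 (by exact_mod_cast Int.abs_lt_one_iff.1 h4)

theorem circ_add (s t : ℝ) : circ (s + t) = circ s * circ t := by
  rw [circ, circ, circ, ← Complex.exp_add]
  congr 1
  push_cast
  ring

theorem mem_segment_one_zero {w : ℂ} (h : w ∈ segment ℝ (1 : ℂ) 0) :
    ∃ x : ℝ, 0 ≤ x ∧ x ≤ 1 ∧ w = x := by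
  obtain ⟨a, b, ha, hb, hab, rfl⟩ := h
  exact ⟨a, ha, by linarith, by simp⟩

theorem notMem_segment_one_zero_of_im_ne {w : ℂ} (h : w.im ≠ 0) : w ∉ segment ℝ (1 : ℂ) 0 := by
  intro h'
  obtain ⟨x, -, -, rfl⟩ := mem_segment_one_zero h'
  exact h (Complex.ofReal_im x)

theorem mul_circ_notMem_segment {r t : ℝ} (hr : 0 < r) (ht : t ≠ 0) (ht1 : |t| < 1) :
    (r : ℂ) * circ t ∉ segment ℝ (1 : ℂ) 0 := by
  intro h
  obtain ⟨x, hx0, -, hx⟩ := mem_segment_one_zero h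
  have h1 : r = x := by
    have := congrArg norm hx
    rwa [norm_mul, norm_circ, mul_one, Complex.norm_real, Complex.norm_real,
      Real.norm_of_nonneg hr.le, Real.norm_of_nonneg hx0] at this
  refine circ_ne_one ht ht1 (mul_left_cancel₀ (show (r : ℂ) ≠ 0 by exact_mod_cast hr.ne') ?_)
  rw [hx, h1, mul_one]

theorem injective_put {j : ℕ} (hj : j ≤ n) {z : Fin (n + 1) → ℂ} (hinj : Function.Injective z)
    {w : ℂ} (h : ∀ i ≤ n, i ≠ j → pt i z ≠ w) : Function.Injective (put j w z) :=
  injective_of_pt_ne fun i k hik hk => by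
    by_cases hij : i = j
    · subst hij
      rw [pt_put_self, pt_put_of_ne hk (by omega) (by omega)]
      exact (h k hk (by omega)).symm
    · rw [pt_put_of_ne (by omega) hj hij]
      by_cases hkj : k = j
      · subst hkj
        rw [pt_put_self]
        exact h i (by omega) hij
      · rw [pt_put_of_ne hk hj hkj]
        exact pt_ne hinj hik.ne (by omega) hk

end Rotation

/-! ### The first point of the cluster passing once across the segment of integration -/

section Crossing

variable {n : ℕ}

/-- Continuation of `confInt 0 n` when the point `j` goes around the points `j + 1, …, n`. -/
theorem cont_confInt_put_rotate {j : ℕ} (hj : 1 ≤ j) (hjn : j < n) {z : Fin (n + 1) → ℂ}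
    (h0 : pt 0 z = 1) (hn : pt n z = 0) (hinj : Function.Injective z) {μ M : ℝ} (hμ0 : 0 < μ)
    (hμ : ∀ k, j < k → k < n → ‖pt k z‖ < μ) (hμa : μ ≤ (pt j z).re) (hM : ‖pt j z‖ < M)
    (hMi : ∀ i < j, M ≤ ‖pt i z‖) (hIm : ∀ k, j ≤ k → k < n → (pt k z).im < 0)
    (hcr : ∀ k, j < k → k < n → (conj (pt j z) * pt k z).im < 0)
    (hhull : ∀ i, 1 ≤ i → i < j → pt i z ∉ convexHull ℝ {pt 0 z, pt j z, pt n z}) :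
    Cont (fun t => put j (circ t * pt j z) z) 0 1
      (fun w => confInt 0 n w + 2 * Real.pi * Complex.I * (confInt 0 j w * confInt j n w))
      (confInt 0 n) := by
  -- The integral from j to n may itself change when j goes around the later points. The correction
  -- term is therefore added at the start of the path, where its factors are the unobstructed
  -- integrals, and it disappears at the end.
  set a := pt j z with ha
  set T : Set ℂ := convexHull ℝ {pt 0 z, a, pt n z} with hT
  have hTconv : Convex ℝ T := convex_convexHull ℝ _
  have h1T : (1 : ℂ) ∈ T := h0 ▸ subset_convexHull ℝ _ (by simp)
  have h0T : (0 : ℂ) ∈ T := hn ▸ subset_convexHull ℝ _ (by simp)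
  have haT : a ∈ T := subset_convexHull ℝ _ (by simp)
  have hM1 : M ≤ 1 := by simpa [h0] using hMi 0 (by omega)
  have hMpos : 0 < M := (norm_nonneg _).trans_lt hM
  have ht : ∀ (w : ℂ), pt j (put j w z) = w := fun w => pt_put_self ..
  have hi : ∀ i ≤ n, i ≠ j → ∀ w, pt i (put j w z) = pt i z := fun i hi hij w =>
    pt_put_of_ne hi hjn.le hij w z
  have hseg : ∀ i, 1 ≤ i → i < n → i ≠ j → pt i z ∉ segment ℝ (1 : ℂ) 0 := by
    intro i h1 h2 h3
    rcases lt_or_gt_of_ne h3 with h | h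
    · exact fun hh => hhull i h1 h (hTconv.segment_subset h1T h0T hh)
    · exact notMem_segment_one_zero_of_im_ne (hIm i h.le h2).ne
  have hf0 : ∀ w, w ∉ segment ℝ (1 : ℂ) 0 → Free 0 n (put j w z) := by
    intro w hw i h1 h2
    rw [hi 0 (by omega) (by omega), hi n le_rfl (by omega), h0, hn]
    by_cases hij : i = j
    · rw [hij, ht]
      exact hw
    · rw [hi i h2.le hij]
      exact hseg i h1 h2 hij
  have hfj : ∀ w ∈ T, Free 0 j (put j w z) := by
    intro w hw i h1 h2
    rw [hi 0 (by omega) (by omega), ht, h0, hi i (by omega) (by omega)]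
    exact fun hh => hhull i h1 h2 (hTconv.segment_subset h1T hw hh)
  -- A point on the segment from w to 0 would be a real multiple of w, making conj w times it real.
  have hfjn : ∀ w, (∀ k, j < k → k < n → (conj w * pt k z).im < 0) → Free j n (put j w z) := by
    intro w hw k h1 h2
    rw [ht, hi n le_rfl (by omega), hn, hi k h2.le (by omega)]
    rintro ⟨x, y, -, -, -, hxy⟩
    have := hw k h1 h2
    rw [← hxy, smul_zero, add_zero, Complex.real_smul, mul_left_comm, Complex.conj_mul'] at this
    rw [← Complex.ofReal_pow, ← Complex.ofReal_mul, Complex.ofReal_im] at this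
    exact lt_irrefl _ this
  have hne : ∀ w, w ≠ 0 → ‖w‖ < M → (∀ k, j < k → k < n → pt k z ≠ w) →
      Function.Injective (put j w z) := by
    intro w hw0 hwM hwk
    refine injective_put hjn.le hinj fun i h1 h2 => ?_
    rcases lt_or_gt_of_ne h2 with h | h
    · intro hh
      rw [← hh] at hwM
      exact absurd (hMi i h) (not_le.2 hwM)
    · by_cases hin : i = n
      · rw [hin, hn]
        exact hw0.symm
      · exact hwk i h (by omega)
  have hex : ∀ γ : ℝ → ℂ, Continuous γ →
      (∀ t ∈ Set.Icc (0 : ℝ) 1, Function.Injective (put j (γ t) z)) →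
      γ 0 ∉ segment ℝ (1 : ℂ) 0 → γ 0 ∈ T → (∀ k, j < k → k < n → (conj (γ 0) * pt k z).im < 0) →
      ∃ h, Cont (fun t => put j (γ t) z) 0 1 (fun w => confInt 0 n w +
        2 * Real.pi * Complex.I * (confInt 0 j w * confInt j n w)) h := by
    intro γ hγ hγi h1 h2 h3
    have hc : Continuous fun t => put j (γ t) z := continuous_put j hγ continuous_const
    obtain ⟨g1, hg1⟩ := exists_cont_confInt (a := 0) (b := n) (by omega) le_rfl hc hγi (hf0 _ h1)
    obtain ⟨g2, hg2⟩ := exists_cont_confInt (a := 0) (b := j) (by omega) hjn.le hc hγi (hfj _ h2)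
    obtain ⟨g3, hg3⟩ := exists_cont_confInt (a := j) (b := n) hjn le_rfl hc hγi (hfjn _ h3)
    exact ⟨_, hg1.add ((hg2.mul hg3).const_mul _)⟩
  -- the points between `pt j z` and its real part
  let bb : ℝ → ℂ := fun s => (a.re : ℂ) + s * (a.im * Complex.I)
  have hbbre : ∀ s, (bb s).re = a.re := fun s => by simp [bb]
  have hbbim : ∀ s, (bb s).im = s * a.im := fun s => by simp [bb]
  have hbbc : Continuous bb := by fun_prop
  have hapos : 0 < a.re := hμ0.trans_le hμa
  have haim : a.im < 0 := hIm j le_rfl hjn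
  have hareM : a.re < M := (Complex.re_le_norm a).trans_lt hM
  have hbb1 : bb 1 = a := by
    simp [bb, Complex.re_add_im]
  have hbbcomb : ∀ s : ℝ, bb s = (1 - s : ℝ) • (a.re : ℂ) + s • a := by
    intro s
    apply Complex.ext <;> simp [bb]
    ring
  have hreT : (a.re : ℂ) ∈ T := by
    have := hTconv h1T h0T hapos.le (sub_nonneg.2 (hareM.le.trans hM1)) (by ring)
    simpa using this
  have hbbT : ∀ s, 0 ≤ s → s ≤ 1 → bb s ∈ T := fun s h1 h2 => by
    rw [hbbcomb]
    exact hTconv hreT haT (sub_nonneg.2 h2) h1 (by ring)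
  have hbbM : ∀ s, 0 ≤ s → s ≤ 1 → ‖bb s‖ < M := by
    intro s h1 h2
    have := (convex_ball (0 : ℂ) M) (x := (a.re : ℂ)) (y := a)
      (by simpa [abs_of_pos hapos] using hareM) (by simpa using hM) (sub_nonneg.2 h2) h1 (by ring)
    rw [← hbbcomb] at this
    simpa using this
  have hbbμ : ∀ s, μ ≤ ‖bb s‖ := fun s => hμa.trans ((hbbre s).symm.le.trans (Complex.re_le_norm _))
  have hbbcr : ∀ s, 0 ≤ s → s ≤ 1 → ∀ k, j < k → k < n → (conj (bb s) * pt k z).im < 0 := by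
    intro s h1 h2 k h3 h4
    have e1 := hcr k h3 h4
    have e2 : (conj ((a.re : ℂ)) * pt k z).im < 0 := by
      rw [Complex.conj_ofReal, Complex.im_ofReal_mul]
      exact mul_neg_of_pos_of_neg hapos (hIm k h3.le h4)
    have := (convex_Iio (0 : ℝ)) e2 e1 (sub_nonneg.2 h2) h1 (by ring)
    rw [hbbcomb, map_add, add_mul, Complex.add_im]
    have e3 : ∀ (x : ℝ) (u : ℂ), (conj (x • u) * pt k z).im = x • (conj u * pt k z).im := by
      intro x u
      rw [Complex.real_smul, map_mul, Complex.conj_ofReal, mul_assoc, Complex.im_ofReal_mul,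
        smul_eq_mul]
    rw [e3, e3]
    exact this
  -- a base point near the real axis
  obtain ⟨τ, hτ, hτk⟩ : ∃ τ > 0, ∀ t : ℝ, |t| < τ → ∀ k, j < k → k < n →
      (pt k z * circ t).im < 0 := by
    have : ∀ᶠ t : ℝ in 𝓝 0, ∀ k ∈ Finset.Ioo j n, (pt k z * circ t).im < 0 :=
      (Finset.eventually_all _).2 fun k hk => by
        have hc : Continuous fun t : ℝ => (pt k z * circ t).im := by fun_prop
        refine hc.continuousAt.eventually_lt_const ?_
        simpa using hIm k (Finset.mem_Ioo.1 hk).1.le (Finset.mem_Ioo.1 hk).2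
    obtain ⟨τ, hτ, h⟩ := Metric.eventually_nhds_iff.1 this
    exact ⟨τ, hτ, fun t ht k h1 h2 => h (by simpa using ht) k (Finset.mem_Ioo.2 ⟨h1, h2⟩)⟩
  -- The base point is chosen so close to the real axis that the arc from it to its mirror image
  -- meets none of the later points at any radius; τ measures the available angle.
  obtain ⟨σ, hσ0, hσ1, hσ⟩ : ∃ σ : ℝ, 0 < σ ∧ σ < 1 ∧
      |Complex.arg (bb σ)| < Real.pi * min τ (1 / 2) := by
    have hc : ContinuousAt (fun s => |Complex.arg (bb s)|) 0 := by
      refine (ContinuousAt.comp (g := Complex.arg) (Complex.continuousAt_arg ?_)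
        hbbc.continuousAt).abs
      left
      rw [hbbre]
      exact hapos
    have h1 : |Complex.arg (bb 0)| < Real.pi * min τ (1 / 2) := by
      have : bb 0 = (a.re : ℂ) := by simp [bb]
      rw [this, Complex.arg_ofReal_of_nonneg hapos.le, abs_zero]
      have := Real.pi_pos
      positivity
    obtain ⟨δ, hδ, h⟩ := Metric.eventually_nhds_iff.1 (hc.eventually_lt_const h1)
    refine ⟨min (δ / 2) (1 / 2), by positivity, (min_le_right _ _).trans_lt (by norm_num), h ?_⟩
    rw [dist_zero_right, Real.norm_of_nonneg (by positivity)]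
    exact (min_le_left _ _).trans_lt (by linarith)
  -- With this choice `bb σ` has angle -πt₁. The arc for t in [0, t₁] is symmetric about the
  -- positive real axis, and for t in [t₁, 1] the rest of the circle avoids it.
  set t₁ : ℝ := -Complex.arg (bb σ) / Real.pi with ht₁
  have hpi := Real.pi_pos
  have ht₁pos : 0 < t₁ := by
    have : Complex.arg (bb σ) < 0 := by
      rw [Complex.arg_neg_iff, hbbim]
      exact mul_neg_of_pos_of_neg hσ0 haim
    exact div_pos (by linarith) hpi
  have ht₁lt : t₁ < min τ (1 / 2) := by
    rw [ht₁, div_lt_iff₀ hpi, mul_comm]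
    exact (neg_le_abs _).trans_lt hσ
  have ht₁τ : t₁ < τ := ht₁lt.trans_le (min_le_left _ _)
  have ht₁h : t₁ < 1 / 2 := ht₁lt.trans_le (min_le_right _ _)
  set r := ‖bb σ‖ with hr
  have hrpos : 0 < r := hμ0.trans_le (hbbμ σ)
  have hb : bb σ = r * circ (-(t₁ / 2)) := by
    rw [hr, circ]
    conv_lhs => rw [← Complex.norm_mul_exp_arg_mul_I (bb σ)]
    congr 2
    rw [ht₁]
    have : (Real.pi : ℂ) ≠ 0 := by exact_mod_cast hpi.ne'
    push_cast
    field_simp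
  -- circles of any radius
  let P : ℝ → ℝ → Fin (n + 1) → ℂ := fun R t => put j (R * circ (t - t₁ / 2)) z
  have hPc : Continuous (Function.uncurry P) :=
    continuous_put j (by fun_prop) continuous_const
  have hPstart : ∀ R, 0 < R → R ≤ r → R * circ (-(t₁ / 2)) ∈ T ∧
      ∀ k, j < k → k < n → (conj ((R : ℂ) * circ (-(t₁ / 2))) * pt k z).im < 0 := by
    intro R hR hRr
    have e : (R : ℂ) * circ (-(t₁ / 2)) = (R / r : ℝ) • bb σ := by
      have : (r : ℂ) ≠ 0 := by exact_mod_cast hrpos.ne'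
      rw [hb, Complex.real_smul]
      push_cast
      field_simp
    rw [e]
    constructor
    · have := hTconv h0T (hbbT σ hσ0.le hσ1.le) (sub_nonneg.2 ((div_le_one hrpos).2 hRr))
        (div_pos hR hrpos).le (by ring)
      simpa using this
    · intro k h1 h2
      rw [Complex.real_smul, map_mul, Complex.conj_ofReal, mul_assoc, Complex.im_ofReal_mul]
      exact mul_neg_of_pos_of_neg (div_pos hR hrpos) (hbbcr σ hσ0.le hσ1.le k h1 h2)
  have hPfree : ∀ R, 0 < R → ∀ t, 0 ≤ t → t ≤ 1 → t ≠ t₁ / 2 → Free 0 n (P R t) := by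
    intro R hR t h1 h2 h3
    exact hf0 _ (mul_circ_notMem_segment hR (sub_ne_zero.2 h3)
      (abs_lt.2 ⟨by linarith, by linarith⟩))
  have hnorm : ∀ R : ℝ, 0 < R → ∀ t, ‖(R : ℂ) * circ t‖ = R := by
    intro R hR t
    rw [norm_mul, norm_circ, mul_one, Complex.norm_real, Real.norm_of_nonneg hR.le]
  have hnz : ∀ R : ℝ, 0 < R → ∀ t, (R : ℂ) * circ t ≠ 0 := fun R hR t =>
    mul_ne_zero (by exact_mod_cast hR.ne') (circ_ne_zero t)
  -- a small circle
  obtain ⟨ε, hε0, hεr, hεT, hεn⟩ : ∃ ε : ℝ, 0 < ε ∧ ε < r ∧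
      (∀ w : ℂ, ‖w‖ = ε → ∀ i ∈ Finset.Ico 1 n, i ≠ j → ∀ t : unitInterval,
        pt i z ∉ segment ℝ (1 : ℂ) (w + ((t : ℝ) : ℂ) * (0 - w))) ∧
      (∀ i ∈ Finset.range n, i ≠ j → 4 * ε < ‖pt i z‖) := by
    have e1 : ∀ᶠ w : ℂ in 𝓝 0, ∀ i ∈ Finset.Ico 1 n, i ≠ j → ∀ t : unitInterval,
        pt i z ∉ segment ℝ (1 : ℂ) (w + ((t : ℝ) : ℂ) * (0 - w)) :=
      (Finset.eventually_all _).2 fun i hi => by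
        by_cases hij : i = j
        · exact Eventually.of_forall fun _ h => absurd hij h
        · have := eventually_forall_notMem_segment (X := ℂ) (e := 0) (a := fun _ => 1)
            (b := fun w => w) (c := fun _ => 0) (d := fun _ => pt i z) continuousAt_const
            continuousAt_id continuousAt_const continuousAt_const (fun t => by
              simpa using hseg i (Finset.mem_Ico.1 hi).1 (Finset.mem_Ico.1 hi).2 hij)
          filter_upwards [this] with w hw _ using hw
    have e2 : ∀ᶠ x : ℝ in 𝓝 0, ∀ i ∈ Finset.range n, i ≠ j → 4 * x < ‖pt i z‖ :=
      (Finset.eventually_all _).2 fun i hi => by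
        have hi' := Finset.mem_range.1 hi
        have hc : ContinuousAt (fun x : ℝ => 4 * x) 0 := by fun_prop
        have hpos : 0 < ‖pt i z‖ := by
          rw [norm_pos_iff, ← hn]
          exact pt_ne hinj hi'.ne hi'.le le_rfl
        filter_upwards [hc.eventually_lt_const (show 4 * (0 : ℝ) < ‖pt i z‖ by simpa using hpos)]
          with x hx _ using hx
    obtain ⟨δ1, hδ1, h1⟩ := Metric.eventually_nhds_iff.1 e1
    obtain ⟨δ2, hδ2, h2⟩ := Metric.eventually_nhds_iff.1 e2
    obtain ⟨ε, hε0, hε⟩ := exists_between (show (0 : ℝ) < min r (min δ1 δ2) by positivity)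
    refine ⟨ε, hε0, hε.trans_le (min_le_left _ _), fun w hw => h1 ?_, h2 ?_⟩
    · rw [dist_zero_right, hw]
      exact hε.trans_le ((min_le_right _ _).trans (min_le_left _ _))
    · rw [dist_zero_right, Real.norm_of_nonneg hε0.le]
      exact hε.trans_le ((min_le_right _ _).trans (min_le_right _ _))
  have hrM : r < M := hbbM σ hσ0.le hσ1.le
  have hεinj : ∀ t, Function.Injective (P ε t) := fun t => by
    refine hne _ (hnz ε hε0 _) ((hnorm ε hε0 _).trans_lt (hεr.trans hrM)) fun k h1 h2 h3 => ?_
    have h4 := hεn k (Finset.mem_range.2 h2) (by omega)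
    rw [h3, hnorm ε hε0] at h4
    linarith
  have hεtri : TriangleFree j (P ε 0) := by
    refine ⟨?_, fun i h1 h2 h3 t => ?_⟩
    · rw [ht, hi 0 (by omega) (by omega), hi n le_rfl (by omega), h0, hn]
      exact mul_circ_notMem_segment hε0 (by linarith) (abs_lt.2 ⟨by linarith, by linarith⟩)
    · rw [ht, hi 0 (by omega) (by omega), hi n le_rfl (by omega), hi i h1.le h3, h0, hn]
      exact hεT _ (hnorm ε hε0 _) i (Finset.mem_Ico.2 ⟨h2, h1⟩) h3 t
  have small : Cont (P ε) 0 1 (fun w => confInt 0 n w +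
      2 * Real.pi * Complex.I * (confInt 0 j w * confInt j n w)) (confInt 0 n) := by
    have c1 := cont_confInt_put_circle hj hjn (hεinj 0)
      (by rw [hi n le_rfl (by omega), hn]) (fun i h1 h2 => by
        rw [ht, hi i h1.le h2, hnorm ε hε0]
        exact hεn i (Finset.mem_range.2 h1) h2) hεtri
    have hpath : ∀ t, put j (circ t * pt j (P ε 0)) (P ε 0) = P ε t := by
      intro t
      rw [ht]
      simp only [P]
      rw [put_put]
      congr 1
      rw [show t - t₁ / 2 = t + (0 - t₁ / 2) by ring, circ_add t]
      ring
    rw [funext hpath] at c1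
    have c2 : Cont (P ε) 0 1 (confInt 0 j) (confInt 0 j) := Cont.const fun t _ => by
      refine Free.analyticAt (by omega) fun i h1 h2 => ?_
      rw [ht, hi 0 (by omega) (by omega), h0, hi i (by omega) (by omega)]
      simpa using hεT _ (hnorm ε hε0 (t - t₁ / 2)) i (Finset.mem_Ico.2 ⟨h1, by omega⟩) (by omega) 0
    have c3 : Cont (P ε) 0 1 (confInt j n) (confInt j n) := Cont.const fun t _ => by
      refine Free.analyticAt hjn fun k h1 h2 h3 => ?_
      rw [ht, hi n le_rfl (by omega), hn, hi k h2.le (by omega)] at h3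
      have h4 := (convex_closedBall (0 : ℂ) ε).segment_subset
        (show ε * circ (t - t₁ / 2) ∈ Metric.closedBall (0 : ℂ) ε by
          rw [mem_closedBall_zero_iff, hnorm ε hε0]) (by simpa using hε0.le) h3
      have h5 := hεn k (Finset.mem_range.2 h2) (by omega)
      rw [mem_closedBall_zero_iff] at h4
      linarith
    refine (c1.add ((c2.mul c3).const_mul (2 * Real.pi * Complex.I))).congr EventuallyEq.rfl
      (Eventually.of_forall fun w => ?_)
    simp only [loopGerm]
    ring
  -- the small arc through the positive real axis
  have hPcont : ∀ R, Continuous (P R) := fun R => hPc.comp (Continuous.prodMk_right R)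
  have major : ∀ R, 0 < R → Cont (P R) t₁ 1 (confInt 0 n) (confInt 0 n) := fun R hR =>
    Cont.const fun t ht => (hPfree R hR t (ht₁pos.le.trans ht.1) ht.2
      (by linarith [ht.1])).analyticAt (by omega)
  -- On the rest of the small circle the segment stays unobstructed and the integral does not
  -- change, so the monodromy of the whole small circle comes from the short arc alone. Uniqueness
  -- along the reversed long arc makes this precise.
  have minor : Cont (P ε) 0 t₁ (fun w => confInt 0 n w +
      2 * Real.pi * Complex.I * (confInt 0 j w * confInt j n w)) (confInt 0 n) := by
    obtain ⟨h, hA, hB⟩ := small.exists_split ht₁pos.le (by linarith)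
    have hτc : ContinuousOn (fun t : ℝ => t₁ + 1 - t) (Set.Icc t₁ 1) := by fun_prop
    have hτm : Set.MapsTo (fun t : ℝ => t₁ + 1 - t) (Set.Icc t₁ 1) (Set.Icc t₁ 1) := fun t ht =>
      ⟨by linarith [ht.2], by linarith [ht.1]⟩
    have r1 := hB.comp_reverse hτc hτm (by ring) (by ring)
    have r2 := (major ε hε0).comp_reverse hτc hτm (by ring) (by ring)
    have := Cont.unique ((hPcont ε).comp (by fun_prop)).continuousOn (by linarith) r1 r2
    simp only [Function.comp_apply, add_sub_cancel_right] at this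
    exact hA.congr EventuallyEq.rfl this
  have minor' : Cont (fun t => P ε (t₁ * t)) 0 1 (fun w => confInt 0 n w +
      2 * Real.pi * Complex.I * (confInt 0 j w * confInt j n w)) (confInt 0 n) :=
    minor.comp (τ := fun t => t₁ * t) (by fun_prop)
      (fun t ht => ⟨mul_nonneg ht₁pos.le ht.1, mul_le_of_le_one_right ht₁pos.le ht.2⟩)
      (by simp) (by simp)
  have hRpos : ∀ s ∈ Set.Icc (0 : ℝ) 1, 0 < ε + s * (r - ε) ∧ ε + s * (r - ε) ≤ r := by
    intro s hs
    have h1 := mul_nonneg hs.1 (sub_pos.2 hεr).le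
    have h2 := mul_le_of_le_one_left (sub_pos.2 hεr).le hs.2
    exact ⟨by linarith, by linarith⟩
  have hRinj : ∀ s ∈ Set.Icc (0 : ℝ) 1, ∀ t ∈ Set.Icc (0 : ℝ) 1,
      Function.Injective (P (ε + s * (r - ε)) (t₁ * t)) := by
    intro s hs t ht
    have hR := hRpos s hs
    refine hne _ (hnz _ hR.1 _) ((hnorm _ hR.1 _).trans_lt (hR.2.trans_lt hrM))
      fun k h1 h2 h3 => ?_
    have h4 := hτk (-(t₁ * t - t₁ / 2)) (by
      have e1 := mul_nonneg ht₁pos.le ht.1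
      have e2 := mul_le_of_le_one_right ht₁pos.le ht.2
      exact abs_lt.2 ⟨by linarith, by linarith⟩) k h1 h2
    rw [h3, mul_assoc, ← circ_add, add_neg_cancel, circ_zero, mul_one, Complex.ofReal_im] at h4
    exact lt_irrefl _ h4
  -- The short arc is enlarged from radius ε to r inside the sector that contains no later points.
  have arc : Cont (fun t => P r (t₁ * t)) 0 1 (fun w => confInt 0 n w +
      2 * Real.pi * Complex.I * (confInt 0 j w * confInt j n w)) (confInt 0 n) := by
    have := Cont.homotopy (Φ := fun s t => P (ε + s * (r - ε)) (t₁ * t)) (f := fun w =>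
      confInt 0 n w + 2 * Real.pi * Complex.I * (confInt 0 j w * confInt j n w)) (g := confInt 0 n)
      (hPc.comp (by fun_prop : Continuous fun x : ℝ × ℝ => (ε + x.1 * (r - ε), t₁ * x.2)))
      (fun s hs => (hPfree _ (hRpos s hs).1 _ (by linarith) (by linarith)
        (by linarith)).analyticAt (by omega))
      (fun s hs => hex _ (by fun_prop) (hRinj s hs)
        (mul_circ_notMem_segment (hRpos s hs).1 (by linarith)
          (abs_lt.2 ⟨by linarith, by linarith⟩))
        (by simpa using (hPstart _ (hRpos s hs).1 (hRpos s hs).2).1)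
        (by simpa using (hPstart _ (hRpos s hs).1 (hRpos s hs).2).2))
      (by simpa using minor')
    simpa using this
  have arc' : Cont (P r) 0 t₁ (fun w => confInt 0 n w +
      2 * Real.pi * Complex.I * (confInt 0 j w * confInt j n w)) (confInt 0 n) := by
    have := arc.comp (τ := fun t => t / t₁) (c := 0) (d := t₁) (by fun_prop)
      (fun t ht => ⟨div_nonneg ht.1 ht₁pos.le, (div_le_one ht₁pos).2 ht.2⟩)
      (by simp) (div_self ht₁pos.ne')
    refine this.congr_path ht₁pos.le fun t _ => ?_
    simp only [Function.comp_apply]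
    rw [mul_div_cancel₀ _ ht₁pos.ne']
  have full : Cont (P r) 0 1 (fun w => confInt 0 n w +
      2 * Real.pi * Complex.I * (confInt 0 j w * confInt j n w)) (confInt 0 n) :=
    arc'.trans ht₁pos.le (by linarith) (major r hrpos) (hPcont r).continuousAt
  -- moving the base point
  have hσs : ∀ s ∈ Set.Icc (0 : ℝ) 1, 0 < σ + s * (1 - σ) ∧ σ + s * (1 - σ) ≤ 1 := by
    intro s hs
    have h1 := mul_nonneg hs.1 (sub_pos.2 hσ1).le
    have h2 := mul_le_of_le_one_left (sub_pos.2 hσ1).le hs.2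
    exact ⟨by linarith, by linarith⟩
  have hbbseg : ∀ s, 0 < s → bb s ∉ segment ℝ (1 : ℂ) 0 := fun s hs =>
    notMem_segment_one_zero_of_im_ne (by
      rw [hbbim]
      exact (mul_neg_of_pos_of_neg hs haim).ne)
  -- Finally the starting point moves up the vertical segment to a. All circles have radius at least
  -- μ, hence enclose the later points, and less than M, hence exclude the earlier ones.
  have last := Cont.homotopy (Φ := fun s t => put j (circ t * bb (σ + s * (1 - σ))) z) (f := fun w =>
      confInt 0 n w + 2 * Real.pi * Complex.I * (confInt 0 j w * confInt j n w)) (g := confInt 0 n)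
      (continuous_put j (by fun_prop) continuous_const)
      (fun s hs => by
        rw [circ_one, one_mul]
        exact (hf0 _ (hbbseg _ (hσs s hs).1)).analyticAt (by omega))
      (fun s hs => by
        have h1 := hσs s hs
        refine hex _ (by fun_prop) (fun t _ => ?_) ?_ ?_ ?_
        · have h2 : ‖circ t * bb (σ + s * (1 - σ))‖ = ‖bb (σ + s * (1 - σ))‖ := by
            rw [norm_mul, norm_circ, one_mul]
          refine hne _ ?_ (h2.trans_lt (hbbM _ h1.1.le h1.2)) fun k h3 h4 h5 => ?_
          · exact mul_ne_zero (circ_ne_zero t) (norm_pos_iff.1 (hμ0.trans_le (hbbμ _)))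
          · have h6 := hμ k h3 h4
            rw [h5, h2] at h6
            exact absurd (hbbμ _) (not_le.2 h6)
        · rw [circ_zero, one_mul]
          exact hbbseg _ h1.1
        · rw [circ_zero, one_mul]
          exact hbbT _ h1.1.le h1.2
        · rw [circ_zero, one_mul]
          exact hbbcr _ h1.1.le h1.2)
      (by
        refine full.congr_path zero_le_one fun t _ => ?_
        simp only [P]
        rw [zero_mul, add_zero, hb, show t - t₁ / 2 = t + -(t₁ / 2) by ring, circ_add]
        congr 1
        ring)
  simpa [hbb1] using last

end Crossing

/-! ### Clusters of points, their rotation, and clockwise polygons -/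

section Cluster

variable {n : ℕ}

/-- The configuration with given points. -/
def conf (f : ℕ → ℂ) : Fin (n + 1) → ℂ := fun i => f i

theorem pt_conf {k : ℕ} (hk : k ≤ n) (f : ℕ → ℂ) : pt k (conf f : Fin (n + 1) → ℂ) = f k :=
  pt_mk (by omega) _

theorem continuous_conf {X : Type*} [TopologicalSpace X] {f : X → ℕ → ℂ}
    (hf : ∀ k, Continuous fun x => f x k) : Continuous fun x => (conf (f x) : Fin (n + 1) → ℂ) :=
  continuous_pi fun i => hf i

/-- Only points that enter the integral have to be distinct; this permits homotopies in which point
j runs into later points. -/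
theorem exists_cont_confInt_of_ne {a b : ℕ} (hab : a < b) {γ : ℝ → Fin (n + 1) → ℂ}
    (hγ : Continuous γ)
    (hne : ∀ i k, a ≤ i → i < k → k ≤ b → ∀ t ∈ Set.Icc (0 : ℝ) 1, pt i (γ t) ≠ pt k (γ t))
    (h : Free a b (γ 0)) : ∃ g, Cont γ 0 1 (confInt a b) g :=
  exists_cont_polyInt (p := fun i z => pt (a + i) z) hγ zero_le_one
    (fun _ _ _ _ => analyticAt_pt _ _)
    (fun i j hij hj t ht => hne _ _ (by omega) (by omega) (by omega) t ht)
    (h.unobstructed hab)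

/-- Multiply the point `j` by `circ x` and all later points by `circ y`. -/
def twist (j : ℕ) (x y : ℝ) (z : Fin (n + 1) → ℂ) : Fin (n + 1) → ℂ :=
  conf fun i => if i < j then pt i z else if i = j then circ x * pt i z else circ y * pt i z

theorem pt_twist_of_lt {i j : ℕ} (hi : i < j) (hin : i ≤ n) (x y : ℝ) (z : Fin (n + 1) → ℂ) :
    pt i (twist j x y z) = pt i z := by
  rw [twist, pt_conf (by omega), if_pos hi]

theorem pt_twist_self {j : ℕ} (hj : j ≤ n) (x y : ℝ) (z : Fin (n + 1) → ℂ) :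
    pt j (twist j x y z) = circ x * pt j z := by
  rw [twist, pt_conf hj, if_neg (lt_irrefl j), if_pos rfl]

theorem pt_twist_of_gt {i j : ℕ} (hi : j < i) (hin : i ≤ n) (x y : ℝ) (z : Fin (n + 1) → ℂ) :
    pt i (twist j x y z) = circ y * pt i z := by
  rw [twist, pt_conf hin, if_neg (by omega), if_neg (by omega)]

theorem pt_twist_diag {i j : ℕ} (hi : j ≤ i) (hin : i ≤ n) (x : ℝ) (z : Fin (n + 1) → ℂ) :
    pt i (twist j x x z) = circ x * pt i z := by
  rw [twist, pt_conf hin, if_neg (by omega), ite_self]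

theorem continuous_twist {X : Type*} [TopologicalSpace X] {f g : X → ℝ} (j : ℕ)
    {z : X → Fin (n + 1) → ℂ} (hf : Continuous f) (hg : Continuous g) (hz : Continuous z) :
    Continuous fun x => twist j (f x) (g x) (z x) := by
  refine continuous_conf fun k => ?_
  have := (continuous_pt k).comp hz
  simp only [Function.comp_def] at this
  split_ifs <;> fun_prop

theorem twist_of_circ_eq_one {j : ℕ} {x y : ℝ} (hx : circ x = 1) (hy : circ y = 1)
    (z : Fin (n + 1) → ℂ) : twist j x y z = z :=
  conf_ext fun k hk => by
    rw [twist, pt_conf hk, hx, hy, one_mul, ite_self, ite_self]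

theorem norm_pt_twist {i : ℕ} (hi : i ≤ n) (j : ℕ) (x y : ℝ) (z : Fin (n + 1) → ℂ) :
    ‖pt i (twist j x y z)‖ = ‖pt i z‖ := by
  rw [twist, pt_conf hi]
  split_ifs
  · rfl
  · rw [norm_mul, norm_circ, one_mul]
  · rw [norm_mul, norm_circ, one_mul]

/-- The moduli separate the points before j, point j, and the points after j, so the last two groups
may be rotated independently. -/
theorem injective_twist {j : ℕ} {z : Fin (n + 1) → ℂ} (hinj : Function.Injective z) {M : ℝ}
    (hfar : ∀ i < j, M ≤ ‖pt i z‖) (hj : ‖pt j z‖ < M)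
    (hnear : ∀ k, j < k → k ≤ n → ‖pt k z‖ < ‖pt j z‖) (x y : ℝ) :
    Function.Injective (twist j x y z) :=
  injective_of_pt_ne fun i k hik hk => by
    rcases lt_trichotomy i j with hi | rfl | hi
    · by_cases hkj : k < j
      · rw [pt_twist_of_lt hi (by omega), pt_twist_of_lt hkj hk]
        exact pt_ne hinj hik.ne (by omega) hk
      · intro h
        have h1 := congrArg norm h
        rw [norm_pt_twist (by omega), norm_pt_twist hk] at h1
        have h2 := hfar i hi
        rcases (not_lt.1 hkj).eq_or_lt with rfl | hkj
        · linarith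
        · linarith [hnear k hkj hk]
    · intro h
      have h1 := congrArg norm h
      rw [norm_pt_twist (by omega), norm_pt_twist hk] at h1
      exact (hnear k hik hk).ne h1.symm
    · rw [pt_twist_of_gt hi (by omega), pt_twist_of_gt (by omega) hk]
      intro h
      exact pt_ne hinj hik.ne (by omega) hk (mul_left_cancel₀ (circ_ne_zero _) h)

theorem injective_twist_diag {j : ℕ} {z : Fin (n + 1) → ℂ} (hinj : Function.Injective z)
    {M : ℝ} (hfar : ∀ i < j, M ≤ ‖pt i z‖) (hnear : ∀ k, j ≤ k → k ≤ n → ‖pt k z‖ < M) (x : ℝ) :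
    Function.Injective (twist j x x z) :=
  injective_of_pt_ne fun i k hik hk => by
    by_cases hi : i < j
    · by_cases hkj : k < j
      · rw [pt_twist_of_lt hi (by omega), pt_twist_of_lt hkj hk]
        exact pt_ne hinj hik.ne (by omega) hk
      · intro h
        have h1 := congrArg norm h
        rw [norm_pt_twist (by omega), norm_pt_twist hk] at h1
        linarith [hfar i hi, hnear k (by omega) hk]
    · rw [pt_twist_diag (by omega) (by omega), pt_twist_diag (by omega) hk]
      intro h
      exact pt_ne hinj hik.ne (by omega) hk (mul_left_cancel₀ (circ_ne_zero _) h)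

/-- The value of `confInt 0 n` after a full rotation of the points `j, …, n - 1`. -/
def clusterGerm (j : ℕ) (z : Fin (n + 1) → ℂ) : ℂ :=
  confInt 0 n z - 2 * Real.pi * Complex.I * ∑ s ∈ Finset.Ico j n, confInt 0 s z * confInt s n z

/-- The integrals in `clusterGerm` are not obstructed. -/
structure ClusterFree (j : ℕ) (z : Fin (n + 1) → ℂ) : Prop where
  free : Free 0 n z
  free_left : ∀ s, j ≤ s → s < n → Free 0 s z
  free_right : ∀ s, j ≤ s → s < n → Free s n z

theorem ClusterFree.analyticAt {j : ℕ} (hj : 1 ≤ j) (hjn : j < n) {z : Fin (n + 1) → ℂ}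
    (h : ClusterFree j z) : AnalyticAt ℂ (clusterGerm j) z := by
  refine (h.free.analyticAt (by omega)).sub (analyticAt_const.mul
    (Finset.analyticAt_fun_sum _ fun s hs => ?_))
  have hs' := Finset.mem_Ico.1 hs
  exact ((h.free_left s hs'.1 hs'.2).analyticAt (by omega)).mul
    ((h.free_right s hs'.1 hs'.2).analyticAt hs'.2)

/-- Together with the point `0`, which is `1`, the points `j, …, n`, the last of which is `0`, form
a convex polygon, traversed clockwise, which contains no other points. -/
structure ClockwisePolygon (j : ℕ) (z : Fin (n + 1) → ℂ) : Prop where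
  injective : Function.Injective z
  zero : pt 0 z = 1
  last : pt n z = 0
  im_neg : ∀ k, j ≤ k → k < n → (pt k z).im < 0
  one_im_neg : ∀ k l, j ≤ k → k < l → l < n → (conj (pt k z - 1) * (pt l z - 1)).im < 0
  mul_im_neg : ∀ k l, j ≤ k → k < l → l < n → (conj (pt k z) * pt l z).im < 0
  notMem : ∀ i, 1 ≤ i → i < j →
    pt i z ∉ convexHull ℝ (insert (pt 0 z) ((fun k => pt k z) '' Set.Icc j n))

theorem conj_smul_mul_im (r : ℝ) (u v : ℂ) : (conj ((r : ℂ) * u) * v).im = r * (conj u * v).im := by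
  rw [map_mul, Complex.conj_ofReal, mul_assoc, Complex.im_ofReal_mul]

theorem conj_mul_smul_im (r : ℝ) (u : ℂ) : (conj ((r : ℂ) * u) * u).im = 0 := by
  rw [conj_smul_mul_im, Complex.conj_mul', ← Complex.ofReal_pow, Complex.ofReal_im, mul_zero]

theorem mul_smul_conj_im (r : ℝ) (u : ℂ) : (conj u * ((r : ℂ) * u)).im = 0 := by
  rw [mul_left_comm, Complex.conj_mul', ← Complex.ofReal_pow, ← Complex.ofReal_mul,
    Complex.ofReal_im]

/-- Points before j are outside the polygon, while every segment of integration in question lies in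
it. A vertex between the ends of a diagonal or side is off that segment because the orientation
inequalities are strict. -/
theorem ClockwisePolygon.clusterFree {j : ℕ} (hjn : j < n) {z : Fin (n + 1) → ℂ}
    (h : ClockwisePolygon j z) : ClusterFree j z := by
  have hC := convex_convexHull ℝ (insert (pt 0 z) ((fun k => pt k z) '' Set.Icc j n))
  have h0C := subset_convexHull ℝ _ (Set.mem_insert (pt 0 z) ((fun k => pt k z) '' Set.Icc j n))
  have hkC : ∀ k, j ≤ k → k ≤ n →
      pt k z ∈ convexHull ℝ (insert (pt 0 z) ((fun k => pt k z) '' Set.Icc j n)) :=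
    fun k h1 h2 => subset_convexHull ℝ _ (Set.mem_insert_of_mem _ ⟨k, ⟨h1, h2⟩, rfl⟩)
  refine ⟨fun i h1 h2 => ?_, fun s hs hsn i h1 h2 => ?_, fun s hs hsn i h1 h2 => ?_⟩
  · by_cases hij : i < j
    · exact fun hh => h.notMem i h1 hij (hC.segment_subset h0C (hkC n hjn.le le_rfl) hh)
    · rw [h.zero, h.last]
      exact notMem_segment_one_zero_of_im_ne (h.im_neg i (by omega) h2).ne
  · by_cases hij : i < j
    · exact fun hh => h.notMem i h1 hij (hC.segment_subset h0C (hkC s hs hsn.le) hh)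
    · rw [segment_eq_image']
      rintro ⟨t, -, ht⟩
      have h3 := h.one_im_neg i s (by omega) h2 hsn
      rw [← ht, h.zero] at h3
      simp only [Complex.real_smul, add_sub_cancel_left] at h3
      rw [conj_mul_smul_im] at h3
      exact lt_irrefl _ h3
  · rw [segment_symm, segment_eq_image']
    rintro ⟨t, -, ht⟩
    have h3 := h.mul_im_neg s i hs h1 h2
    rw [← ht, h.last] at h3
    simp only [Complex.real_smul, zero_add, sub_zero] at h3
    rw [mul_smul_conj_im] at h3
    exact lt_irrefl _ h3

end Cluster

/-! ### Operations on clockwise polygons -/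

section ClusterRotation

variable {n : ℕ}

/-- Rotation of the last but one point. -/
theorem cont_clusterGerm_last (hn : 2 ≤ n) {z : Fin (n + 1) → ℂ}
    (hinj : Function.Injective z) (hz : pt n z = 0)
    (hR : ∀ i < n, i ≠ n - 1 → 4 * ‖pt (n - 1) z‖ < ‖pt i z‖) (hT : TriangleFree (n - 1) z) :
    Cont (fun t => twist (n - 1) t t z) 0 1 (confInt 0 n) (clusterGerm (n - 1)) := by
  have h1 := cont_confInt_put_circle (m := n - 1) (by omega) (by omega) hinj hz hR hT
  refine (h1.congr_path zero_le_one fun t _ => conf_ext fun k hk => ?_).congr EventuallyEq.rfl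
    (Eventually.of_forall fun w => ?_)
  · by_cases hk1 : k = n - 1
    · rw [hk1, pt_put_self, pt_twist_self (by omega)]
    · rw [pt_put_of_ne hk (by omega) hk1]
      by_cases hkn : k = n
      · rw [hkn, pt_twist_of_gt (by omega) le_rfl, hz, mul_zero]
      · rw [pt_twist_of_lt (by omega) hk]
  · have : Finset.Ico (n - 1) n = {n - 1} := by
      ext
      simp only [Finset.mem_Ico, Finset.mem_singleton]
      omega
    simp only [loopGerm, clusterGerm, this, Finset.sum_singleton]

/-- Move the point `j` towards the point `0`. -/
theorem ClockwisePolygon.put {j : ℕ} (hj : 1 ≤ j) (hjn : j < n) {z : Fin (n + 1) → ℂ}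
    (h : ClockwisePolygon j z) {u : ℝ} (hu0 : 0 ≤ u) (hu1 : u < 1)
    (hfar : ∀ i < j, pt i z ≠ pt j z + u * (1 - pt j z)) :
    ClockwisePolygon j (put j (pt j z + u * (1 - pt j z)) z) := by
  set a := pt j z with ha
  set b := a + u * (1 - a) with hb
  have hj' : pt j (MultipleLog.put j b z) = b := pt_put_self ..
  have hi : ∀ i ≤ n, i ≠ j → pt i (MultipleLog.put j b z) = pt i z := fun i hi hij =>
    pt_put_of_ne hi hjn.le hij b z
  have hbim : b.im = (1 - u) * a.im := by
    simp [hb]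
    ring
  have haim := h.im_neg j le_rfl hjn
  have hb1 : b - 1 = ((1 - u : ℝ) : ℂ) * (a - 1) := by
    rw [hb]
    push_cast
    ring
  have hone : ∀ l, j < l → l < n → (conj (b - 1) * (pt l z - 1)).im < 0 := by
    intro l h1 h2
    rw [hb1, conj_smul_mul_im]
    exact mul_neg_of_pos_of_neg (by linarith) (h.one_im_neg j l le_rfl h1 h2)
  refine ⟨injective_put hjn.le h.injective fun i h1 h2 => ?_, ?_, ?_, fun k h1 h2 => ?_,
    fun k l h1 h2 h3 => ?_, fun k l h1 h2 h3 => ?_, fun i h1 h2 => ?_⟩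
  · rcases lt_or_gt_of_ne h2 with h3 | h3
    · exact hfar i h3
    · by_cases hin : i = n
      · intro h4
        rw [hin, h.last] at h4
        rw [← h4, Complex.zero_im] at hbim
        nlinarith
      · intro h4
        have h5 := hone i h3 (by omega)
        rw [h4, Complex.conj_mul', ← Complex.ofReal_pow, Complex.ofReal_im] at h5
        exact lt_irrefl _ h5
  · rw [hi 0 (by omega) (by omega), h.zero]
  · rw [hi n le_rfl (by omega), h.last]
  · by_cases hkj : k = j
    · rw [hkj, hj', hbim]
      exact mul_neg_of_pos_of_neg (by linarith) haim
    · rw [hi k h2.le hkj]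
      exact h.im_neg k h1 h2
  · rw [hi l h3.le (by omega)]
    by_cases hkj : k = j
    · rw [hkj, hj']
      exact hone l (by omega) h3
    · rw [hi k (by omega) hkj]
      exact h.one_im_neg k l h1 h2 h3
  · rw [hi l h3.le (by omega)]
    by_cases hkj : k = j
    · subst hkj
      rw [hj', show b = ((1 - u : ℝ) : ℂ) * a + (u : ℂ) * 1 by rw [hb]; push_cast; ring, map_add,
        add_mul, Complex.add_im, conj_smul_mul_im, conj_smul_mul_im, map_one, one_mul]
      have h4 := h.mul_im_neg k l le_rfl h2 h3
      have h5 := h.im_neg l (by omega) h3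
      have h6 : (1 - u) * (conj a * pt l z).im < 0 := mul_neg_of_pos_of_neg (by linarith) h4
      have h7 := mul_nonpos_of_nonneg_of_nonpos hu0 h5.le
      linarith
    · rw [hi k (by omega) hkj]
      exact h.mul_im_neg k l h1 h2 h3
  · rw [hi i (by omega) (by omega), hi 0 (by omega) (by omega)]
    refine fun hh => h.notMem i h1 h2 (convexHull_min ?_ (convex_convexHull ℝ _) hh)
    rintro w (rfl | ⟨k, hk, rfl⟩)
    · exact subset_convexHull ℝ _ (Set.mem_insert _ _)
    · by_cases hkj : k = j
      · subst hkj
        simp only [hj']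
        have h3 : a ∈ insert (pt 0 z) ((fun i => pt i z) '' Set.Icc k n) :=
          Set.mem_insert_of_mem _ ⟨k, hk, rfl⟩
        refine (convex_convexHull ℝ _).segment_subset (subset_convexHull ℝ _ h3)
          (subset_convexHull ℝ _ (Set.mem_insert _ _)) ?_
        rw [segment_eq_image']
        exact ⟨u, ⟨hu0, hu1.le⟩, by simp [hb, h.zero]⟩
      · simp only [hi k hk.2 hkj]
        exact subset_convexHull ℝ _ (Set.mem_insert_of_mem _ ⟨k, hk, rfl⟩)

/-- Drop the point `j`. -/
theorem ClockwisePolygon.succ {j : ℕ} (hjn : j + 1 < n) {z : Fin (n + 1) → ℂ}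
    (h : ClockwisePolygon j z) : ClockwisePolygon (j + 1) z := by
  refine ⟨h.injective, h.zero, h.last, fun k h1 h2 => h.im_neg k (by omega) h2,
    fun k l h1 h2 h3 => h.one_im_neg k l (by omega) h2 h3,
    fun k l h1 h2 h3 => h.mul_im_neg k l (by omega) h2 h3, fun i h1 h2 h3 => ?_⟩
  by_cases hij : i = j
  · subst hij
    -- The remaining vertices other than 1 lie strictly on one side of the line through 1 and the
    -- dropped vertex. An open half plane together with one boundary point is convex, and the
    -- dropped vertex is not in it.
    let S : Set ℂ := {w | w = 1 ∨ (conj (pt i z - 1) * (w - 1)).im < 0}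
    have hS : Convex ℝ S := by
      intro v hv w hw x y hx hy hxy
      have e : (conj (pt i z - 1) * (x • v + y • w - 1)).im =
          x * (conj (pt i z - 1) * (v - 1)).im + y * (conj (pt i z - 1) * (w - 1)).im := by
        rw [← Complex.im_ofReal_mul, ← Complex.im_ofReal_mul, ← Complex.add_im]
        congr 1
        have : (x : ℂ) + y = 1 := by exact_mod_cast hxy
        simp only [Complex.real_smul]
        linear_combination (conj (pt i z - 1)) * this
      have hv' : (conj (pt i z - 1) * (v - 1)).im ≤ 0 := by
        rcases hv with rfl | hv
        · simp
        · exact hv.le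
      have hw' : (conj (pt i z - 1) * (w - 1)).im ≤ 0 := by
        rcases hw with rfl | hw
        · simp
        · exact hw.le
      rcases hx.eq_or_lt with rfl | hx
      · rw [zero_add] at hxy
        simpa [hxy] using hw
      rcases hy.eq_or_lt with rfl | hy
      · rw [add_zero] at hxy
        simpa [hxy] using hv
      by_cases hv1 : v = 1
      · by_cases hw1 : w = 1
        · left
          rw [hv1, hw1, ← add_smul, hxy, one_smul]
        · right
          rw [e]
          have := mul_neg_of_pos_of_neg hy (hw.resolve_left hw1)
          have := mul_nonpos_of_nonneg_of_nonpos hx.le hv'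
          linarith
      · right
        rw [e]
        have := mul_neg_of_pos_of_neg hx (hv.resolve_left hv1)
        have := mul_nonpos_of_nonneg_of_nonpos hy.le hw'
        linarith
    have hsub : insert (pt 0 z) ((fun k => pt k z) '' Set.Icc (i + 1) n) ⊆ S := by
      rintro w (rfl | ⟨k, hk, rfl⟩)
      · exact Or.inl h.zero
      · by_cases hkn : k = n
        · right
          have := h.im_neg i le_rfl (by omega)
          simpa [hkn, h.last] using this
        · have hk1 := hk.1
          have hk2 := hk.2
          exact Or.inr (h.one_im_neg i k le_rfl (by omega) (by omega))
    rcases convexHull_min hsub hS h3 with h4 | h4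
    · have := h.im_neg i le_rfl (by omega)
      rw [h4, Complex.one_im] at this
      exact lt_irrefl _ this
    · rw [Complex.conj_mul', ← Complex.ofReal_pow, Complex.ofReal_im] at h4
      exact lt_irrefl _ h4
  · refine h.notMem i h1 (by omega) (convexHull_mono (Set.insert_subset_insert
      (Set.image_mono (Set.Icc_subset_Icc_left (by omega)))) h3)

end ClusterRotation

/-! ### Rotation of a cluster, one point at a time -/

section ClusterInduction

variable {n : ℕ}

/-- The integral from `0` to `j` does not change when `j` rotates around the origin. -/
theorem cont_confInt_put_contract {j : ℕ} (hj : 1 ≤ j) (hjn : j ≤ n) {z : Fin (n + 1) → ℂ}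
    (hinj : Function.Injective z) (hF : Free 0 j z) {M : ℝ} (hfar : ∀ i < j, M ≤ ‖pt i z‖)
    (hjM : ‖pt j z‖ < M) :
    Cont (fun t => put j (circ t * pt j z) z) 0 1 (confInt 0 j) (confInt 0 j) := by
  let Ψ : ℝ → ℝ → Fin (n + 1) → ℂ := fun s t =>
    put j (pt j z + s * (circ t * pt j z - pt j z)) z
  have hΨ : Continuous (Function.uncurry Ψ) := continuous_put j (by fun_prop) continuous_const
  have hΨz : ∀ s t, circ t = 1 → Ψ s t = z := fun s t h => by
    simp only [Ψ, h, one_mul, sub_self, mul_zero, add_zero, put_self]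
  have hΨ0 : ∀ t, Ψ 0 t = z := fun t => by
    simp only [Ψ, Complex.ofReal_zero, zero_mul, add_zero, put_self]
  have hc0 : AnalyticAt ℂ (confInt 0 j) z := hF.analyticAt (by omega)
  have hne : ∀ s ∈ Set.Icc (0 : ℝ) 1, ∀ t, ∀ i k, 0 ≤ i → i < k → k ≤ j →
      pt i (Ψ s t) ≠ pt k (Ψ s t) := by
    intro s hs t i k _ hik hk
    simp only [Ψ]
    rw [pt_put_of_ne (by omega) hjn (by omega)]
    by_cases hkj : k = j
    · rw [hkj, pt_put_self]
      have := (convex_ball (0 : ℂ) M) (x := pt j z) (y := circ t * pt j z) (by simpa using hjM)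
        (by rw [mem_ball_zero_iff, norm_mul, norm_circ, one_mul]; exact hjM)
        (sub_nonneg.2 hs.2) hs.1 (by ring)
      rw [mem_ball_zero_iff] at this
      intro h
      have h3 := hfar i (by omega)
      rw [h, show pt j z + s * (circ t * pt j z - pt j z) =
        (1 - s) • pt j z + s • (circ t * pt j z) by
          simp only [Complex.real_smul]; push_cast; ring] at h3
      linarith
    · rw [pt_put_of_ne (by omega) hjn hkj]
      exact pt_ne hinj hik.ne (by omega) (by omega)
  have := Cont.homotopy hΨ (f := confInt 0 j) (g := confInt 0 j)
    (fun s _ => by rwa [hΨz s 1 circ_one])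
    (fun s hs => exists_cont_confInt_of_ne (by omega) (hΨ.comp (Continuous.prodMk_right s))
      (fun i k h1 h2 h3 t _ => hne s hs t i k h1 h2 h3) (by
        rwa [hΨz s 0 circ_zero]))
    (by
      rw [funext hΨ0]
      exact Cont.const fun _ _ => hc0)
  refine this.congr_path zero_le_one fun t _ => ?_
  simp [Ψ]

/-- Rotation of all the points from `j` on does not change the integral from `j` to `n`. -/
theorem cont_confInt_twist_diag {j : ℕ} (hjn : j < n) {z : Fin (n + 1) → ℂ} (hF : Free j n z) :
    Cont (fun t => twist j t t z) 0 1 (confInt j n) (confInt j n) := Cont.const fun t _ => by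
  refine Free.analyticAt hjn fun k h3 h4 h5 => ?_
  rw [pt_twist_diag le_rfl hjn.le, pt_twist_diag hjn.le le_rfl,
    pt_twist_diag h3.le h4.le, segment_eq_image'] at h5
  obtain ⟨x, hx, h5⟩ := h5
  refine hF k h3 h4 ?_
  rw [segment_eq_image']
  refine ⟨x, hx, mul_left_cancel₀ (circ_ne_zero t) ?_⟩
  rw [← h5]
  simp only [Complex.real_smul]
  ring

/-- If the point `j` is much closer to the points after it than to the ones before it, then its
rotation followed by the rotation of the later points gives the rotation of all of them. -/
theorem cont_clusterGerm_of_succ {j : ℕ} (hj : 1 ≤ j) (hjn : j < n) {z : Fin (n + 1) → ℂ}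
    (hinj : Function.Injective z) (hF : ClusterFree j z) {M : ℝ}
    (hfar : ∀ i < j, M ≤ ‖pt i z‖) (hjM : ‖pt j z‖ < M)
    (hnear : ∀ k, j < k → k ≤ n → ‖pt k z‖ < ‖pt j z‖)
    (h1 : Cont (fun t => put j (circ t * pt j z) z) 0 1
      (fun w => confInt 0 n w + 2 * Real.pi * Complex.I * (confInt 0 j w * confInt j n w))
      (confInt 0 n))
    (h2 : Cont (fun t => twist (j + 1) t t z) 0 1 (confInt 0 n) (clusterGerm (j + 1))) :
    Cont (fun t => twist j t t z) 0 1 (confInt 0 n) (clusterGerm j) := by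
  let θ : ℝ → Fin (n + 1) → ℂ := fun t => twist j (min (2 * t) 1) (max (2 * t - 1) 0) z
  have hθ : Continuous θ := continuous_twist j (by fun_prop) (by fun_prop) continuous_const
  let Φ : ℝ → ℝ → Fin (n + 1) → ℂ := fun s t =>
    twist j ((1 - s) * t + s * min (2 * t) 1) ((1 - s) * t + s * max (2 * t - 1) 0) z
  have hΦ : Continuous (Function.uncurry Φ) :=
    continuous_twist j (by fun_prop) (by fun_prop) continuous_const
  have hΦr : Continuous (Function.uncurry fun s => Φ (1 - s)) :=
    continuous_twist j (by fun_prop) (by fun_prop) continuous_const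
  have hΦi : ∀ s t, Function.Injective (Φ s t) := fun s t =>
    injective_twist hinj hfar hjM hnear _ _
  have hΦ0 : ∀ s, Φ s 0 = z := fun s => by
    simp only [Φ]
    refine twist_of_circ_eq_one ?_ ?_ z <;> norm_num
  have hΦ1 : ∀ s, Φ s 1 = z := fun s => by
    simp only [Φ]
    refine twist_of_circ_eq_one ?_ ?_ z <;> norm_num
  have hΦθ : ∀ t, Φ 1 t = θ t := fun t => by
    simp [Φ, θ]
  have hΦd : ∀ t, Φ 0 t = twist j t t z := fun t => by
    simp [Φ]
  -- the two halves of the path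
  have hA : ∀ t ∈ Set.Icc (0 : ℝ) (1 / 2), put j (circ (2 * t) * pt j z) z = θ t := by
    intro t ht
    have e1 : min (2 * t) 1 = 2 * t := min_eq_left (by linarith [ht.2])
    have e2 : max (2 * t - 1) 0 = 0 := max_eq_right (by linarith [ht.2])
    refine conf_ext fun k hk => ?_
    simp only [θ, e1, e2]
    rcases lt_trichotomy k j with h | rfl | h
    · rw [pt_put_of_ne hk hjn.le h.ne, pt_twist_of_lt h hk]
    · rw [pt_put_self, pt_twist_self hk]
    · rw [pt_put_of_ne hk hjn.le h.ne', pt_twist_of_gt h hk, circ_zero, one_mul]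
  have hB : ∀ t ∈ Set.Icc (1 / 2 : ℝ) 1, twist (j + 1) (2 * t - 1) (2 * t - 1) z = θ t := by
    intro t ht
    have e1 : min (2 * t) 1 = 1 := min_eq_right (by linarith [ht.1])
    have e2 : max (2 * t - 1) 0 = 2 * t - 1 := max_eq_left (by linarith [ht.1])
    refine conf_ext fun k hk => ?_
    simp only [θ, e1, e2]
    rcases lt_trichotomy k j with h | rfl | h
    · rw [pt_twist_of_lt (by omega) hk, pt_twist_of_lt h hk]
    · rw [pt_twist_of_lt (by omega) hk, pt_twist_self hk, circ_one, one_mul]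
    · rw [pt_twist_diag (by omega) hk, pt_twist_of_gt h hk]
  have f1 : Cont θ 0 (1 / 2)
      (fun w => confInt 0 n w + 2 * Real.pi * Complex.I * (confInt 0 j w * confInt j n w))
      (confInt 0 n) :=
    (h1.comp (τ := fun t => 2 * t) (c := 0) (d := 1 / 2) (by fun_prop)
      (fun t ht => ⟨by linarith [ht.1], by linarith [ht.2]⟩) (by norm_num)
      (by norm_num)).congr_path (by norm_num) hA
  have f2 : Cont θ (1 / 2) 1 (confInt 0 n) (clusterGerm (j + 1)) :=
    (h2.comp (τ := fun t => 2 * t - 1) (c := 1 / 2) (d := 1) (by fun_prop)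
      (fun t ht => ⟨by linarith [ht.1], by linarith [ht.2]⟩) (by norm_num)
      (by norm_num)).congr_path (by norm_num) hB
  -- the integral from `j` to `n`
  obtain ⟨g, g1, g2⟩ : ∃ g, Cont θ 0 (1 / 2) (confInt j n) g ∧ Cont θ (1 / 2) 1 g (confInt j n) := by
    refine Cont.exists_split (by norm_num) (by norm_num) ?_
    have hd : Cont (Φ 0) 0 1 (confInt j n) (confInt j n) := by
      rw [funext hΦd]
      exact cont_confInt_twist_diag hjn (hF.free_right j le_rfl hjn)
    have := cont_confInt_homotopy hjn le_rfl hΦ (fun s _ t _ => hΦi s t)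
      (fun s _ => by
        rw [hΦ0]
        exact hF.free_right j le_rfl hjn)
      (fun s _ => by
        rw [hΦ1]
        exact (hF.free_right j le_rfl hjn).analyticAt hjn) hd
    rwa [funext hΦθ] at this
  -- the integral from `0` to `j`
  have hc0 : AnalyticAt ℂ (confInt 0 j) z := (hF.free_left j le_rfl hjn).analyticAt (by omega)
  have c2 : Cont θ (1 / 2) 1 (confInt 0 j) (confInt 0 j) := Cont.const fun t ht => by
    refine Free.analyticAt (by omega) fun k h3 h4 => ?_
    rw [← hB t ht, pt_twist_of_lt (by omega) (by omega), pt_twist_of_lt (by omega) (by omega),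
      pt_twist_of_lt (by omega) (by omega)]
    exact hF.free_left j le_rfl hjn k h3 h4
  have c1 : Cont θ 0 (1 / 2) (confInt 0 j) (confInt 0 j) := by
    have c := cont_confInt_put_contract hj hjn.le hinj (hF.free_left j le_rfl hjn) hfar hjM
    exact (c.comp (τ := fun t => 2 * t) (c := 0) (d := 1 / 2) (by fun_prop)
      (fun t ht => ⟨by linarith [ht.1], by linarith [ht.2]⟩) (by norm_num)
      (by norm_num)).congr_path (by norm_num) hA
  -- In the first half the correction is carried by the intermediate germ g of the integral from j
  -- to n. In the second half g returns to that integral, because for it the composite rotation is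
  -- homotopic to the rigid one.
  have F1 := f1.add ((c1.mul g1).const_mul (-(2 * Real.pi * Complex.I)))
  have F2 := f2.add ((c2.mul g2).const_mul (-(2 * Real.pi * Complex.I)))
  have F := F1.trans (by norm_num) (by norm_num) F2 hθ.continuousAt
  have F' : Cont θ 0 1 (confInt 0 n) (clusterGerm j) := by
    have e1 : ∀ u v : ℂ, u + 2 * Real.pi * Complex.I * v + -(2 * Real.pi * Complex.I) * v = u :=
      fun u v => by ring
    have e2 : ∀ w : Fin (n + 1) → ℂ, clusterGerm (j + 1) w +
        -(2 * Real.pi * Complex.I) * (confInt 0 j w * confInt j n w) = clusterGerm j w := by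
      intro w
      rw [clusterGerm, clusterGerm, Finset.sum_eq_sum_Ico_succ_bot hjn]
      ring
    simp only [e1, e2] at F
    exact F
  have := cont_confInt_homotopy (a := 0) (b := n) (Φ := fun s => Φ (1 - s)) (g := clusterGerm j)
    (by omega) le_rfl
    hΦr (fun s _ t _ => hΦi _ t)
    (fun s _ => by
      rw [hΦ0]
      exact hF.free)
    (fun s _ => by
      rw [hΦ1]
      exact hF.analyticAt hj hjn)
    (by
      simp only [sub_zero]
      rwa [funext hΦθ])
  simp only [sub_self] at this
  rwa [funext hΦd] at this

/-- Rotation of the points `j, …, n - 1` around the point `n`, when they are so near to the latter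
that the rotation can be done one point at a time. -/
theorem ClockwisePolygon.cont_clusterGerm {j : ℕ} (hj : 1 ≤ j) (hjn : j < n)
    {z : Fin (n + 1) → ℂ} (h : ClockwisePolygon j z) {ρ : ℝ} (hρ : 0 < ρ)
    (hfar : ∀ i < j, ρ ≤ ‖pt i z‖) (hnear : ∀ k, j ≤ k → k < n → ‖pt k z‖ < ρ / 4 ^ (n - j)) :
    Cont (fun t => twist j t t z) 0 1 (confInt 0 n) (clusterGerm j) := by
  induction hd : n - j generalizing j z ρ with
  | zero => omega
  | succ d ih =>
    by_cases hj1 : j + 1 < n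
    swap
    · obtain rfl : j = n - 1 := by omega
      refine cont_clusterGerm_last (by omega) h.injective h.last (fun i h1 h2 => ?_) ⟨?_, ?_⟩
      · have h3 := hfar i (by omega)
        have h4 := hnear (n - 1) le_rfl hjn
        rw [show n - (n - 1) = 1 by omega, pow_one] at h4
        linarith
      · rw [h.zero, h.last]
        exact notMem_segment_one_zero_of_im_ne (h.im_neg _ le_rfl hjn).ne
      · intro i h1 h2 h3 t h4
        refine h.notMem i h2 (by omega) (convexHull_mono ?_ (triangle_subset h4))
        rintro w (rfl | rfl | rfl)
        · exact Set.mem_insert _ _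
        · exact Set.mem_insert_of_mem _ ⟨n - 1, ⟨le_rfl, hjn.le⟩, rfl⟩
        · exact Set.mem_insert_of_mem _ ⟨n, ⟨hjn.le, le_rfl⟩, rfl⟩
    have hρ1 : ρ ≤ 1 := by simpa [h.zero] using hfar 0 (by omega)
    have hnj : n - j = d + 1 := hd
    have hpow1 : ρ / 4 ^ (n - j) = ρ / 4 / 4 ^ (n - (j + 1)) := by
      rw [show n - j = n - (j + 1) + 1 by omega, pow_succ, div_div, mul_comm]
    have hpow2 : ρ / 4 ^ (n - j) ≤ ρ / 16 := by
      refine div_le_div_of_nonneg_left hρ.le (by norm_num) ?_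
      calc (16 : ℝ) = 4 ^ 2 := by norm_num
        _ ≤ 4 ^ (n - j) := pow_le_pow_right₀ (by norm_num) (by omega)
    have hnear' : ∀ k, j ≤ k → k ≤ n → ‖pt k z‖ < ρ / 16 := by
      intro k h1 h2
      rcases h2.eq_or_lt with rfl | h2
      · rw [h.last, norm_zero]
        positivity
      · exact (hnear k h1 h2).trans_le hpow2
    set a := pt j z with ha
    have hanorm : ‖a‖ < ρ / 16 := hnear' j le_rfl hjn.le
    -- Point j is pulled towards the point 1 until its real part is at least 7ρ/16. It stays within
    -- radius ρ, while the later points remain within ρ/16. This gives the separation for rotating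
    -- it by itself.
    let b : ℝ → ℂ := fun s => a + ((s * (ρ / 2) : ℝ) : ℂ) * (1 - a)
    have hbc : Continuous b := by fun_prop
    have hu : ∀ s ∈ Set.Icc (0 : ℝ) 1, 0 ≤ s * (ρ / 2) ∧ s * (ρ / 2) ≤ ρ / 2 := fun s hs =>
      ⟨by have := hs.1; positivity, mul_le_of_le_one_left (by positivity) hs.2⟩
    have hbM : ∀ s ∈ Set.Icc (0 : ℝ) 1, ‖b s‖ < ρ := by
      intro s hs
      have h1 := hu s hs
      have h2 : ‖1 - a‖ ≤ 1 + 1 / 16 := by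
        refine (norm_sub_le _ _).trans ?_
        rw [norm_one]
        linarith
      have h3 : ‖((s * (ρ / 2) : ℝ) : ℂ) * (1 - a)‖ ≤ ρ / 2 * (1 + 1 / 16) := by
        rw [norm_mul, Complex.norm_real, Real.norm_of_nonneg h1.1]
        exact mul_le_mul h1.2 h2 (norm_nonneg _) (by positivity)
      refine (norm_add_le _ _).trans_lt ?_
      linarith
    have hpoly : ∀ s ∈ Set.Icc (0 : ℝ) 1, ClockwisePolygon j (MultipleLog.put j (b s) z) := by
      intro s hs
      have h1 := hu s hs
      refine h.put hj hjn h1.1 (by linarith) fun i hi h2 => ?_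
      have h3 := hfar i hi
      rw [h2] at h3
      exact absurd (hbM s hs) (not_lt.2 h3)
    have h1mem : (1 : ℝ) ∈ Set.Icc (0 : ℝ) 1 := by simp
    set z' := MultipleLog.put j (b 1) z with hz'
    have hz'j : pt j z' = b 1 := pt_put_self ..
    have hz'i : ∀ i ≤ n, i ≠ j → pt i z' = pt i z := fun i hi hij =>
      pt_put_of_ne hi hjn.le hij _ z
    have hP := hpoly 1 h1mem
    have hbre : 7 * ρ / 16 ≤ (b 1).re := by
      have e : (b 1).re = (1 - ρ / 2) * a.re + ρ / 2 := by
        simp [b]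
        ring
      have h1 := Complex.abs_re_le_norm a
      have h2 := neg_abs_le a.re
      have h3 : (1 - ρ / 2) * (-(ρ / 16)) ≤ (1 - ρ / 2) * a.re :=
        mul_le_mul_of_nonneg_left (by linarith) (by linarith)
      rw [e]
      nlinarith
    have hbnorm : 7 * ρ / 16 ≤ ‖pt j z'‖ := by
      rw [hz'j]
      exact hbre.trans (Complex.re_le_norm _)
    have hfar' : ∀ i < j, ρ ≤ ‖pt i z'‖ := fun i hi => by
      rw [hz'i i (by omega) hi.ne]
      exact hfar i hi
    have hnear'' : ∀ k, j < k → k ≤ n → ‖pt k z'‖ < ρ / 16 := fun k h1 h2 => by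
      rw [hz'i k h2 h1.ne']
      exact hnear' k h1.le h2
    have hbM' : ‖pt j z'‖ < ρ := by
      rw [hz'j]
      exact hbM 1 h1mem
    have rot : Cont (fun t => MultipleLog.put j (circ t * pt j z') z') 0 1
        (fun w => confInt 0 n w + 2 * Real.pi * Complex.I * (confInt 0 j w * confInt j n w))
        (confInt 0 n) := by
      refine cont_confInt_put_rotate hj hjn hP.zero hP.last hP.injective (μ := 7 * ρ / 16) (M := ρ)
        (by positivity) (fun k h1 h2 => (hnear'' k h1 h2.le).trans (by linarith))
        (by rwa [hz'j]) hbM' hfar' hP.im_neg (fun k h1 h2 => hP.mul_im_neg j k le_rfl h1 h2)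
        fun i h1 h2 h3 => hP.notMem i h1 h2 (convexHull_mono ?_ h3)
      rintro w (rfl | rfl | rfl)
      · exact Set.mem_insert _ _
      · exact Set.mem_insert_of_mem _ ⟨j, ⟨le_rfl, hjn.le⟩, rfl⟩
      · exact Set.mem_insert_of_mem _ ⟨n, ⟨hjn.le, le_rfl⟩, rfl⟩
    -- Point j, now at distance at least 7ρ/16 ≥ ρ/4, counts as a far point for the smaller cluster;
    -- the powers of 4 are arranged for this loss.
    have rest := ih (by omega) hj1 (hP.succ hj1) (ρ := ρ / 4) (by positivity)
      (fun i hi => by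
        rcases (Nat.lt_succ_iff.1 hi).eq_or_lt with rfl | hi
        · linarith
        · linarith [hfar' i hi])
      (fun k h1 h2 => by
        rw [hz'i k h2.le (by omega), ← hpow1]
        exact hnear k (by omega) h2)
      (by omega)
    have main := cont_clusterGerm_of_succ hj hjn hP.injective (hP.clusterFree hjn) hfar'
      hbM' (fun k h1 h2 => (hnear'' k h1 h2).trans (by linarith)) rot rest
    have hb0 : MultipleLog.put j (b 0) z = z := by
      simp only [b, zero_mul, Complex.ofReal_zero, add_zero]
      exact put_self j z
    have hs1 : ∀ s ∈ Set.Icc (0 : ℝ) 1, 1 - s ∈ Set.Icc (0 : ℝ) 1 := fun s hs =>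
      ⟨by linarith [hs.2], by linarith [hs.1]⟩
    -- Point j is moved back while the whole cluster rotates rigidly; no separation inside the
    -- cluster is needed for that.
    have last := cont_confInt_homotopy (a := 0) (b := n)
      (Φ := fun s t => twist j t t (MultipleLog.put j (b (1 - s)) z)) (g := clusterGerm j)
      (by omega) le_rfl (continuous_twist j (by fun_prop) (by fun_prop)
        (continuous_put j (by fun_prop) continuous_const))
      (fun s hs t _ => injective_twist_diag (hpoly _ (hs1 s hs)).injective (M := ρ)
        (fun i hi => by
          rw [pt_put_of_ne (by omega) hjn.le hi.ne]
          exact hfar i hi)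
        (fun k h1 h2 => by
          by_cases hkj : k = j
          · rw [hkj, pt_put_self]
            exact hbM _ (hs1 s hs)
          · rw [pt_put_of_ne h2 hjn.le hkj]
            linarith [hnear' k h1 h2]) t)
      (fun s hs => by
        rw [twist_of_circ_eq_one circ_zero circ_zero]
        exact ((hpoly _ (hs1 s hs)).clusterFree hjn).free)
      (fun s hs => by
        rw [twist_of_circ_eq_one circ_one circ_one]
        exact ((hpoly _ (hs1 s hs)).clusterFree hjn).analyticAt hj hjn)
      (by simpa only [sub_zero] using main)
    simpa only [sub_self, hb0] using last

end ClusterInduction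

/-! ### Normalizing the segment of integration to run from 1 to 0 -/

section Normalization

variable {n : ℕ}

theorem affine_mem_segment_iff {c d u v w : ℂ} (hc : c ≠ 0) :
    c * u + d ∈ segment ℝ (c * v + d) (c * w + d) ↔ u ∈ segment ℝ v w := by
  rw [segment_eq_image', segment_eq_image']
  refine exists_congr fun t => and_congr_right fun _ => ?_
  simp only [Complex.real_smul]
  constructor
  · intro h
    exact mul_left_cancel₀ hc (by linear_combination h)
  · intro h
    rw [← h]
    ring

/-- The affine image of a configuration where the point `0` becomes `1` and the point `n`
becomes `0`. -/
def normalize (z : Fin (n + 1) → ℂ) : Fin (n + 1) → ℂ :=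
  conf fun k => (pt 0 z - pt n z)⁻¹ * pt k z + -((pt 0 z - pt n z)⁻¹ * pt n z)

theorem pt_normalize {k : ℕ} (hk : k ≤ n) (z : Fin (n + 1) → ℂ) : pt k (normalize z) =
    (pt 0 z - pt n z)⁻¹ * pt k z + -((pt 0 z - pt n z)⁻¹ * pt n z) :=
  pt_conf hk _

theorem pt_normalize_eq_div {k : ℕ} (hk : k ≤ n) (z : Fin (n + 1) → ℂ) : pt k (normalize z) =
    (pt k z - pt n z) / (pt 0 z - pt n z) := by
  rw [pt_normalize hk]
  ring

theorem confInt_normalize {a b : ℕ} (hab : a < b) (hb : b ≤ n) {z : Fin (n + 1) → ℂ}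
    (hz : pt 0 z ≠ pt n z) : confInt a b (normalize z) = confInt a b z := by
  exact (polyInt_congr fun i hi => pt_normalize (by omega) z).trans
    (polyInt_affine (inv_ne_zero (sub_ne_zero.2 hz)))

theorem clusterGerm_normalize {j : ℕ} (hj : 1 ≤ j) (hjn : j < n) {z : Fin (n + 1) → ℂ}
    (hz : pt 0 z ≠ pt n z) : clusterGerm j (normalize z) = clusterGerm j z := by
  rw [clusterGerm, clusterGerm, confInt_normalize (by omega) le_rfl hz]
  congr 2
  refine Finset.sum_congr rfl fun s hs => ?_
  have := Finset.mem_Ico.1 hs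
  rw [confInt_normalize (by omega) (by omega) hz, confInt_normalize (by omega) le_rfl hz]

theorem free_normalize_iff {a b : ℕ} (hb : b ≤ n) {z : Fin (n + 1) → ℂ} (hz : pt 0 z ≠ pt n z) :
    Free a b (normalize z) ↔ Free a b z := by
  refine forall_congr' fun i => imp_congr_right fun h1 => imp_congr_right fun h2 => ?_
  rw [pt_normalize (show i ≤ n by omega), pt_normalize (show a ≤ n by omega), pt_normalize hb,
    affine_mem_segment_iff (inv_ne_zero (sub_ne_zero.2 hz))]

theorem clusterFree_of_normalize {j : ℕ} {z : Fin (n + 1) → ℂ} (hz : pt 0 z ≠ pt n z)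
    (h : ClusterFree j (normalize z)) : ClusterFree j z :=
  ⟨(free_normalize_iff le_rfl hz).1 h.free,
    fun s h1 h2 => (free_normalize_iff h2.le hz).1 (h.free_left s h1 h2),
    fun s h1 h2 => (free_normalize_iff le_rfl hz).1 (h.free_right s h1 h2)⟩

theorem TriangleFree.normalize {m : ℕ} (hm : m ≤ n) {z : Fin (n + 1) → ℂ} (hz : pt 0 z ≠ pt n z)
    (h : TriangleFree m z) : TriangleFree m (normalize z) := by
  have hc := inv_ne_zero (sub_ne_zero.2 hz)
  refine ⟨?_, fun i hi h1 h2 t => ?_⟩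
  · rw [pt_normalize hm, pt_normalize (Nat.zero_le n), pt_normalize (le_refl n),
      affine_mem_segment_iff hc]
    exact h.1
  · rw [pt_normalize hm, pt_normalize (Nat.zero_le n), pt_normalize (le_refl n),
      pt_normalize hi.le]
    convert (affine_mem_segment_iff hc).not.2 (h.2 i hi h1 h2 t) using 3
    ring

theorem TriangleFree.clusterFree (hn : 2 ≤ n) {z : Fin (n + 1) → ℂ}
    (h : TriangleFree (n - 1) z) : ClusterFree (n - 1) z := by
  refine ⟨h.free, fun s h1 h2 => ?_, fun s h1 h2 => ?_⟩
  · obtain rfl : s = n - 1 := by omega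
    exact h.free_left (by omega)
  · obtain rfl : s = n - 1 := by omega
    exact h.free_right (by omega)

theorem analyticAt_normalize {z : Fin (n + 1) → ℂ} (hz : pt 0 z ≠ pt n z) :
    AnalyticAt ℂ normalize z := by
  have h1 : AnalyticAt ℂ (fun z : Fin (n + 1) → ℂ => (pt 0 z - pt n z)⁻¹) z :=
    ((analyticAt_pt 0 z).sub (analyticAt_pt n z)).inv (sub_ne_zero.2 hz)
  exact analyticAt_pi_iff.2 fun i => (h1.mul (analyticAt_pt _ z)).add
    (h1.mul (analyticAt_pt n z)).neg

theorem injective_normalize {z : Fin (n + 1) → ℂ} (hz : pt 0 z ≠ pt n z)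
    (h : Function.Injective z) : Function.Injective (normalize z) :=
  injective_of_pt_ne fun i k hik hk => by
    rw [pt_normalize (by omega), pt_normalize hk]
    intro h'
    exact pt_ne h hik.ne (by omega) hk
      (mul_left_cancel₀ (inv_ne_zero (sub_ne_zero.2 hz)) (add_right_cancel h'))

/-- A condition under which the monodromy of `confInt 0 n` around the divisor where the points
`j, …, n` coincide is known. -/
def ClusterRegion (j : ℕ) (z : Fin (n + 1) → ℂ) : Prop :=
  ClockwisePolygon j (normalize z) ∨ j + 1 = n ∧ TriangleFree j z

theorem ClusterRegion.clusterFree {j : ℕ} (hj : 1 ≤ j) (hjn : j < n) {z : Fin (n + 1) → ℂ}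
    (hz : pt 0 z ≠ pt n z) (h : ClusterRegion j z) : ClusterFree j z := by
  rcases h with h | ⟨rfl, h⟩
  · exact clusterFree_of_normalize hz (h.clusterFree hjn)
  · exact TriangleFree.clusterFree (n := j + 1) (by omega) h

/-- Rotation of the points `j, …, n` around the point `n`. -/
theorem ClusterRegion.cont_clusterGerm {j : ℕ} (hj : 1 ≤ j) (hjn : j < n) {z : Fin (n + 1) → ℂ}
    (hinj : Function.Injective z) (h : ClusterRegion j z) {m η : ℝ} (hη : 0 < η)
    (hηm : 4 ^ (n + 1) * η ≤ m) (hfar : ∀ i < j, m ≤ ‖pt i z‖)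
    (hnear : ∀ k, j ≤ k → k ≤ n → ‖pt k z‖ < η) :
    Cont (fun t => (conf fun k => if k < j then pt k z else
      pt n z + circ t * (pt k z - pt n z) : Fin (n + 1) → ℂ)) 0 1 (confInt 0 n)
      (clusterGerm j) := by
  have hz : pt 0 z ≠ pt n z := pt_ne hinj (by omega) (by omega) le_rfl
  set D := ‖pt 0 z - pt n z‖ with hD
  have hDpos : 0 < D := norm_pos_iff.2 (sub_ne_zero.2 hz)
  have h16 : 16 * η ≤ 4 ^ (n + 1) * η := by
    refine mul_le_mul_of_nonneg_right ?_ hη.le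
    calc (16 : ℝ) = 4 ^ 2 := by norm_num
      _ ≤ 4 ^ (n + 1) := pow_le_pow_right₀ (by norm_num) (by omega)
  have hfar' : ∀ i < j, (m - η) / D ≤ ‖pt i (normalize z)‖ := by
    intro i hi
    rw [pt_normalize_eq_div (by omega), norm_div, ← hD]
    refine div_le_div_of_nonneg_right ?_ hDpos.le
    have := norm_sub_norm_le (pt i z) (pt n z)
    linarith [hfar i hi, hnear n hjn.le le_rfl]
  -- Differences inside the cluster are at most 2η, and 4^(n+1) exceeds 4^(n-j) by a factor of at
  -- least 16, which also absorbs the η lost in m - η.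
  have hnear' : ∀ k, j ≤ k → k < n → ‖pt k (normalize z)‖ < (m - η) / D / 4 ^ (n - j) := by
    intro k h1 h2
    rw [pt_normalize_eq_div (by omega), norm_div, ← hD, div_right_comm]
    refine div_lt_div_of_pos_right ?_ hDpos
    rw [lt_div_iff₀ (by positivity)]
    have e1 : ‖pt k z - pt n z‖ ≤ 2 * η := by
      refine (norm_sub_le _ _).trans ?_
      linarith [hnear k h1 h2.le, hnear n hjn.le le_rfl]
    have e2 : (4 : ℝ) ^ (n - j) * 16 ≤ 4 ^ (n + 1) := by
      calc (4 : ℝ) ^ (n - j) * 16 = 4 ^ (n - j + 2) := by rw [pow_add]; norm_num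
        _ ≤ 4 ^ (n + 1) := pow_le_pow_right₀ (by norm_num) (by omega)
    have e3 : ‖pt k z - pt n z‖ * 4 ^ (n - j) ≤ 2 * η * 4 ^ (n - j) :=
      mul_le_mul_of_nonneg_right e1 (by positivity)
    have e4 := mul_le_mul_of_nonneg_right e2 hη.le
    nlinarith
  have key : Cont (fun t => twist j t t (normalize z)) 0 1 (confInt 0 n) (clusterGerm j) := by
    rcases h with h | ⟨hj1, h⟩
    · exact h.cont_clusterGerm hj hjn (div_pos (by linarith) hDpos) hfar' hnear'
    · obtain rfl : j = n - 1 := by omega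
      refine cont_clusterGerm_last (by omega) (injective_normalize hz hinj) ?_ (fun i h1 h2 => ?_)
        (h.normalize (by omega) hz)
      · rw [pt_normalize_eq_div le_rfl, sub_self, zero_div]
      · have h3 := hfar' i (by omega)
        have h4 := hnear' (n - 1) le_rfl hjn
        rw [show n - (n - 1) = 1 by omega, pow_one] at h4
        linarith
  set Γ : ℝ → Fin (n + 1) → ℂ := fun t => conf fun k => if k < j then pt k z else
      pt n z + circ t * (pt k z - pt n z) with hΓ
  have hΓlt : ∀ t, ∀ k < j, pt k (Γ t) = pt k z := fun t k hk => by
    rw [hΓ, pt_conf (by omega), if_pos hk]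
  have hΓge : ∀ t k, j ≤ k → k ≤ n → pt k (Γ t) = pt n z + circ t * (pt k z - pt n z) :=
    fun t k hk hkn => by
      rw [hΓ, pt_conf hkn, if_neg (by omega)]
  have hΓn : ∀ t, pt n (Γ t) = pt n z := fun t => by
    rw [hΓge t n hjn.le le_rfl, sub_self, mul_zero, add_zero]
  have hΓ0 : ∀ t, pt 0 (Γ t) ≠ pt n (Γ t) := fun t => by
    rwa [hΓlt t 0 (by omega), hΓn]
  have hev : ∀ t, ∀ᶠ w in 𝓝 (Γ t), pt 0 w ≠ pt n w := fun t => by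
    filter_upwards [((continuous_pt 0).sub (continuous_pt n)).continuousAt.eventually_ne
      (sub_ne_zero.2 (hΓ0 t))] with w hw using sub_ne_zero.1 hw
  refine (key.pullback (γ' := Γ) zero_le_one (fun t _ => analyticAt_normalize (hΓ0 t))
    fun t _ => conf_ext fun k hk => ?_).congr ?_ ?_
  · rw [pt_normalize_eq_div hk, hΓlt t 0 (by omega), hΓn]
    by_cases hkj : k < j
    · rw [hΓlt t k hkj, pt_twist_of_lt hkj hk, pt_normalize_eq_div hk]
    · rw [hΓge t k (by omega) hk, pt_twist_diag (by omega) hk, pt_normalize_eq_div hk]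
      ring
  · filter_upwards [hev 0] with w hw using confInt_normalize (by omega) le_rfl hw
  · filter_upwards [hev 1] with w hw using clusterGerm_normalize hj hjn hw

end Normalization

/-! ### Monodromy where a cluster shrinks to the origin -/

section ClusterCollision

variable {n : ℕ}

theorem norm_interpolate_lt {u v c : ℂ} {r s : ℝ} (hs : s ∈ Set.Icc (0 : ℝ) 1) (hu : ‖u - c‖ < r)
    (hv : ‖v - c‖ < r) : ‖(1 - s) * u + s * v - c‖ < r := by
  have := (convex_ball c r) (mem_ball_iff_norm.2 hu) (mem_ball_iff_norm.2 hv)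
    (sub_nonneg.2 hs.2) hs.1 (by ring)
  rw [mem_ball_iff_norm] at this
  simpa only [Complex.real_smul, Complex.ofReal_sub, Complex.ofReal_one] using this

/-- The modulus of an exponential depends only on the real part, which interpolates linearly.
Scaling factors thus stay small when their logarithms are interpolated. -/
theorem norm_exp_interpolate_lt {u v : ℂ} {r s : ℝ} (hs : s ∈ Set.Icc (0 : ℝ) 1) (hr : 0 < r)
    (hu : ‖Complex.exp u‖ < r) (hv : ‖Complex.exp v‖ < r) :
    ‖Complex.exp ((1 - s) * u + s * v)‖ < r := by
  rw [Complex.norm_exp, ← Real.lt_log_iff_exp_lt hr] at hu hv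
  have := (convex_Iio (Real.log r)) hu hv (sub_nonneg.2 hs.2) hs.1 (by ring)
  rw [Complex.norm_exp, ← Real.lt_log_iff_exp_lt hr, Complex.add_re,
    show (1 - (s : ℂ)) = ((1 - s : ℝ) : ℂ) by push_cast; rfl, Complex.re_ofReal_mul,
    Complex.re_ofReal_mul]
  exact this

/-- The configuration whose points from `j` on are multiplied by `h`. -/
def scaleFrom (j : ℕ) (h : ℂ) (f : ℕ → ℂ) : Fin (n + 1) → ℂ :=
  conf fun k => if k < j then f k else h * f k

theorem pt_scaleFrom_of_lt {j k : ℕ} (hk : k < j) (hkn : k ≤ n) (h : ℂ) (f : ℕ → ℂ) :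
    pt k (scaleFrom j h f : Fin (n + 1) → ℂ) = f k := by
  rw [scaleFrom, pt_conf hkn, if_pos hk]

theorem pt_scaleFrom_of_le {j k : ℕ} (hk : j ≤ k) (hkn : k ≤ n) (h : ℂ) (f : ℕ → ℂ) :
    pt k (scaleFrom j h f : Fin (n + 1) → ℂ) = h * f k := by
  rw [scaleFrom, pt_conf hkn, if_neg (by omega)]

/-- Uniform bounds for the limiting shape: d separates the far points from 0 and from each other,
and the cluster coefficients from each other; S bounds all coefficients with a margin d. -/
theorem exists_cluster_constants (j : ℕ) {a : ℕ → ℂ}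
    (h1 : ∀ i < j, i ≤ n → a i ≠ 0)
    (h2 : ∀ i k, i < k → k ≤ n → (k < j ∨ j ≤ i) → a i ≠ a k) :
    ∃ d S : ℝ, 0 < d ∧ 0 < S ∧ (∀ i < j, i ≤ n → d ≤ ‖a i‖) ∧
      (∀ i k, i < k → k ≤ n → (k < j ∨ j ≤ i) → d ≤ dist (a i) (a k)) ∧
      ∀ k ≤ n, ‖a k‖ + d ≤ S := by
  have e1 : ∀ᶠ d : ℝ in 𝓝[>] 0, ∀ i ∈ Finset.range (n + 1), i < j → d ≤ ‖a i‖ :=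
    (Finset.eventually_all _).2 fun i hi => by
      by_cases hij : i < j
      · filter_upwards [(eventually_le_nhds (norm_pos_iff.2
          (h1 i hij (by simpa [Nat.lt_succ_iff] using hi)))).filter_mono nhdsWithin_le_nhds]
          with d hd _ using hd
      · exact Eventually.of_forall fun _ h => absurd h hij
  have e2 : ∀ᶠ d : ℝ in 𝓝[>] 0, ∀ k ∈ Finset.range (n + 1), ∀ i ∈ Finset.range k,
      (k < j ∨ j ≤ i) → d ≤ dist (a i) (a k) :=
    (Finset.eventually_all _).2 fun k hk => (Finset.eventually_all _).2 fun i hi => by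
      by_cases hij : k < j ∨ j ≤ i
      · filter_upwards [(eventually_le_nhds (dist_pos.2 (h2 i k (Finset.mem_range.1 hi)
          (by simpa [Nat.lt_succ_iff] using hk) hij))).filter_mono nhdsWithin_le_nhds]
          with d hd _ using hd
      · exact Eventually.of_forall fun _ h => absurd h hij
  obtain ⟨d, hd1, hd2, hd⟩ := (e1.and (e2.and self_mem_nhdsWithin)).exists
  have hd' : (0 : ℝ) < d := hd
  refine ⟨d, ∑ k ∈ Finset.range (n + 1), ‖a k‖ + d, hd', ?_, fun i hi hin =>
    hd1 i (Finset.mem_range.2 (by omega)) hi, fun i k hik hk =>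
    hd2 k (Finset.mem_range.2 (by omega)) i (Finset.mem_range.2 hik), fun k hk => ?_⟩
  · exact add_pos_of_nonneg_of_pos (Finset.sum_nonneg fun _ _ => norm_nonneg _) hd'
  · have := Finset.single_le_sum (f := fun k => ‖a k‖) (fun _ _ => norm_nonneg _)
      (Finset.mem_range.2 (Nat.lt_succ_iff.2 hk))
    simpa using this

/-- Monodromy of `confInt 0 n` around a divisor where the points `j, …, n` coincide. -/
theorem cont_confInt_cluster {j : ℕ} (hj : 1 ≤ j) (hjn : j < n) {h : ℂ → ℂ} {σ : ℕ → ℂ → ℂ}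
    (hh : Continuous h) (hσ : ∀ k, Continuous (σ k)) (hh0 : h 0 = 0)
    (hh1 : ∀ z, ‖z‖ ≤ 1 → z ≠ 0 → h z ≠ 0) (hσ1 : ∀ i < j, i ≤ n → σ i 0 ≠ 0)
    (hσ2 : ∀ i k, i < k → k ≤ n → (k < j ∨ j ≤ i) → σ i 0 ≠ σ k 0)
    {ψ : ℂ → Fin (n + 1) → ℂ} (hψ : ∀ z, ψ z = scaleFrom j (h z) fun k => σ k z)
    (hinj : ∀ z, ‖z‖ ≤ 1 → z ≠ 0 → Function.Injective (ψ z))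
    (hreg : ∀ r : ℝ, 0 < r → r ≤ 1 → ClusterRegion j (ψ r))
    {l : ℝ → ℂ} (hl : Continuous l)
    (hlexp : ∀ t ∈ Set.Icc (0 : ℝ) 1, Complex.exp (l t) = h (circ t))
    (hl1 : l 1 - l 0 = 2 * Real.pi * Complex.I) :
    Cont (fun t => ψ (circ t)) 0 1 (confInt 0 n) (clusterGerm j) := by
  have hψlt : ∀ z, ∀ k < j, pt k (ψ z) = σ k z := fun z k hk => by
    rw [hψ, pt_scaleFrom_of_lt hk (by omega)]
  have hψge : ∀ z k, j ≤ k → k ≤ n → pt k (ψ z) = h z * σ k z := fun z k hk hkn => by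
    rw [hψ, pt_scaleFrom_of_le hk hkn]
  have hψc : Continuous ψ := by
    rw [funext hψ]
    refine continuous_conf fun k => ?_
    have := hσ k
    split_ifs <;> fun_prop
  have hψ0n : ∀ r : ℝ, 0 < r → r ≤ 1 → pt 0 (ψ r) ≠ pt n (ψ r) := fun r hr hr1 =>
    pt_ne (hinj _ (by rw [Complex.norm_real, Real.norm_of_nonneg hr.le]; exact hr1)
      (by exact_mod_cast hr.ne')) (by omega) (by omega) le_rfl
  have hfree : ∀ r : ℝ, 0 < r → r ≤ 1 → ClusterFree j (ψ r) := fun r hr hr1 =>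
    (hreg r hr hr1).clusterFree hj hjn (hψ0n r hr hr1)
  -- a small radius
  obtain ⟨d, S, hd, hS, hd1, hd2, hS1⟩ := exists_cluster_constants (n := n) j hσ1 hσ2
  have h4 : (0 : ℝ) < 4 ^ (n + 1) := by positivity
  have h16 : (16 : ℝ) ≤ 4 ^ (n + 1) := by
    calc (16 : ℝ) = 4 ^ 2 := by norm_num
      _ ≤ 4 ^ (n + 1) := pow_le_pow_right₀ (by norm_num) (by omega)
  -- The cluster must have size below η while far points have modulus at least d/2 = 4^(n+1)·η, as
  -- the rotation theorem requires. The radius is then chosen with the scaling factor below η/S.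
  set η : ℝ := d / 2 / 4 ^ (n + 1) with hη
  have hηpos : 0 < η := by positivity
  have hηd : 4 ^ (n + 1) * η = d / 2 := by
    rw [hη]
    field_simp
  have hη16 : 16 * η ≤ d / 2 := hηd ▸ mul_le_mul_of_nonneg_right h16 hηpos.le
  obtain ⟨ρ, hρ0, hρ1, hρh, hρσ⟩ : ∃ ρ : ℝ, 0 < ρ ∧ ρ ≤ 1 ∧
      (∀ t, ‖h (ρ * circ t)‖ < η / S) ∧ ∀ k ≤ n, ∀ t, ‖σ k (ρ * circ t) - σ k 0‖ < d / 8 := by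
    have e1 : ∀ᶠ w in 𝓝 (0 : ℂ), ‖h w‖ < η / S :=
      hh.norm.continuousAt.eventually_lt_const (by simpa [hh0] using div_pos hηpos hS)
    have e2 : ∀ᶠ w in 𝓝 (0 : ℂ), ∀ k ∈ Finset.range (n + 1), ‖σ k w - σ k 0‖ < d / 8 :=
      (Finset.eventually_all _).2 fun k _ =>
        ((hσ k).sub continuous_const).norm.continuousAt.eventually_lt_const
          (by simpa using hd)
    obtain ⟨δ, hδ, hδw⟩ := Metric.eventually_nhds_iff.1 (e1.and e2)
    have hρ : (0 : ℝ) < min 1 (δ / 2) := by positivity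
    have hn : ∀ t, dist (((min 1 (δ / 2) : ℝ) : ℂ) * circ t) 0 < δ := fun t => by
      rw [dist_zero_right, norm_mul, norm_circ, mul_one, Complex.norm_real,
        Real.norm_of_nonneg hρ.le]
      exact (min_le_right _ _).trans_lt (by linarith)
    exact ⟨_, hρ, min_le_left _ _, fun t => (hδw (hn t)).1, fun k hk t =>
      (hδw (hn t)).2 k (Finset.mem_range.2 (by omega))⟩
  have hη' : 0 < η / S := by positivity
  set ξ := ψ ρ with hξ
  have hρσ0 : ∀ k ≤ n, ‖σ k ρ - σ k 0‖ < d / 8 := fun k hk => by simpa using hρσ k hk 0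
  have hρh0 : ‖h ρ‖ < η / S := by simpa using hρh 0
  have hprod : ∀ k ≤ n, ∀ u v : ℂ, ‖u‖ < η / S → ‖v - σ k 0‖ < d / 8 → ‖u * v‖ < η := by
    intro k hk u v hu hv
    have hv' : ‖v‖ ≤ S := by
      have := norm_sub_norm_le v (σ k 0)
      linarith [hS1 k hk]
    rw [norm_mul]
    calc ‖u‖ * ‖v‖ ≤ ‖u‖ * S := mul_le_mul_of_nonneg_left hv' (norm_nonneg _)
      _ < η / S * S := mul_lt_mul_of_pos_right hu hS
      _ = η := div_mul_cancel₀ _ hS.ne'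
  have hfar : ∀ i < j, i ≤ n → ∀ v, ‖v - σ i 0‖ < d / 8 → d / 2 ≤ ‖v‖ := by
    intro i hi hin v hv
    have := norm_sub_norm_le (σ i 0) v
    rw [norm_sub_rev] at hv
    linarith [hd1 i hi hin]
  have hξinj : Function.Injective ξ := hinj _
    (by rw [Complex.norm_real, Real.norm_of_nonneg hρ0.le]; exact hρ1) (by exact_mod_cast hρ0.ne')
  have hξnear : ∀ k, j ≤ k → k ≤ n → ‖pt k ξ‖ < η := fun k h1 h2 => by
    rw [hξ, hψge _ k h1 h2]
    exact hprod k h2 _ _ hρh0 (hρσ0 k h2)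
  have step1 := (hreg ρ hρ0 hρ1).cont_clusterGerm hj hjn hξinj hηpos hηd.le
    (fun i hi => by
      rw [hψlt _ i hi]
      exact hfar i hi (by omega) _ (hρσ0 i (by omega))) hξnear
  -- the radius as a function of a parameter
  let rad : ℝ → ℝ := fun u => ρ + (Set.projIcc (0 : ℝ) 1 zero_le_one u : ℝ) * (1 - ρ)
  have hrad : Continuous rad :=
    continuous_const.add ((continuous_subtype_val.comp continuous_projIcc).mul continuous_const)
  have hrad0 : rad 0 = ρ := by simp [rad]
  have hrad1 : rad 1 = 1 := by simp [rad]
  have hradpos : ∀ u, 0 < rad u ∧ rad u ≤ 1 := by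
    intro u
    have h1 := (Set.projIcc (0 : ℝ) 1 zero_le_one u).2
    constructor
    · have := mul_nonneg h1.1 (sub_nonneg.2 hρ1)
      simp only [rad]
      linarith
    · have := mul_le_of_le_one_left (sub_nonneg.2 hρ1) h1.2
      simp only [rad]
      linarith
  have hz : ∀ u t, ‖(rad u : ℂ) * circ t‖ ≤ 1 ∧ (rad u : ℂ) * circ t ≠ 0 := by
    intro u t
    constructor
    · rw [norm_mul, norm_circ, mul_one, Complex.norm_real, Real.norm_of_nonneg (hradpos u).1.le]
      exact (hradpos u).2
    · exact mul_ne_zero (by exact_mod_cast (hradpos u).1.ne') (circ_ne_zero t)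
  -- the logarithm of the scaling factor
  obtain ⟨L, hL, hLexp⟩ := exists_log_of_ne_zero
    (H := fun x : ℝ × ℝ => h ((rad x.1 : ℂ) * circ x.2)) (hh.comp (by fun_prop))
    fun x => hh1 _ (hz x.1 x.2).1 (hz x.1 x.2).2
  have hL1 : L (0, 1) - L (0, 0) = 2 * Real.pi * Complex.I := by
    have e1 := sub_eq_sub_of_exp_eq (A := unitInterval) (l := fun t => L (1, (t : ℝ)))
      (l' := fun t => l t) (by fun_prop) (by fun_prop) (fun t => by
        rw [hLexp, hlexp t t.2]
        simp [hrad1]) 1 0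
    simp only [Set.Icc.coe_one, Set.Icc.coe_zero] at e1
    have e2 := sub_eq_sub_of_exp_eq (A := ℝ) (l := fun u => L (u, 1)) (l' := fun u => L (u, 0))
      (by fun_prop) (by fun_prop) (fun u => by simp [hLexp]) 0 1
    linear_combination e2 + e1 + hl1
  have hL0 : Complex.exp (L (0, 0)) = h ρ := by
    rw [hLexp]
    simp [hrad0]
  -- straightening the small loop
  let P : ℕ → ℝ → ℝ → ℂ := fun k s t => (1 - s) * σ k ρ + s * σ k (ρ * circ t)
  let E : ℝ → ℝ → ℂ := fun s t =>
    Complex.exp ((1 - s) * (L (0, 0) + 2 * Real.pi * Complex.I * t) + s * L (0, t))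
  -- This translation reconciles the two centres: the model rotates the cluster around its point n,
  -- the loop multiplies it by h, which rotates it around 0.
  let C : ℝ → ℝ → ℂ := fun s t => (1 - s) * (pt n ξ * (1 - circ t))
  let Φ : ℝ → ℝ → Fin (n + 1) → ℂ := fun s t =>
    conf fun k => if k < j then P k s t else E s t * P k s t + C s t
  have hΦlt : ∀ s t, ∀ k < j, pt k (Φ s t) = P k s t := fun s t k hk => by
    rw [pt_conf (by omega), if_pos hk]
  have hΦge : ∀ s t k, j ≤ k → k ≤ n → pt k (Φ s t) = E s t * P k s t + C s t :=
    fun s t k hk hkn => by rw [pt_conf hkn, if_neg (by omega)]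
  have hΦ : Continuous (Function.uncurry Φ) := by
    refine continuous_conf (f := fun (x : ℝ × ℝ) k => if k < j then P k x.1 x.2 else
      E x.1 x.2 * P k x.1 x.2 + C x.1 x.2) fun k => ?_
    have hP : Continuous fun x : ℝ × ℝ => P k x.1 x.2 := by
      have : Continuous fun x : ℝ × ℝ => σ k (ρ * circ x.2) := (hσ k).comp (by fun_prop)
      fun_prop
    have hE : Continuous fun x : ℝ × ℝ => E x.1 x.2 := by fun_prop
    have hC : Continuous fun x : ℝ × ℝ => C x.1 x.2 := by fun_prop
    split_ifs
    · exact hP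
    · exact (hE.mul hP).add hC
  have hΦξ : ∀ s t, circ t = 1 → E s t = h ρ → Φ s t = ξ := fun s t h1 h2 =>
    conf_ext fun k hk => by
      have hP : P k s t = σ k ρ := by
        simp only [P, h1, mul_one]
        ring
      by_cases hkj : k < j
      · rw [hΦlt _ _ k hkj, hP, hξ, hψlt _ k hkj]
      · rw [hΦge _ _ k (by omega) hk, hP, h2, hξ, hψge _ k (by omega) hk]
        simp [C, h1]
  have hstart : ∀ s, Φ s 0 = ξ := fun s => hΦξ s 0 circ_zero (by
    simp only [E]
    rw [← hL0]
    congr 1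
    push_cast
    ring)
  have hend : ∀ s, Φ s 1 = ξ := fun s => hΦξ s 1 circ_one (by
    simp only [E]
    rw [show (1 - (s : ℂ)) * (L (0, 0) + 2 * Real.pi * Complex.I * ((1 : ℝ) : ℂ)) + s * L (0, 1) =
      L (0, 0) + 2 * Real.pi * Complex.I by
        push_cast
        linear_combination (s : ℂ) * hL1, Complex.exp_add, Complex.exp_two_pi_mul_I, hL0, mul_one])
  have hPnear : ∀ k ≤ n, ∀ s ∈ Set.Icc (0 : ℝ) 1, ∀ t, ‖P k s t - σ k 0‖ < d / 8 :=
    fun k hk s hs t => norm_interpolate_lt hs (hρσ0 k hk) (hρσ k hk t)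
  have hEnorm : ∀ s ∈ Set.Icc (0 : ℝ) 1, ∀ t, ‖E s t‖ < η / S := by
    intro s hs t
    refine norm_exp_interpolate_lt hs hη' ?_ ?_
    · rw [Complex.exp_add, hL0, ← circ, norm_mul, norm_circ, mul_one]
      exact hρh0
    · rw [hLexp, hrad0]
      exact hρh t
  have hCnorm : ∀ s ∈ Set.Icc (0 : ℝ) 1, ∀ t, ‖C s t‖ ≤ 2 * η := by
    intro s hs t
    have e1 : ‖1 - (s : ℂ)‖ ≤ 1 := by
      rw [← Complex.ofReal_one, ← Complex.ofReal_sub, Complex.norm_real,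
        Real.norm_of_nonneg (sub_nonneg.2 hs.2)]
      linarith [hs.1]
    have e2 : ‖1 - circ t‖ ≤ 2 := by
      refine (norm_sub_le _ _).trans ?_
      rw [norm_one, norm_circ]
      norm_num
    have e3 : ‖pt n ξ * (1 - circ t)‖ ≤ η * 2 := by
      rw [norm_mul]
      exact mul_le_mul (hξnear n hjn.le le_rfl).le e2 (norm_nonneg _) hηpos.le
    rw [norm_mul]
    linarith [(mul_le_of_le_one_left (norm_nonneg _) e1).trans e3]
  have hsep : ∀ i k, i < k → k ≤ n → (k < j ∨ j ≤ i) → ∀ s ∈ Set.Icc (0 : ℝ) 1, ∀ t,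
      P i s t ≠ P k s t := by
    intro i k hik hk hc s hs t h1
    have e1 := hPnear i (by omega) s hs t
    have e2 := hPnear k hk s hs t
    have e3 := hd2 i k hik hk hc
    have e4 := dist_triangle (σ i 0) (P i s t) (σ k 0)
    rw [h1] at e1 e4
    rw [← dist_eq_norm] at e1 e2
    rw [dist_comm] at e1
    linarith
  have hΦinj : ∀ s ∈ Set.Icc (0 : ℝ) 1, ∀ t ∈ Set.Icc (0 : ℝ) 1, Function.Injective (Φ s t) := by
    intro s hs t _
    refine injective_of_pt_ne fun i k hik hk => ?_
    by_cases hi : i < j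
    · rw [hΦlt _ _ i hi]
      by_cases hkj : k < j
      · rw [hΦlt _ _ k hkj]
        exact hsep i k hik hk (Or.inl hkj) s hs t
      · rw [hΦge _ _ k (by omega) hk]
        intro h1
        have e1 := hfar i hi (by omega) _ (hPnear i (by omega) s hs t)
        rw [h1] at e1
        have e2 := norm_add_le (E s t * P k s t) (C s t)
        have e3 := hprod k hk _ _ (hEnorm s hs t) (hPnear k hk s hs t)
        linarith [hCnorm s hs t]
    · rw [hΦge _ _ i (by omega) (by omega), hΦge _ _ k (by omega) hk]
      intro h1
      exact hsep i k hik hk (Or.inr (by omega)) s hs t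
        (mul_left_cancel₀ (Complex.exp_ne_zero _) (add_right_cancel h1))
  have step2 : Cont (Φ 1) 0 1 (confInt 0 n) (clusterGerm j) := by
    refine cont_confInt_homotopy (by omega) le_rfl hΦ hΦinj (fun s _ => ?_) (fun s _ => ?_) ?_
    · rw [hstart]
      exact (hfree ρ hρ0 hρ1).free
    · rw [hend]
      exact (hfree ρ hρ0 hρ1).analyticAt hj hjn
    · refine step1.congr_path zero_le_one fun t _ => conf_ext fun k hk => ?_
      have hP : P k 0 t = σ k ρ := by simp [P]
      have hE : E 0 t = h ρ * circ t := by
        simp only [E]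
        rw [circ, ← hL0, ← Complex.exp_add]
        congr 1
        push_cast
        ring
      by_cases hkj : k < j
      · rw [pt_conf hk, if_pos hkj, hΦlt _ _ k hkj, hP, hψlt _ k hkj]
      · rw [pt_conf hk, if_neg hkj, hΦge _ _ k (by omega) hk, hP, hE, hψge _ k (by omega) hk]
        simp only [C, hξ, hψge _ n hjn.le le_rfl]
        push_cast
        ring
  -- the radial homotopy
  have step3 := cont_confInt_homotopy (a := 0) (b := n) (Φ := fun s t => ψ ((rad s : ℂ) * circ t))
    (g := clusterGerm j) (by omega) le_rfl (hψc.comp (by fun_prop))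
    (fun s _ t _ => hinj _ (hz s t).1 (hz s t).2)
    (fun s _ => by
      rw [circ_zero, mul_one]
      exact (hfree _ (hradpos s).1 (hradpos s).2).free)
    (fun s _ => by
      rw [circ_one, mul_one]
      exact (hfree _ (hradpos s).1 (hradpos s).2).analyticAt hj hjn)
    (by
      refine step2.congr_path zero_le_one fun t _ => conf_ext fun k hk => ?_
      have hP : P k 1 t = σ k (ρ * circ t) := by simp [P]
      have hE : E 1 t = h (ρ * circ t) := by
        simp only [E]
        rw [show (1 - ((1 : ℝ) : ℂ)) * (L (0, 0) + 2 * Real.pi * Complex.I * t) +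
          ((1 : ℝ) : ℂ) * L (0, t) = L (0, t) by push_cast; ring, hLexp]
        simp [hrad0]
      rw [hrad0]
      by_cases hkj : k < j
      · rw [hΦlt _ _ k hkj, hP, hψlt _ k hkj]
      · rw [hΦge _ _ k (by omega) hk, hP, hE, hψge _ k (by omega) hk]
        simp [C])
  simpa [hrad1] using step3

end ClusterCollision

/-! ### The divisor x_j = 0 -/

section Polygon

variable {n : ℕ}

/-- Orientation is invariant under complex affine maps, and conj V · W is |V|² · (W/V). This turns
the quotient condition into the polynomial one used for polygons. -/
theorem Clockwise.conj_mul_im_neg {c d u v w : ℂ} (hc : c ≠ 0) (h : Clockwise u v w) :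
    (conj (c * v + d - (c * u + d)) * (c * w + d - (c * u + d))).im < 0 := by
  have e : (w - u) / (v - u) = (c * w + d - (c * u + d)) / (c * v + d - (c * u + d)) := by
    rw [show c * w + d - (c * u + d) = c * (w - u) by ring,
      show c * v + d - (c * u + d) = c * (v - u) by ring, mul_div_mul_left _ _ hc]
  rw [Clockwise, e] at h
  generalize c * w + d - (c * u + d) = W at *
  generalize c * v + d - (c * u + d) = V at *
  have hV : V ≠ 0 := by
    rintro rfl
    simp at h
  have e2 : conj V * W = ((Complex.normSq V : ℝ) : ℂ) * (W / V) := by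
    rw [← Complex.mul_conj]
    field_simp
  rw [e2, Complex.im_ofReal_mul]
  exact mul_neg_of_pos_of_neg (Complex.normSq_pos.2 hV) h

theorem convex_affine_preimage {K : Set ℂ} (hK : Convex ℝ K) (c d : ℂ) :
    Convex ℝ {w | c * w + d ∈ K} := by
  intro x hx y hy a b ha hb hab
  have := hK hx hy ha hb hab
  rw [Set.mem_ofPred_eq]
  convert this using 1
  have h1 : (a : ℂ) + b = 1 := by exact_mod_cast hab
  simp only [Complex.real_smul]
  linear_combination -d * h1

/-- For j = n - 1 the orientation is not given, but a single point rotating around v_n only needs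
the triangle condition. Otherwise the polygon is carried over by the normalizing affine map. -/
theorem clusterRegion_prodConf {j : ℕ} (hj : 1 ≤ j) (hjn : j < n) {x : Fin n → ℂ}
    (hx : x ∈ regularSet n) (h : x ∈ polygonRegion n j) : ClusterRegion j (prodConf x) := by
  obtain ⟨h1, h2, h3⟩ := h
  by_cases hj1 : j + 1 < n
  swap
  · obtain rfl : j = n - 1 := by omega
    refine Or.inr ⟨by omega, ?_, fun i hi hi1 hij t hmem => ?_⟩
    · rw [pt_prodConf hjn.le, pt_prodConf (Nat.zero_le n), pt_prodConf (le_refl n)]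
      exact h1
    · rw [pt_prodConf hjn.le, pt_prodConf (Nat.zero_le n), pt_prodConf (le_refl n),
        pt_prodConf hi.le] at hmem
      refine h3 i hi1 (by omega) (convexHull_mono ?_ (triangle_subset hmem))
      rintro w (rfl | rfl | rfl)
      · exact Set.mem_insert _ _
      · exact Set.mem_insert_of_mem _ ⟨n - 1, ⟨le_rfl, hjn.le⟩, rfl⟩
      · exact Set.mem_insert_of_mem _ ⟨n, ⟨hjn.le, le_rfl⟩, rfl⟩
  left
  set z := prodConf x with hz
  have hzk : ∀ k ≤ n, pt k z = partialProd x k := fun k hk => pt_prodConf hk x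
  have hinj : Function.Injective z := injective_prodConf hx
  have h0n : pt 0 z ≠ pt n z := pt_ne hinj (by omega) (by omega) le_rfl
  have hD : pt 0 z - pt n z ≠ 0 := sub_ne_zero.2 h0n
  have hzero : pt 0 (normalize z) = 1 := by
    rw [pt_normalize_eq_div (Nat.zero_le n), div_self hD]
  have hlast : pt n (normalize z) = 0 := by
    rw [pt_normalize_eq_div le_rfl, sub_self, zero_div]
  have hcl : ∀ a b c, (a = 0 ∨ j ≤ a) → j ≤ b → a < b → b < c → c ≤ n →
      (conj (pt b (normalize z) - pt a (normalize z)) *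
        (pt c (normalize z) - pt a (normalize z))).im < 0 := by
    intro a b c ha hb hab hbc hc
    have := h2 hj1 a b c ha hb hab hbc hc
    rw [← hzk a (by omega), ← hzk b (by omega), ← hzk c hc] at this
    rw [pt_normalize (show a ≤ n by omega), pt_normalize (show b ≤ n by omega), pt_normalize hc]
    exact this.conj_mul_im_neg (inv_ne_zero hD)
  refine ⟨injective_normalize h0n hinj, hzero, hlast, fun k hk hkn => ?_,
    fun k l hk hkl hl => ?_, fun k l hk hkl hl => ?_, fun i hi hij hmem => ?_⟩
  · have := hcl 0 k n (Or.inl rfl) hk (by omega) hkn le_rfl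
    rw [hzero, hlast] at this
    simpa using this
  · have := hcl 0 k l (Or.inl rfl) hk (by omega) hkl hl.le
    rwa [hzero] at this
  · have := hcl k l n (Or.inr hk) (by omega) hkl hl le_rfl
    rw [hlast] at this
    simp only [map_sub, Complex.mul_im, Complex.sub_re, Complex.sub_im, Complex.conj_re,
      Complex.conj_im, Complex.zero_re, Complex.zero_im] at this ⊢
    linarith
  · have hback : ∀ k ≤ n, (pt 0 z - pt n z) * pt k (normalize z) + pt n z = partialProd x k := by
      intro k hk
      rw [pt_normalize_eq_div hk, mul_div_cancel₀ _ hD, sub_add_cancel, hzk k hk]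
    have hsub := convexHull_min (?_ : _ ⊆ {w | (pt 0 z - pt n z) * w + pt n z ∈ convexHull ℝ
      (insert (partialProd x 0) (partialProd x '' Set.Icc j n))})
      (convex_affine_preimage (convex_convexHull ℝ _) _ _) hmem
    · rw [Set.mem_ofPred_eq, hback i (by omega)] at hsub
      exact h3 i hi hij hsub
    · rintro w (rfl | ⟨k, hk, rfl⟩)
      · rw [Set.mem_ofPred_eq, hback 0 (by omega)]
        exact subset_convexHull ℝ _ (Set.mem_insert _ _)
      · rw [Set.mem_ofPred_eq, hback k hk.2]
        exact subset_convexHull ℝ _ (Set.mem_insert_of_mem _ ⟨k, hk, rfl⟩)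

theorem block_ne_zero {x : Fin n → ℂ} {a b : ℕ} (h : ∀ i, a ≤ i → i ≤ b → block x i i ≠ 0) :
    block x a b ≠ 0 := by
  rw [block, Finset.prod_ne_zero_iff]
  intro i hi
  have hi' := (Finset.mem_filter.1 hi).2
  have := h (i + 1) hi'.1 hi'.2
  rw [block, Finset.prod_ne_zero_iff] at this
  exact this i (by simp)

theorem block_ne_block {x : Fin n → ℂ} {a b c : ℕ} (hab : a ≤ b + 1) (hbc : b < c)
    (h0 : block x a b ≠ 0) (h1 : (Component.one (b + 1) c).eqn x ≠ 0) :
    block x a b ≠ block x a c := by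
  intro h
  rw [← block_mul_block x hab hbc.le] at h
  exact h1 (by rw [Component.eqn, ← mul_left_cancel₀ h0 ((mul_one _).trans h), sub_self])

/-- Continuation along a loop which turns once around `x_j = 0`. -/
theorem cont_around_zero {j : ℕ} (hj : 1 ≤ j) (hjn : j < n) {x : Fin n → ℂ} {q : Path x x}
    (h : TurnsOnceAround (Component.zero j) (polygonRegion n j) q) :
    Cont (fun t : ℝ => q (Set.projIcc 0 1 zero_le_one t)) 0 1 (intF 1 n) (fun z =>
      intF 1 n z - 2 * Real.pi * Complex.I *
        ∑ s ∈ Finset.Icc j (n - 1), intF 1 s z * intF (s + 1) n z) := by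
  obtain ⟨φ, l, hφ, hl, hreg, h0, hw, hD, hA, hq, hlexp, hl1⟩ := h.exists_extension
  have hcb : ∀ a b, Continuous fun z => block (φ z) a b := fun a b =>
    (continuous_iff_continuousAt.2 fun x => (analyticAt_block a b x).continuousAt).comp hφ
  -- For k ≥ j the partial product v_k is x_j times this coefficient. At the centre of the disc the
  -- coefficients within the cluster are distinct, since only the component x_j = 0 is met.
  let σ : ℕ → ℂ → ℂ := fun k z =>
    if k < j then partialProd (φ z) k else partialProd (φ z) (j - 1) * block (φ z) (j + 1) k
  have hσlt : ∀ k < j, ∀ z, σ k z = partialProd (φ z) k := fun k hk z => if_pos hk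
  have hσge : ∀ k, j ≤ k → ∀ z, σ k z = partialProd (φ z) (j - 1) * block (φ z) (j + 1) k :=
    fun k hk z => if_neg (by omega)
  have hzero : ∀ i, 1 ≤ i → i ≤ n → i ≠ j → block (φ 0) i i ≠ 0 := fun i h1 h2 h3 =>
    hD (.zero i) ⟨h1, h2⟩ (by simpa using h3)
  have hlt0 : ∀ i < j, partialProd (φ 0) i ≠ 0 := fun i hi =>
    partialProd_ne_zero fun k h1 h2 => hzero k h1 (by omega) (by omega)
  have hone : ∀ a b, 1 ≤ a → a ≤ b → b ≤ n → (Component.one a b).eqn (φ 0) ≠ 0 :=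
    fun a b h1 h2 h3 => hD _ ⟨h1, h2, h3⟩ (by simp)
  have hψ : ∀ z, prodConf (φ z) = scaleFrom j (block (φ z) j j) fun k => σ k z := fun z =>
    conf_ext fun k hk => by
      rw [pt_prodConf hk]
      by_cases hkj : k < j
      · rw [pt_scaleFrom_of_lt hkj hk, hσlt k hkj]
      · rw [pt_scaleFrom_of_le (by omega) hk, hσge k (by omega),
          ← partialProd_mul_block (φ z) (show j - 1 ≤ k by omega),
          show j - 1 + 1 = j by omega, ← block_mul_block (φ z) (show j ≤ j + 1 by omega)
            (show j ≤ k by omega)]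
        ring
  have hC := cont_confInt_cluster hj hjn (h := fun z => block (φ z) j j) (σ := σ)
    (ψ := fun z => prodConf (φ z)) (hcb j j)
    (fun k => by
      have h1 : Continuous fun z => partialProd (φ z) k := hcb 1 k
      have h2 : Continuous fun z => partialProd (φ z) (j - 1) := hcb 1 (j - 1)
      by_cases hkj : k < j
      · rw [funext (hσlt k hkj)]
        exact h1
      · rw [funext (hσge k (by omega))]
        exact h2.mul (hcb (j + 1) k))
    h0 (fun z hz hz0 => hreg z hz hz0 (.zero j) ⟨hj, hjn.le⟩)
    (fun i hi _ => by
      rw [hσlt i hi]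
      exact hlt0 i hi)
    (fun i k hik hk hc => by
      rcases hc with hc | hc
      · rw [hσlt k hc, hσlt i (by omega)]
        exact partialProd_ne_of_eqn hik (hlt0 k hc) (hone _ _ (by omega) hik hk)
      · rw [hσge i hc, hσge k (by omega)]
        intro h1
        refine block_ne_block (by omega) hik (block_ne_zero (fun m h2 h3 =>
          hzero m (by omega) (by omega) (by omega))) (hone _ _ (by omega) hik hk)
          (mul_left_cancel₀ (hlt0 (j - 1) (by omega)) h1))
    hψ (fun z hz hz0 => injective_prodConf (hreg z hz hz0))
    (fun r hr hr1 => clusterRegion_prodConf hj hjn (hreg _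
      (by rw [Complex.norm_real, Real.norm_of_nonneg hr.le]; exact hr1) (by exact_mod_cast hr.ne'))
      (hA r hr hr1)) hl hlexp hl1
  have hC' := hC.pullback (γ' := fun t : ℝ => q (Set.projIcc 0 1 zero_le_one t)) zero_le_one
    (fun t _ => analyticAt_prodConf _) fun t ht => by rw [hq, Set.projIcc_of_mem _ ht]
  refine hC'.congr (Eventually.of_forall fun z => ?_) (Eventually.of_forall fun z => ?_)
  · exact confInt_prodConf (by omega) le_rfl z
  · simp only [Function.comp_apply, clusterGerm]
    rw [confInt_prodConf (by omega) le_rfl,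
      show Finset.Icc j (n - 1) = Finset.Ico j n by ext; simp; omega]
    congr 2
    refine Finset.sum_congr rfl fun s hs => ?_
    have hs' := Finset.mem_Ico.1 hs
    rw [confInt_prodConf (by omega) hs'.2.le, confInt_prodConf hs'.2 le_rfl]

end Polygon

/-! ### Transport of the monodromy formulas along p -/

section Branches

variable {n : ℕ}

theorem Cont.path_trans {x y w : Fin n → ℂ} {q : Path x y} {p : Path y w}
    {f g h : (Fin n → ℂ) → ℂ} (hq : Cont (fun t => q (Set.projIcc 0 1 zero_le_one t)) 0 1 f g)
    (hp : Cont (fun t => p (Set.projIcc 0 1 zero_le_one t)) 0 1 g h) :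
    Cont (fun t => q.trans p (Set.projIcc 0 1 zero_le_one t)) 0 1 f h := by
  have hc : Continuous fun t : ℝ => q.trans p (Set.projIcc 0 1 zero_le_one t) := by fun_prop
  have h1 : Cont (fun t => q.trans p (Set.projIcc 0 1 zero_le_one t)) 0 (1 / 2) f g :=
    (hq.comp (τ := fun t => 2 * t) (c := 0) (d := 1 / 2) (by fun_prop)
      (fun t ht => ⟨by linarith [ht.1], by linarith [ht.2]⟩) (by norm_num)
      (by norm_num)).congr_path (by norm_num) fun t ht => by
        have h0 : t ∈ Set.Icc (0 : ℝ) 1 := ⟨ht.1, by linarith [ht.2]⟩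
        have h2 : 2 * t ∈ Set.Icc (0 : ℝ) 1 := ⟨by linarith [ht.1], by linarith [ht.2]⟩
        simp only [Function.comp_apply]
        rw [Set.projIcc_of_mem _ h0, Set.projIcc_of_mem _ h2, Path.trans_apply, dif_pos ht.2]
  have h2 : Cont (fun t => q.trans p (Set.projIcc 0 1 zero_le_one t)) (1 / 2) 1 g h :=
    (hp.comp (τ := fun t => 2 * t - 1) (c := 1 / 2) (d := 1) (by fun_prop)
      (fun t ht => ⟨by linarith [ht.1], by linarith [ht.2]⟩) (by norm_num)
      (by norm_num)).congr_path (by norm_num) fun t ht => by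
        have h0 : t ∈ Set.Icc (0 : ℝ) 1 := ⟨by linarith [ht.1], ht.2⟩
        have h2 : 2 * t - 1 ∈ Set.Icc (0 : ℝ) 1 := ⟨by linarith [ht.1], by linarith [ht.2]⟩
        simp only [Function.comp_apply]
        rw [Set.projIcc_of_mem _ h0, Set.projIcc_of_mem _ h2, Path.trans_apply]
        split_ifs with h3
        · obtain rfl : t = 1 / 2 := le_antisymm h3 ht.1
          norm_num
        · rfl
  exact h1.trans (by norm_num) (by norm_num) h2 hc.continuousAt

theorem isBranchF_of_cont {a b : ℕ} {x y : Fin n → ℂ} {p : Path x y} {f g : (Fin n → ℂ) → ℂ}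
    (hf : IsPrincipalF a b x f)
    (hp : Cont (fun t => p (Set.projIcc 0 1 zero_le_one t)) 0 1 f g) : IsBranchF a b p g :=
  ⟨f, hf, by simpa using hp.continuesAlong⟩

/-- If the monodromy along `q` is known, the branches of the functions `F_{ab}` along paths of the
form `q.trans p` are known. -/
theorem exists_branches {x x' : Fin n → ℂ} {q : Path x x} {p : Path x x'}
    (hp : ∀ t, p t ∈ regularSet n) (hn : 0 < n) {S : Finset ℕ} (hS : ∀ s ∈ S, 1 ≤ s ∧ s < n)
    (h0 : Free 0 n (prodConf x))
    (h1 : ∀ s ∈ S, Free 0 s (prodConf x) ∧ Free s n (prodConf x)) (c : ℂ)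
    (hq : Cont (fun t : ℝ => q (Set.projIcc 0 1 zero_le_one t)) 0 1 (intF 1 n) (fun z =>
      intF 1 n z + c * ∑ s ∈ S, intF 1 s z * intF (s + 1) n z)) :
    ∃ (F : ℕ → ℕ → (Fin n → ℂ) → ℂ) (H : (Fin n → ℂ) → ℂ),
      IsBranchF 1 n p (F 1 n) ∧ IsBranchF 1 n (q.trans p) H ∧
      (∀ s ∈ S, IsBranchF 1 s p (F 1 s) ∧ IsBranchF (s + 1) n p (F (s + 1) n)) ∧
      ∀ᶠ z in 𝓝 x', H z - F 1 n z = c * ∑ s ∈ S, F 1 s z * F (s + 1) n z := by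
  have hx : x ∈ regularSet n := p.source ▸ hp 0
  -- Branches are chosen for all index pairs at once; where the integral is obstructed or the
  -- indices are out of range, the choice is 0 and never used.
  have hex : ∀ a b, ∃ g, a - 1 < b → 1 ≤ a → b ≤ n → Free (a - 1) b (prodConf x) →
      Cont (fun t => p (Set.projIcc 0 1 zero_le_one t)) 0 1 (intF a b) g := by
    intro a b
    by_cases h : a - 1 < b ∧ 1 ≤ a ∧ b ≤ n ∧ Free (a - 1) b (prodConf x)
    · obtain ⟨h2, h3, h4, h5⟩ := h
      have hc : Continuous fun t : ℝ => prodConf (p (Set.projIcc 0 1 zero_le_one t)) :=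
        continuous_prodConf.comp (by fun_prop)
      obtain ⟨g, hg⟩ := exists_cont_confInt h2 h4 hc (fun t _ => injective_prodConf (hp _))
        (by simpa using h5)
      refine ⟨g ∘ prodConf, fun _ _ _ _ => (hg.pullback zero_le_one
        (fun t _ => analyticAt_prodConf _) fun t _ => rfl).congr
          (Eventually.of_forall fun z => ?_) EventuallyEq.rfl⟩
      rw [Function.comp_apply, confInt_prodConf h2 h4, Nat.sub_add_cancel h3]
    · exact ⟨0, fun h2 h3 h4 h5 => absurd ⟨h2, h3, h4, h5⟩ h⟩
  choose F hF using hex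
  have F1n := hF 1 n hn le_rfl le_rfl h0
  have F1s : ∀ s ∈ S, Cont (fun t => p (Set.projIcc 0 1 zero_le_one t)) 0 1 (intF 1 s) (F 1 s) :=
    fun s hs => hF 1 s (hS s hs).1 le_rfl (hS s hs).2.le (h1 s hs).1
  have Fsn : ∀ s ∈ S, Cont (fun t => p (Set.projIcc 0 1 zero_le_one t)) 0 1 (intF (s + 1) n)
      (F (s + 1) n) :=
    fun s hs => hF (s + 1) n (hS s hs).2 (Nat.le_add_left 1 s) le_rfl (h1 s hs).2
  have hpr := isPrincipalF_of_free hn le_rfl hx h0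
  refine ⟨F, fun z => F 1 n z + c * ∑ s ∈ S, F 1 s z * F (s + 1) n z,
    isBranchF_of_cont hpr F1n, isBranchF_of_cont hpr (hq.path_trans
      (F1n.add ((Cont.sum S fun s hs => (F1s s hs).mul (Fsn s hs)).const_mul c))), fun s hs =>
    ⟨isBranchF_of_cont (isPrincipalF_of_free (hS s hs).1 (hS s hs).2.le hx (h1 s hs).1) (F1s s hs),
      isBranchF_of_cont (isPrincipalF_of_free (hS s hs).2 le_rfl hx (h1 s hs).2) (Fsn s hs)⟩,
    Eventually.of_forall fun z => add_sub_cancel_left _ _⟩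

theorem TurnsOnceAround.mem {D : Component} {A : Set (Fin n → ℂ)} {x : Fin n → ℂ} {q : Path x x}
    (h : TurnsOnceAround D A q) : x ∈ A := by
  obtain ⟨⟨φ, -, -, -, -, h5, h6⟩, -⟩ := h
  have h1 := h5 1 one_pos le_rfl
  have h2 := h6 0
  rw [q.source] at h2
  rw [h2]
  simpa using h1

end Branches

end MultipleLog

end

/-! ### The three monodromy formulas -/

open MultipleLog in
theorem mainTheorem5 (n : ℕ) (hn : 1 < n) :
    (∀ j : ℕ, 1 ≤ j → j < n →
      ∀ (x x' : Fin n → ℂ) (q : Path x x) (p : Path x x'), (∀ t, p t ∈ regularSet n) →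
        TurnsOnceAround (Component.zero j) (polygonRegion n j) q →
        ∃ (F : ℕ → ℕ → (Fin n → ℂ) → ℂ) (H : (Fin n → ℂ) → ℂ),
          IsBranchF 1 n p (F 1 n) ∧ IsBranchF 1 n (q.trans p) H ∧
          (∀ s ∈ Finset.Icc j (n - 1), IsBranchF 1 s p (F 1 s) ∧ IsBranchF (s + 1) n p (F (s + 1) n)) ∧
          ∀ᶠ z in nhds x', H z - F 1 n z =
            -(2 * Real.pi * Complex.I) * ∑ s ∈ Finset.Icc j (n - 1), F 1 s z * F (s + 1) n z) ∧
    (∀ j : ℕ, 1 ≤ j → j < n →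
      ∀ (x x' : Fin n → ℂ) (q : Path x x) (p : Path x x'), (∀ t, p t ∈ regularSet n) →
        TurnsOnceAround (Component.one 1 j) (triangleRegion n j) q →
        ∃ (F : ℕ → ℕ → (Fin n → ℂ) → ℂ) (H : (Fin n → ℂ) → ℂ),
          IsBranchF 1 n p (F 1 n) ∧ IsBranchF 1 n (q.trans p) H ∧
          IsBranchF 1 j p (F 1 j) ∧ IsBranchF (j + 1) n p (F (j + 1) n) ∧
          ∀ᶠ z in nhds x', H z - F 1 n z =
            2 * Real.pi * Complex.I * (F 1 j z * F (j + 1) n z)) ∧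
    (∀ j : ℕ, 2 ≤ j → j ≤ n →
      ∀ (x x' : Fin n → ℂ) (q : Path x x) (p : Path x x'), (∀ t, p t ∈ regularSet n) →
        TurnsOnceAround (Component.one j n) (triangleRegion n (j - 1)) q →
        ∃ (F : ℕ → ℕ → (Fin n → ℂ) → ℂ) (H : (Fin n → ℂ) → ℂ),
          IsBranchF 1 n p (F 1 n) ∧ IsBranchF 1 n (q.trans p) H ∧
          IsBranchF 1 (j - 1) p (F 1 (j - 1)) ∧ IsBranchF j n p (F j n) ∧
          ∀ᶠ z in nhds x', H z - F 1 n z =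
            -(2 * Real.pi * Complex.I) * (F 1 (j - 1) z * F j n z)) := by
  refine ⟨fun j hj hjn x x' q p hp h => ?_, fun j hj hjn x x' q p hp h => ?_,
    fun j hj hjn x x' q p hp h => ?_⟩
  · have hx : x ∈ regularSet n := p.source ▸ hp 0
    have hfree := (clusterRegion_prodConf hj hjn hx h.mem).clusterFree hj hjn
      (pt_ne (injective_prodConf hx) (by omega) (by omega) le_rfl)
    have hS : ∀ s ∈ Finset.Icc j (n - 1), j ≤ s ∧ s < n := fun s hs => by
      have := Finset.mem_Icc.1 hs
      omega
    exact exists_branches hp (by omega) (fun s hs => ⟨hj.trans (hS s hs).1, (hS s hs).2⟩) hfree.free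
      (fun s hs => ⟨hfree.free_left s (hS s hs).1 (hS s hs).2,
        hfree.free_right s (hS s hs).1 (hS s hs).2⟩) _
      (by simpa only [neg_mul, ← sub_eq_add_neg] using cont_around_zero hj hjn h)
  · have hT := triangleFree_prodConf hjn h.mem
    obtain ⟨F, H, h1, h2, h3, h4⟩ := exists_branches (S := {j}) hp (by omega)
      (fun s hs => by rw [Finset.mem_singleton.1 hs]; exact ⟨hj, hjn⟩) hT.free
      (fun s hs => by rw [Finset.mem_singleton.1 hs]; exact ⟨hT.free_left hjn, hT.free_right hj⟩)
      (2 * Real.pi * Complex.I)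
      (by simpa only [Finset.sum_singleton] using cont_around_one_left hj hjn h)
    have h5 := h3 j (Finset.mem_singleton_self j)
    exact ⟨F, H, h1, h2, h5.1, h5.2, by simpa only [Finset.sum_singleton] using h4⟩
  · obtain ⟨m, rfl⟩ : ∃ m, j = m + 1 := ⟨j - 1, by omega⟩
    rw [Nat.add_sub_cancel] at h ⊢
    have hm : 1 ≤ m := by omega
    have hmn : m < n := by omega
    have hT := triangleFree_prodConf hmn h.mem
    obtain ⟨F, H, h1, h2, h3, h4⟩ := exists_branches (S := {m}) hp (by omega)
      (fun s hs => by rw [Finset.mem_singleton.1 hs]; exact ⟨hm, hmn⟩) hT.free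
      (fun s hs => by rw [Finset.mem_singleton.1 hs]; exact ⟨hT.free_left hmn, hT.free_right hm⟩)
      (-(2 * Real.pi * Complex.I))
      (by simpa only [Finset.sum_singleton, neg_mul, ← sub_eq_add_neg] using
        cont_around_one_right hm hmn h)
    have h5 := h3 m (Finset.mem_singleton_self m)
    exact ⟨F, H, h1, h2, h5.1, h5.2, by simpa only [Finset.sum_singleton] using h4⟩
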